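/- Let $\Gamma$ be a finite $1$-dimensional CW complex (self-loops, multiple edges, isolated vertices and vertices of any valence are allowed) with vertex set $V$, edge set $E$ and set of half-edges (ends of edges) $H$; write $v(h)$ and $e(h)$ for the vertex and the edge of $h\in H$, and $H(v)=\{h\in H: v(h)=v\}$. Fix a parametrization of $\Gamma$: each open edge is identified with $(0,5)$, compatibly with the attaching maps, so that the point of $e(h)$ at parameter $s$ measured from the end $h$ is the point at parameter $5-s$ measured from the other end. For a vertex $v$ and $0<r\le 2$, let $\mathrm{st}_r(v)$ be the open star of radius $r$, consisting of $v$ and of all points at distance $s\in(0,r)$ from the end $h$ along some $h\in H(v)$. Let $B(\Gamma)=\bigsqcup_{k\ge 0}B_k(\Gamma)$, where $B_k(\Gamma)=\{(x_1,\dots,x_k)\in\Gamma^k: x_i\ne x_j \text{ for } i\ne j\}/\Sigma_k$ has the quotient topology, and let $\widetilde B(\Gamma)\subseteq B(\Gamma)$ be the subspace of configurations with at most one particle in $\mathrm{st}_1(v)$ for every vertex $v$. Let $A(\Gamma)$ be the set of labelings $\lambda$ assigning to each $e\in E$ a number $\lambda(e)\in\mathbb{Z}_{\ge0}$ and to each $v\in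 V$ an element $\lambda(v)\in\{\varnothing,v\}\sqcup H(v)$. Let $UK(\Gamma)$ be the quotient space of $\coprod_{\lambda\in A(\Gamma)}\{\lambda\}\times[0,1]^{\lambda^{-1}(H)}$ by the equivalence relation generated by the following identifications: whenever $\lambda(v)=h\in H(v)$ and $\epsilon\in\{0,1\}$, the cube of $\lambda_\epsilon$ is identified with the face of the cube of $\lambda$ on which the $h$-coordinate equals $\epsilon$, where $\lambda_\epsilon$ agrees with $\lambda$ except that $\lambda_0(v)=v$, respectively that $\lambda_1(v)=\varnothing$ and $\lambda_1(e(h))=\lambda(e(h))+1$. Define $\rho:B(\Gamma)\to\widetilde B(\Gamma)\to UK(\Gamma)$ as follows. 1. For a configuration $x$ and a vertex $v$, radial expansion at $v$ for time $t\ge0$ moves a point at distance $s\in(0,2]$ from $v$ along a half-edge of $v$ to distance $2(s/2)^{e^{-t}}$ along the same half-edge, and fixes $v$. Let $t(x,v)$ be the least $t\ge0$ after which at most one particle of $x$ lies in $\mathrm{st}_1(v)$. The first map expands $x$ at all vertices $v$ simultaneously, for time $t(x,v)$ at $v$, and fixes all particles at distance greater than $2$ from the vertices. 2. The second map sends $x\in\widetilde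 B(\Gamma)$ to the point of $UK(\Gamma)$ given by the following labeling and coordinates: $\lambda(v)=v$ if there is a particle at $v$; $\lambda(v)=h$, with coordinate $s\in(0,1)$, if there is a particle at distance $s$ from $v$ on $h\in H(v)$; $\lambda(v)=\varnothing$ if there is no particle in $\mathrm{st}_1(v)$; and $\lambda(e)$ is the number of particles in the subinterval $[1,4]$ of the edge $e$. Then $\rho:B(\Gamma)\to UK(\Gamma)$ is a homotopy equivalence (in particular, it is continuous). -/

import Mathlib

open Set Filter Topology

noncomputable section

/-! ### Graphs -/

/-- A parametrized finite graph structure on the (Hausdorff) space `X`, with set of vertices `V`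
and set of edges `E`: a one-dimensional CW structure in which the closed edge `e` is parametrized
by `[0, 5]` through `arc e`.  A half-edge is a pair `(e, b)`: the end of `e` at the parameter `0`
for `b = false`, and the end at the parameter `5` for `b = true`.  Self-loops, multiple edges,
isolated vertices and vertices of any valence are allowed.

If `V` and `E` are finite and `X` is Hausdorff, then `X` automatically carries the quotient topology
from `V ⊔ E × [0, 5]`, so this is exactly a finite one-dimensional CW complex with
a parametrization of its edges (only the values of `arc e` on `[0, 5]` matter). -/
structure TopGraph (V E X : Type*) [TopologicalSpace X] where
  /-- the point of `X` that a vertex is -/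
  vert : V → X
  /-- the parametrization of a closed edge by `[0, 5]` -/
  arc : E → ℝ → X
  /-- the vertex `v(h)` of a half-edge `h` -/
  endpt : E × Bool → V
  continuousOn_arc : ∀ e, ContinuousOn (arc e) (Icc 0 5)
  arc_zero : ∀ e, arc e 0 = vert (endpt (e, false))
  arc_five : ∀ e, arc e 5 = vert (endpt (e, true))
  /-- `X` is the disjoint union of its vertices and its open edges `arc e (0, 5)`, and `arc e`
  is injective on `(0, 5)` -/
  bijective : Function.Bijective
    (Sum.elim vert (fun p : E × Ioo (0 : ℝ) 5 => arc p.1 (p.2 : ℝ)))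

/-! ### Unordered configuration spaces -/

/-- The ordered configuration space of `k` points in `X`. -/
abbrev OrdConf (k : ℕ) (X : Type*) : Type _ := {x : Fin k → X // Function.Injective x}

/-- Two ordered configurations are identified if they differ by a permutation of the labels. -/
abbrev confSetoid (k : ℕ) (X : Type*) : Setoid (OrdConf k X) where
  r x y := ∃ σ : Equiv.Perm (Fin k), y.1 = x.1 ∘ σ
  iseqv :=
    { refl := fun x => ⟨1, rfl⟩
      symm := by
        rintro x y ⟨σ, h⟩
        refine ⟨σ⁻¹, ?_⟩
        rw [h]; funext i; simp
      trans := by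
        rintro x y z ⟨σ, h⟩ ⟨τ, h'⟩
        refine ⟨σ * τ, ?_⟩
        rw [h', h]; rfl }

/-- The `k`th unordered configuration space `B_k(X)`, with the quotient topology. -/
abbrev UConf (k : ℕ) (X : Type*) : Type _ := Quotient (confSetoid k X)

/-- `B(X) = ⊔_{k ≥ 0} B_k(X)`, with the topology of the disjoint union. -/
abbrev Conf (X : Type*) : Type _ := Σ k : ℕ, UConf k X

/-- The set of points occupied by a configuration. -/
def UConf.support {k : ℕ} {X : Type*} (x : UConf k X) : Set X :=
  Quotient.liftOn x (fun y => range y.1) (by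
    rintro y z ⟨σ, h⟩
    simp only [h]
    exact (σ.surjective.range_comp y.1).symm)

theorem UConf.finite_support {k : ℕ} {X : Type*} (x : UConf k X) : x.support.Finite := by
  induction x using Quotient.inductionOn with
  | h y => exact finite_range y.1

/-- The map on unordered configurations induced by an injective map. -/
def UConf.map {k : ℕ} {X Y : Type*} (f : X → Y) (hf : Function.Injective f) (x : UConf k X) :
    UConf k Y :=
  Quotient.map (fun y : OrdConf k X => (⟨f ∘ y.1, hf.comp y.2⟩ : OrdConf k Y)) (by
    rintro y z ⟨σ, h⟩
    exact ⟨σ, by simp only [h]; rfl⟩) x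

theorem UConf.support_map {k : ℕ} {X Y : Type*} (f : X → Y) (hf : Function.Injective f)
    (x : UConf k X) : (x.map f hf).support = f '' x.support := by
  induction x using Quotient.inductionOn with
  | h y => exact range_comp f y.1

/-! ### Radial expansion -/

/-- The radial expansion at time `t` of the interval `(0, 2]`. -/
def expand (t s : ℝ) : ℝ := 2 * (s / 2) ^ Real.exp (-t)

/-- The simultaneous radial expansion, on the open edge `(0, 5)`, of the initial interval `(0, 2]`
for the time `a` and of the final interval `[3, 5)` for the time `b`. -/
def edgeExpand (a b s : ℝ) : ℝ :=
  if s ≤ 2 then expand a s else if s < 3 then s else 5 - expand b (5 - s)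

theorem expand_pos {t s : ℝ} (hs : 0 < s) : 0 < expand t s := by
  unfold expand; positivity

theorem expand_le {t s : ℝ} (hs : 0 < s) (hs2 : s ≤ 2) : expand t s ≤ 2 := by
  unfold expand
  have : (s / 2) ^ Real.exp (-t) ≤ 1 :=
    Real.rpow_le_one (by positivity) (by linarith) (Real.exp_pos _).le
  linarith

theorem expand_lt {t s s' : ℝ} (hs : 0 < s) (h : s < s') : expand t s < expand t s' := by
  unfold expand
  have : (s / 2) ^ Real.exp (-t) < (s' / 2) ^ Real.exp (-t) :=
    Real.rpow_lt_rpow (by positivity) (by linarith) (Real.exp_pos _)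
  linarith

theorem continuous_expand {s : ℝ} (hs : 0 < s) : Continuous fun t => expand t s := by
  unfold expand
  have : s / 2 ≠ 0 := by positivity
  exact continuous_const.mul
    (Continuous.rpow continuous_const (by fun_prop) (fun _ => Or.inl this))

theorem tendsto_expand {s : ℝ} (hs : 0 < s) : Tendsto (fun t => expand t s) atTop (𝓝 2) := by
  have h0 : Tendsto (fun t : ℝ => Real.exp (-t)) atTop (𝓝 0) := Real.tendsto_exp_neg_atTop_nhds_zero
  have h1 : Tendsto (fun t : ℝ => (s / 2) ^ Real.exp (-t)) atTop (𝓝 ((s / 2) ^ (0 : ℝ))) :=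
    Tendsto.rpow tendsto_const_nhds h0 (Or.inl (by positivity))
  simpa [expand] using h1.const_mul 2

theorem edgeExpand_mem (a b : ℝ) {s : ℝ} (hs : s ∈ Ioo (0 : ℝ) 5) :
    edgeExpand a b s ∈ Ioo (0 : ℝ) 5 := by
  unfold edgeExpand
  obtain ⟨h0, h5⟩ := hs
  split_ifs with h h'
  · exact ⟨expand_pos h0, by linarith [expand_le (t := a) h0 h]⟩
  · exact ⟨h0, h5⟩
  · have h1 := expand_le (t := b) (s := 5 - s) (by linarith) (by linarith)
    have h2 := expand_pos (t := b) (s := 5 - s) (by linarith)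
    exact ⟨by linarith, by linarith⟩

theorem edgeExpand_lt (a b : ℝ) {s s' : ℝ} (hs : s ∈ Ioo (0 : ℝ) 5) (hs' : s' ∈ Ioo (0 : ℝ) 5)
    (hlt : s < s') : edgeExpand a b s < edgeExpand a b s' := by
  obtain ⟨h0, h5⟩ := hs
  obtain ⟨h0', h5'⟩ := hs'
  unfold edgeExpand
  split_ifs with h1 h2 h3 h4 h5 h6 h7 h8
  · exact expand_lt h0 hlt
  · linarith [expand_le (t := a) h0 h1]
  · linarith [expand_le (t := a) h0 h1, expand_le (t := b) (s := 5 - s') (by linarith) (by linarith)]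
  · linarith
  · linarith
  · linarith [expand_le (t := b) (s := 5 - s') (by linarith) (by linarith)]
  · linarith
  · linarith
  · linarith [expand_lt (t := b) (s := 5 - s') (s' := 5 - s) (by linarith) (by linarith)]

theorem edgeExpand_inj (a b : ℝ) {s s' : ℝ} (hs : s ∈ Ioo (0 : ℝ) 5) (hs' : s' ∈ Ioo (0 : ℝ) 5)
    (h : edgeExpand a b s = edgeExpand a b s') : s = s' := by
  rcases lt_trichotomy s s' with hlt | heq | hgt
  · exact absurd h (edgeExpand_lt a b hs hs' hlt).ne
  · exact heq
  · exact absurd h (edgeExpand_lt a b hs' hs hgt).ne'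

namespace TopGraph

variable {V E X : Type*} [TopologicalSpace X] (Γ : TopGraph V E X)

/-- Every point of `X` is a vertex, or a point of a unique open edge with a unique parameter. -/
def coord : V ⊕ E × Ioo (0 : ℝ) 5 ≃ X := Equiv.ofBijective _ Γ.bijective

/-- The point of the closed edge of the half-edge `h` at distance `s ∈ [0, 5]` from the end `h`. -/
def halfArc (h : E × Bool) (s : ℝ) : X := Γ.arc h.1 (if h.2 then 5 - s else s)

/-- The open star of radius `r` at the vertex `v`. -/
def openStar (v : V) (r : ℝ) : Set X :=
  {p | p = Γ.vert v ∨ ∃ h : E × Bool, Γ.endpt h = v ∧ ∃ s ∈ Ioo 0 r, p = Γ.halfArc h s}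

/-- The radial expansion of `X` that expands the closed star of radius `2` at each vertex `v` for the
time `τ v`, and fixes all vertices and all other points. -/
def push (τ : V → ℝ) (p : X) : X :=
  match Γ.coord.symm p with
  | Sum.inl v => Γ.vert v
  | Sum.inr (e, s) => Γ.arc e (edgeExpand (τ (Γ.endpt (e, false))) (τ (Γ.endpt (e, true))) s)

theorem push_vert (τ : V → ℝ) (v : V) : Γ.push τ (Γ.vert v) = Γ.vert v := by
  have : Γ.coord.symm (Γ.vert v) = Sum.inl v := by
    rw [Equiv.symm_apply_eq]; rfl
  simp [push, this]

theorem push_arc (τ : V → ℝ) (e : E) {s : ℝ} (hs : s ∈ Ioo (0 : ℝ) 5) :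
    Γ.push τ (Γ.arc e s) =
      Γ.arc e (edgeExpand (τ (Γ.endpt (e, false))) (τ (Γ.endpt (e, true))) s) := by
  have : Γ.coord.symm (Γ.arc e s) = Sum.inr (e, ⟨s, hs⟩) := by
    rw [Equiv.symm_apply_eq]; rfl
  simp [push, this]

theorem exists_eq (p : X) :
    (∃ v, p = Γ.vert v) ∨ ∃ e : E, ∃ s ∈ Ioo (0 : ℝ) 5, p = Γ.arc e s := by
  obtain ⟨q, rfl⟩ := Γ.coord.surjective p
  rcases q with v | ⟨e, s⟩
  · exact Or.inl ⟨v, rfl⟩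
  · exact Or.inr ⟨e, s, s.2, rfl⟩

theorem vert_ne_arc (v : V) (e : E) {s : ℝ} (hs : s ∈ Ioo (0 : ℝ) 5) :
    Γ.vert v ≠ Γ.arc e s := fun h => by
  have := Γ.bijective.1 (a₁ := Sum.inl v) (a₂ := Sum.inr (e, ⟨s, hs⟩)) h
  cases this

theorem vert_inj {v w : V} (h : Γ.vert v = Γ.vert w) : v = w :=
  Sum.inl_injective (Γ.bijective.1 (a₁ := Sum.inl v) (a₂ := Sum.inl w) h)

theorem arc_inj {e e' : E} {s s' : ℝ} (hs : s ∈ Ioo (0 : ℝ) 5) (hs' : s' ∈ Ioo (0 : ℝ) 5)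
    (h : Γ.arc e s = Γ.arc e' s') : e = e' ∧ s = s' := by
  have := Sum.inr_injective
    (Γ.bijective.1 (a₁ := Sum.inr (e, ⟨s, hs⟩)) (a₂ := Sum.inr (e', ⟨s', hs'⟩)) h)
  simpa using this

theorem push_injective (τ : V → ℝ) : Function.Injective (Γ.push τ) := by
  intro p q h
  rcases Γ.exists_eq p with ⟨v, rfl⟩ | ⟨e, s, hs, rfl⟩ <;>
    rcases Γ.exists_eq q with ⟨w, rfl⟩ | ⟨e', s', hs', rfl⟩
  · simpa [push_vert] using h
  · rw [push_vert, push_arc _ _ _ hs'] at h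
    exact absurd h (Γ.vert_ne_arc _ _ (edgeExpand_mem _ _ hs'))
  · rw [push_vert, push_arc _ _ _ hs] at h
    exact absurd h.symm (Γ.vert_ne_arc _ _ (edgeExpand_mem _ _ hs))
  · rw [push_arc _ _ _ hs, push_arc _ _ _ hs'] at h
    obtain ⟨rfl, h2⟩ := Γ.arc_inj (edgeExpand_mem _ _ hs) (edgeExpand_mem _ _ hs') h
    rw [edgeExpand_inj _ _ hs hs' h2]

theorem vert_mem_openStar {v w : V} : Γ.vert w ∈ Γ.openStar v 1 ↔ w = v := by
  constructor
  · rintro (h | ⟨⟨e, b⟩, -, s, hs, h⟩)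
    · exact Γ.vert_inj h
    · obtain ⟨h0, h1⟩ := hs
      refine absurd h (Γ.vert_ne_arc w e ?_)
      cases b <;> simp <;> constructor <;> linarith
  · rintro rfl; exact Or.inl rfl

theorem arc_mem_openStar {v : V} {e : E} {s : ℝ} (hs : s ∈ Ioo (0 : ℝ) 5) :
    Γ.arc e s ∈ Γ.openStar v 1 ↔
      (Γ.endpt (e, false) = v ∧ s < 1) ∨ (Γ.endpt (e, true) = v ∧ 4 < s) := by
  constructor
  · rintro (h | ⟨⟨e', b⟩, hv, s', ⟨h0, h1⟩, h⟩)
    · exact absurd h.symm (Γ.vert_ne_arc _ _ hs)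
    · cases b
      · obtain ⟨rfl, rfl⟩ := Γ.arc_inj hs (s' := s') ⟨h0, by linarith⟩ h
        exact Or.inl ⟨hv, h1⟩
      · obtain ⟨rfl, rfl⟩ := Γ.arc_inj hs (s' := 5 - s') ⟨by linarith, by linarith⟩ h
        exact Or.inr ⟨hv, by linarith⟩
  · rintro (⟨hv, h⟩ | ⟨hv, h⟩)
    · exact Or.inr ⟨(e, false), hv, s, ⟨hs.1, h⟩, rfl⟩
    · exact Or.inr ⟨(e, true), hv, 5 - s, ⟨by linarith [hs.2], by linarith⟩, by simp [halfArc]⟩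

theorem push_arc_mem_openStar (τ : V → ℝ) {v : V} {e : E} {s : ℝ} (hs : s ∈ Ioo (0 : ℝ) 5) :
    Γ.push τ (Γ.arc e s) ∈ Γ.openStar v 1 ↔
      (Γ.endpt (e, false) = v ∧ s ≤ 2 ∧ expand (τ v) s < 1) ∨
        (Γ.endpt (e, true) = v ∧ 3 ≤ s ∧ expand (τ v) (5 - s) < 1) := by
  rw [push_arc _ _ _ hs, arc_mem_openStar _ (edgeExpand_mem _ _ hs)]
  obtain ⟨h0, h5⟩ := hs
  apply or_congr
  · apply and_congr_right
    rintro rfl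
    unfold edgeExpand
    split_ifs with h h'
    · simp [h]
    · constructor
      · intro; linarith
      · rintro ⟨h1, -⟩; exact absurd h1 h
    · constructor
      · intro
        linarith [expand_le (t := τ (Γ.endpt (e, true))) (s := 5 - s) (by linarith) (by linarith)]
      · rintro ⟨h1, -⟩; exact absurd h1 h
  · apply and_congr_right
    rintro rfl
    unfold edgeExpand
    split_ifs with h h'
    · constructor
      · intro; linarith [expand_le (t := τ (Γ.endpt (e, false))) h0 h]
      · rintro ⟨h1, -⟩; linarith
    · constructor
      · intro; linarith
      · rintro ⟨h1, -⟩; linarith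
    · constructor
      · intro; exact ⟨by linarith, by linarith⟩
      · rintro ⟨-, h1⟩; linarith

/-- Whether a point ends up in the star at `v` only depends on the expansion time at `v`. -/
theorem push_mem_openStar_congr {τ τ' : V → ℝ} {v : V} (h : τ v = τ' v) (p : X) :
    Γ.push τ p ∈ Γ.openStar v 1 ↔ Γ.push τ' p ∈ Γ.openStar v 1 := by
  rcases Γ.exists_eq p with ⟨w, rfl⟩ | ⟨e, s, hs, rfl⟩
  · simp [push_vert]
  · rw [push_arc_mem_openStar _ _ hs, push_arc_mem_openStar _ _ hs, h]

theorem isClosed_push_notMem (v : V) (p : X) :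
    IsClosed {t : ℝ | Γ.push (fun _ => t) p ∉ Γ.openStar v 1} := by
  rw [← isOpen_compl_iff]
  simp only [compl_ofPred, not_not]
  rcases Γ.exists_eq p with ⟨w, rfl⟩ | ⟨e, s, hs, rfl⟩
  · simp [push_vert]
  · simp only [push_arc_mem_openStar _ _ hs]
    refine IsOpen.union ?_ ?_
    · exact isOpen_const.inter (isOpen_const.inter
        (isOpen_lt (continuous_expand hs.1) continuous_const))
    · exact isOpen_const.inter (isOpen_const.inter
        (isOpen_lt (continuous_expand (by linarith [hs.2])) continuous_const))

theorem eventually_push_notMem (v : V) {p : X} (hp : p ≠ Γ.vert v) :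
    ∀ᶠ t : ℝ in atTop, Γ.push (fun _ => t) p ∉ Γ.openStar v 1 := by
  rcases Γ.exists_eq p with ⟨w, rfl⟩ | ⟨e, s, hs, rfl⟩
  · refine Eventually.of_forall fun t h => hp ?_
    rw [push_vert, vert_mem_openStar] at h
    rw [h]
  · have h1 : ∀ᶠ t in atTop, (1 : ℝ) < expand t s :=
      (tendsto_expand hs.1).eventually (lt_mem_nhds (by norm_num))
    have h2 : ∀ᶠ t in atTop, (1 : ℝ) < expand t (5 - s) :=
      (tendsto_expand (by linarith [hs.2])).eventually (lt_mem_nhds (by norm_num))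
    filter_upwards [h1, h2] with t ht1 ht2
    rw [push_arc_mem_openStar _ _ hs]
    rintro (⟨-, -, h⟩ | ⟨-, -, h⟩) <;> linarith

/-! ### The deformation -/

/-- The set of all times `t ≥ 0` such that, after the particles in the set `S` are expanded
radially for the time `t`, at most one of them lies in the open star of radius `1` at `v`. -/
def clearTimes (S : Set X) (v : V) : Set ℝ :=
  {t | 0 ≤ t ∧ (Γ.push (fun _ => t) '' S ∩ Γ.openStar v 1).Subsingleton}

/-- The time `t(x, v)`: the least `t ≥ 0` such that radial expansion for the time `t` leaves at most
one particle in the open star of radius `1` at `v`. -/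
def expTime (S : Set X) (v : V) : ℝ := sInf (Γ.clearTimes S v)

theorem isLeast_expTime {S : Set X} (hS : S.Finite) (v : V) :
    IsLeast (Γ.clearTimes S v) (Γ.expTime S v) := by
  have hbdd : BddBelow (Γ.clearTimes S v) := ⟨0, fun t ht => ht.1⟩
  have hclosed : IsClosed (Γ.clearTimes S v) := by
    have : Γ.clearTimes S v = Ici 0 ∩ ⋂ p ∈ S, ⋂ q ∈ S, ⋂ _ : p ≠ q,
        ({t : ℝ | Γ.push (fun _ => t) p ∉ Γ.openStar v 1} ∪
          {t : ℝ | Γ.push (fun _ => t) q ∉ Γ.openStar v 1}) := by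
      ext t
      simp only [clearTimes, mem_ofPred_eq, mem_inter_iff, mem_Ici, mem_iInter, mem_union]
      refine and_congr_right fun _ => ⟨fun h p hp q hq hpq => ?_, fun h => ?_⟩
      · by_contra! hcon
        exact hpq (Γ.push_injective _
          (h ⟨mem_image_of_mem _ hp, hcon.1⟩ ⟨mem_image_of_mem _ hq, hcon.2⟩))
      · rintro _ ⟨⟨p, hp, rfl⟩, hp'⟩ _ ⟨⟨q, hq, rfl⟩, hq'⟩
        by_contra hpq
        rcases h p hp q hq (fun e => hpq (by rw [e])) with h' | h'
        · exact h' hp'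
        · exact h' hq'
    rw [this]
    refine isClosed_Ici.inter ?_
    refine isClosed_biInter fun p _ => isClosed_biInter fun q _ => isClosed_iInter fun _ => ?_
    exact (Γ.isClosed_push_notMem v p).union (Γ.isClosed_push_notMem v q)
  have hne : (Γ.clearTimes S v).Nonempty := by
    have h1 : ∀ᶠ t : ℝ in atTop, ∀ p ∈ S \ {Γ.vert v},
        Γ.push (fun _ => t) p ∉ Γ.openStar v 1 :=
      ((hS.subset sdiff_subset).eventually_all).2
        fun p hp => Γ.eventually_push_notMem v hp.2
    obtain ⟨t, ht, ht0⟩ := (h1.and (eventually_ge_atTop (0 : ℝ))).exists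
    refine ⟨t, ht0, ?_⟩
    have key : ∀ y ∈ Γ.push (fun _ => t) '' S ∩ Γ.openStar v 1, y = Γ.vert v := by
      rintro _ ⟨⟨p, hp, rfl⟩, hp'⟩
      by_cases hpv : p = Γ.vert v
      · rw [hpv, push_vert]
      · exact absurd hp' (ht p ⟨hp, hpv⟩)
    intro y hy z hz
    rw [key y hy, key z hz]
  exact ⟨hclosed.csInf_mem hne hbdd, fun t ht => csInf_le hbdd ht⟩

/-- A configuration is reduced if each open star of radius `1` holds at most one particle. -/
def IsReduced {k : ℕ} (x : UConf k X) : Prop :=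
  ∀ v, (x.support ∩ Γ.openStar v 1).Subsingleton

/-- The subspace of reduced configurations of `B(X)`. -/
abbrev RedConf : Type _ := {x : Conf X // Γ.IsReduced x.2}

/-- The result of the deformation: all stars are expanded simultaneously, the star at `v` for the
time `t(x, v)`. -/
def expandConf {k : ℕ} (x : UConf k X) : UConf k X :=
  x.map (Γ.push (Γ.expTime x.support)) (Γ.push_injective _)

theorem isReduced_expandConf {k : ℕ} (x : UConf k X) : Γ.IsReduced (Γ.expandConf x) := by
  intro v
  have h := (Γ.isLeast_expTime x.finite_support v).1.2
  rw [expandConf, UConf.support_map]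
  rintro _ ⟨⟨p, hp, rfl⟩, hp'⟩ _ ⟨⟨q, hq, rfl⟩, hq'⟩
  have hc := Γ.push_mem_openStar_congr (τ := Γ.expTime x.support)
    (τ' := fun _ => Γ.expTime x.support v) (v := v) rfl
  have := h ⟨mem_image_of_mem _ hp, (hc p).1 hp'⟩
    ⟨mem_image_of_mem _ hq, (hc q).1 hq'⟩
  rw [Γ.push_injective _ this]

/-- The retraction of `B(X)` onto the subspace of reduced configurations. -/
def deform (x : Conf X) : Γ.RedConf := ⟨⟨x.1, Γ.expandConf x.2⟩, Γ.isReduced_expandConf x.2⟩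

/-! ### The cubical model -/

/-- The set `{∅, v} ⊔ H(v)` of local states at the vertex `v`. -/
inductive LocalState (v : V) : Type _
  | empty : LocalState v
  | vertex : LocalState v
  | half (h : E × Bool) (hv : Γ.endpt h = v) : LocalState v

/-- The local state is a half-edge. -/
def LocalState.IsHalf {Γ : TopGraph V E X} {v : V} (σ : Γ.LocalState v) : Prop :=
  ∃ h hv, σ = LocalState.half h hv

/-- The set `A(Γ)` of labellings of the edges by natural numbers, and of the vertices by local
states. -/
structure Labelling where
  edge : E → ℕ
  state : ∀ v, Γ.LocalState v

/-- The cube `[0,1]^{λ⁻¹(H)}`; here `λ⁻¹(H)` is the set of vertices labelled by a half-edge. -/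
abbrev Labelling.Cube {Γ : TopGraph V E X} (l : Γ.Labelling) : Type _ :=
  {v // (l.state v).IsHalf} → Icc (0 : ℝ) 1

/-- The disjoint union of all cubes, before gluing. -/
abbrev Cubes : Type _ := Σ l : Γ.Labelling, l.Cube

/-- The elementary gluing: `q` lies in the cube of a labelling `λ` with `λ(v) = h`, where `h` is
a half-edge at `v` of the edge `e`, its coordinate at `v` is `ε ∈ {0, 1}`, and `p` is the point of
the cube of `λ_ε` with the same other coordinates; here `λ_ε` agrees with `λ` except that
`λ_0(v) = v`, respectively that `λ_1(v) = ∅` and `λ_1(e) = λ(e) + 1`. -/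
def Glue (p q : Γ.Cubes) : Prop :=
  ∃ (v : V) (h : E × Bool) (hv : Γ.endpt h = v) (hq : q.1.state v = LocalState.half h hv),
    ((p.1.state v = LocalState.vertex ∧ (∀ e, p.1.edge e = q.1.edge e) ∧
        q.2 ⟨v, h, hv, hq⟩ = 0) ∨
      (p.1.state v = LocalState.empty ∧ p.1.edge h.1 = q.1.edge h.1 + 1 ∧
        (∀ e, e ≠ h.1 → p.1.edge e = q.1.edge e) ∧ q.2 ⟨v, h, hv, hq⟩ = 1)) ∧
    (∀ w, w ≠ v → p.1.state w = q.1.state w) ∧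
    (∀ w hp hq', p.2 ⟨w, hp⟩ = q.2 ⟨w, hq'⟩)

/-- The cube complex `UK(Γ)`: the quotient, with the quotient topology, of the disjoint union of the
cubes by the equivalence relation that the gluings generate. -/
def UK : Type _ := Quot Γ.Glue

/-- Each cube carries the product topology, the set of labellings is discrete. -/
instance : TopologicalSpace Γ.UK := inferInstanceAs (TopologicalSpace (Quot Γ.Glue))

/-! ### The comparison map -/

/-- There is a particle of `S` in the interior of the half-edge `h`, that is, at a distance
`s ∈ (0, 1)` from its vertex. -/
def HasParticle (S : Set X) (h : E × Bool) : Prop := ∃ s ∈ Ioo (0 : ℝ) 1, Γ.halfArc h s ∈ S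

open Classical in
/-- The local state at `v` of the set of particles `S` (with at most one particle in the open
star of radius `1` at `v`). -/
def localState (S : Set X) (v : V) : Γ.LocalState v :=
  if Γ.vert v ∈ S then LocalState.vertex
  else if H : ∃ h : E × Bool, Γ.endpt h = v ∧ Γ.HasParticle S h then
    LocalState.half H.choose H.choose_spec.1
  else LocalState.empty

theorem localState_spec (S : Set X) (v : V) (H : (Γ.localState S v).IsHalf) :
    ∃ s : Icc (0 : ℝ) 1, (s : ℝ) ∈ Ioo (0 : ℝ) 1 ∧
      ∃ h hv, Γ.localState S v = LocalState.half h hv ∧ Γ.halfArc h s ∈ S := by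
  obtain ⟨h, hv, hh⟩ := H
  have hh' := hh
  unfold localState at hh'
  split_ifs at hh' with h1 h2
  obtain ⟨-, s, hs, hsS⟩ := h2.choose_spec
  have e : h2.choose = h := by injection hh'
  exact ⟨⟨s, hs.1.le, hs.2.le⟩, hs, h, hv, hh, e ▸ hsS⟩

/-- The labelling of a set of particles `S`: local states at the vertices, and the number of particles
in the subinterval `[1, 4]` of each edge. -/
def labelling (S : Set X) : Γ.Labelling where
  edge e := {s | s ∈ Icc (1 : ℝ) 4 ∧ Γ.arc e s ∈ S}.ncard
  state v := Γ.localState S v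

/-- The coordinates of the particles on the half-edges: if the state at `v` is the half-edge `h`, the
distance `s ∈ (0, 1)` from `v` of the particle on `h`. -/
def cubeCoord (S : Set X) : (Γ.labelling S).Cube :=
  fun v => (Γ.localState_spec S v.1 v.2).choose

/-- The map from reduced configurations to `UK(Γ)` that records the presence or absence of particles
at vertices, the coordinates of the particles in punctured open stars of radius `1`, and the number
of particles in the subinterval `[1, 4]` of each edge. -/
def record (x : Γ.RedConf) : Γ.UK :=
  Quot.mk _ ⟨Γ.labelling x.1.2.support, Γ.cubeCoord x.1.2.support⟩

/-- The comparison map `ρ : B(Γ) → UK(Γ)`. -/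
def rho (x : Conf X) : Γ.UK := Γ.record (Γ.deform x)

end TopGraph

end

/-!
The map `rho` is the composition of the retraction `deform` of `B(Γ)` onto the reduced
configurations with `record`, which forgets the positions of the particles in the interiors of the
edges. A homotopy inverse has to choose these positions. In general no continuous choice places
the particles exactly where `record` saw them: already `record` for one particle on an interval
collapses `[1, 4]` and has no continuous section. One explicit motion of particles gives the
inverse and both homotopies.

*Spreading.* On each edge, give a particle at distance `s < 1` from the left end the mass `s`,
every other particle the mass `1`, and let `a` be the total mass up to a given particle; let `b`
be the mass from that particle on, computed from the right end. The particle moves with constant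
speed to `spreadPos a b`. A particle that enters or leaves a vertex carries almost no mass, hence
this is a continuous motion on all of `B(Γ)` (`continuous_spreadConf`), and it preserves the order
of the particles on each edge. If the configuration is reduced, then the final positions depend
only on the particles in the open stars and on the number of particles on each edge, that is, on
the relation `LocEq` (`LocEq.spread_one_eq`).

*The inverse.* A point of a cube has a standard realization as a reduced configuration
(`realize`), continuous on each cube. Points that are glued to each other have `LocEq`
realizations (`locEq_of_glue`), so realizing and then spreading descends to a continuous map
`rhoInv` on `UK(Γ)`. As a reduced configuration is `LocEq` to the realization of its image
(`Reduced.locEq_realize`), `rhoInv ∘ rho` is the composition of the deformation with spreading,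
which is homotopic to the identity because both maps are ends of continuous motions. In the other
direction, `record` of the realization of `u`, spread for the time `t`, depends only on `u` and
`t`, and is a homotopy from the identity to `rho ∘ rhoInv`.

*Continuity.* Continuity of a motion is checked on the products of closed cells
(`continuous_ordConf_of_cell`). The retraction is continuous since `t(x, v)` is a function of the
distances of the particles from `v` (`expTime_range`). For `record`, the configurations whose
image lies in the closed cube of a given labelling are cut out by equations between sums of
continuous functions over the particles (`Compat`). They form a locally finite closed cover, on
each piece of which `record` lifts to the cube (`Compat.record_eq`, `continuous_record`).
-/

noncomputable section

namespace TopGraph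

variable {V E X : Type*} [TopologicalSpace X] (Γ : TopGraph V E X)

/-! ### Continuity on products with a graph -/

/-- The characteristic maps of the closed cells of a graph, on the common domain `[0, 5]`: the
closed vertices (constant maps) and the closed edges. -/
def cell : V ⊕ E → Icc (0 : ℝ) 5 → X
  | Sum.inl v, _ => Γ.vert v
  | Sum.inr e, s => Γ.arc e s

theorem continuous_cell (a : V ⊕ E) : Continuous (Γ.cell a) := by
  rcases a with v | e
  · exact continuous_const
  · exact (continuousOn_iff_continuous_domRestrict.1 (Γ.continuousOn_arc e))

theorem exists_cell_eq (p : X) : ∃ a s, Γ.cell a s = p := by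
  rcases Γ.exists_eq p with ⟨v, rfl⟩ | ⟨e, s, hs, rfl⟩
  · exact ⟨Sum.inl v, ⟨0, by simp⟩, rfl⟩
  · exact ⟨Sum.inr e, ⟨s, hs.1.le, hs.2.le⟩, rfl⟩

/-- A map on the product of an ordered configuration space with a parameter space is continuous if
it is so in the parameters of the closed cells that contain the particles: the closed cells have
compact domains, so the sum of their products is a proper surjection. -/
theorem continuous_ordConf_of_cell [Finite V] [Finite E] [T2Space X] {Z Y : Type*}
    [TopologicalSpace Z] [TopologicalSpace Y] {k : ℕ} {G : OrdConf k X × Z → Y}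
    (hG : ∀ a : Fin k → V ⊕ E, Continuous fun p : {s : Fin k → Icc (0 : ℝ) 5 //
      Function.Injective fun j => Γ.cell (a j) (s j)} × Z =>
        G (⟨fun j => Γ.cell (a j) (p.1.1 j), p.1.2⟩, p.2)) : Continuous G := by
  let π : (Σ _ : Fin k → V ⊕ E, Fin k → Icc (0 : ℝ) 5) → Fin k → X :=
    fun c j => Γ.cell (c.1 j) (c.2 j)
  have hπ : Continuous π := continuous_sigma fun a => continuous_pi fun j =>
    (Γ.continuous_cell (a j)).comp (continuous_apply j)
  have hprop : IsProperMap (Prod.map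
      ({y : Fin k → X | Function.Injective y}.restrictPreimage π) (id : Z → Z)) :=
    (hπ.isProperMap.restrictPreimage _).prodMap isProperMap_id
  have hsurj : Function.Surjective (Prod.map
      ({y : Fin k → X | Function.Injective y}.restrictPreimage π) (id : Z → Z)) := by
    refine Function.Surjective.prodMap (Set.restrictPreimage_surjective _ fun y => ?_)
      Function.surjective_id
    choose a s h using fun j => Γ.exists_cell_eq (y j)
    exact ⟨⟨a, s⟩, funext h⟩
  have hq := hprop.isClosedMap.isQuotientMap hprop.continuous hsurj
  refine hq.continuous_iff.2 ?_
  -- the domain is a disjoint union over the choice of the cells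
  have hloc : ∀ a : Fin k → V ⊕ E, IsOpen {c : {c : Σ _ : Fin k → V ⊕ E, Fin k → Icc (0 : ℝ) 5 //
      c ∈ π ⁻¹' {y | Function.Injective y}} × Z | c.1.1.1 = a} := by
    intro a
    have h1 : IsOpen (Sigma.fst ⁻¹' {a} : Set (Σ _ : Fin k → V ⊕ E, Fin k → Icc (0 : ℝ) 5)) := by
      rw [isOpen_sigma_iff]
      intro b
      by_cases h : b = a
      · subst h; convert isOpen_univ; ext; simp
      · convert isOpen_empty; ext; simp [h]
    exact h1.preimage (continuous_subtype_val.comp continuous_fst)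
  rw [continuous_iff_continuousAt]
  rintro ⟨⟨⟨a, s⟩, hs⟩, z⟩
  refine ContinuousOn.continuousAt (s := {c | c.1.1.1 = a}) ?_ ((hloc a).mem_nhds rfl)
  have hproj : ContinuousOn (fun c : {c : Σ _ : Fin k → V ⊕ E, Fin k → Icc (0 : ℝ) 5 //
      c ∈ π ⁻¹' {y | Function.Injective y}} × Z => c.1.1.2) {c | c.1.1.1 = a} := by
    have : Continuous fun c : Σ _ : Fin k → V ⊕ E, Fin k → Icc (0 : ℝ) 5 => c.2 :=
      continuous_sigma fun b => continuous_id
    exact (this.comp (continuous_subtype_val.comp continuous_fst)).continuousOn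
  rw [continuousOn_iff_continuous_domRestrict] at hproj ⊢
  have hfac : Continuous fun c : {c : {c : Σ _ : Fin k → V ⊕ E, Fin k → Icc (0 : ℝ) 5 //
      c ∈ π ⁻¹' {y | Function.Injective y}} × Z | c.1.1.1 = a} =>
      ((⟨c.1.1.1.2, by
        obtain ⟨⟨⟨⟨b, s⟩, hb⟩, z⟩, h⟩ := c
        obtain rfl : b = a := h
        exact hb⟩, c.1.2) : {s : Fin k → Icc (0 : ℝ) 5 //
        Function.Injective fun j => Γ.cell (a j) (s j)} × Z) :=
    (hproj.subtype_mk _).prodMk (continuous_snd.comp continuous_subtype_val)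
  convert (hG a).comp hfac using 1
  ext c
  obtain ⟨⟨⟨⟨b, s⟩, hb⟩, z⟩, h⟩ := c
  obtain rfl : b = a := h
  rfl

/-- A map on the product of a graph with a parameter space is continuous if it is so on each
closed cell. -/
theorem continuous_prod_of_cell [Finite V] [Finite E] [T2Space X] {Z Y : Type*}
    [TopologicalSpace Z] [TopologicalSpace Y] {G : X × Z → Y}
    (hv : ∀ v, Continuous fun z => G (Γ.vert v, z))
    (he : ∀ e, Continuous fun p : Icc (0 : ℝ) 5 × Z => G (Γ.arc e p.1, p.2)) : Continuous G := by
  let π : (Σ _ : V ⊕ E, Icc (0 : ℝ) 5) → X := fun c => Γ.cell c.1 c.2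
  have hπ : Continuous π := continuous_sigma fun a => Γ.continuous_cell a
  have hprop : IsProperMap (Prod.map π (id : Z → Z)) := hπ.isProperMap.prodMap isProperMap_id
  have hsurj : Function.Surjective (Prod.map π (id : Z → Z)) := by
    refine Function.Surjective.prodMap (fun p => ?_) Function.surjective_id
    obtain ⟨a, s, h⟩ := Γ.exists_cell_eq p
    exact ⟨⟨a, s⟩, h⟩
  refine (hprop.isClosedMap.isQuotientMap hprop.continuous hsurj).continuous_iff.2 ?_
  have : Continuous ((G ∘ Prod.map π (id : Z → Z)) ∘ Homeomorph.sigmaProdDistrib.symm) := by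
    refine continuous_sigma fun a => ?_
    rcases a with v | e
    · exact (hv v).comp continuous_snd
    · exact he e
  simpa [Function.comp_assoc] using this.comp Homeomorph.sigmaProdDistrib.continuous

/-- The function on a graph with the value `a v` at the vertex `v` and the value `f e s` at the
point of the open edge `e` with the parameter `s`. -/
def extend {α : Type*} (a : V → α) (f : E → ℝ → α) (p : X) : α :=
  match Γ.coord.symm p with
  | Sum.inl v => a v
  | Sum.inr (e, s) => f e s

theorem extend_vert {α : Type*} (a : V → α) (f : E → ℝ → α) (v : V) :
    Γ.extend a f (Γ.vert v) = a v := by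
  have : Γ.coord.symm (Γ.vert v) = Sum.inl v := by
    rw [Equiv.symm_apply_eq]; rfl
  simp [extend, this]

theorem extend_arc {α : Type*} (a : V → α) (f : E → ℝ → α) (e : E) {s : ℝ}
    (hs : s ∈ Ioo (0 : ℝ) 5) : Γ.extend a f (Γ.arc e s) = f e s := by
  have : Γ.coord.symm (Γ.arc e s) = Sum.inr (e, ⟨s, hs⟩) := by
    rw [Equiv.symm_apply_eq]; rfl
  simp [extend, this]

theorem extend_arc_of_mem_Icc {α : Type*} {a : V → α} {f : E → ℝ → α} {e : E}
    (h0 : f e 0 = a (Γ.endpt (e, false))) (h5 : f e 5 = a (Γ.endpt (e, true))) {s : ℝ}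
    (hs : s ∈ Icc (0 : ℝ) 5) : Γ.extend a f (Γ.arc e s) = f e s := by
  rcases eq_or_lt_of_le hs.1 with rfl | h
  · rw [Γ.arc_zero, extend_vert, h0]
  rcases eq_or_lt_of_le hs.2 with rfl | h'
  · rw [Γ.arc_five, extend_vert, h5]
  exact Γ.extend_arc _ _ _ ⟨h, h'⟩

theorem continuous_extend [Finite V] [Finite E] [T2Space X] {α : Type*} [TopologicalSpace α]
    {a : V → α} {f : E → ℝ → α} (hf : ∀ e, Continuous (f e))
    (h0 : ∀ e, f e 0 = a (Γ.endpt (e, false))) (h5 : ∀ e, f e 5 = a (Γ.endpt (e, true))) :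
    Continuous (Γ.extend a f) := by
  have : Continuous fun p : X × Unit => Γ.extend a f p.1 := by
    refine Γ.continuous_prod_of_cell (fun v => continuous_of_discreteTopology) fun e => ?_
    have : (fun p : Icc (0 : ℝ) 5 × Unit => Γ.extend a f (Γ.arc e p.1)) = fun p => f e p.1 := by
      ext p; exact Γ.extend_arc_of_mem_Icc (h0 e) (h5 e) p.1.2
    rw [this]
    exact (hf e).comp (continuous_subtype_val.comp continuous_fst)
  exact this.comp (continuous_id.prodMk (continuous_const (y := ())))

end TopGraph

/-! ### Maps on unordered configuration spaces -/

section Conf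

variable {X : Type*}

theorem OrdConf.finite_range {k : ℕ} (y : OrdConf k X) : (range y.1).Finite := Set.finite_range _

/-- A configuration is determined by the set of its particles. -/
theorem Conf.ext_support {x y : Conf X} (h : x.2.support = y.2.support) : x = y := by
  obtain ⟨k, x⟩ := x
  obtain ⟨l, y⟩ := y
  induction x using Quotient.inductionOn with
  | h x =>
  induction y using Quotient.inductionOn with
  | h y =>
  change range x.1 = range y.1 at h
  have hk : k = l := by
    have h1 := Nat.card_congr (Equiv.ofInjective x.1 x.2)
    have h2 := Nat.card_congr (Equiv.ofInjective y.1 y.2)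
    rw [h] at h1
    simpa using h1.trans h2.symm
  subst hk
  congr 1
  refine Quotient.sound ⟨(Equiv.ofInjective y.1 y.2).trans
    ((Equiv.setCongr h.symm).trans (Equiv.ofInjective x.1 x.2).symm), ?_⟩
  funext i
  simp only [Function.comp, Equiv.trans_apply]
  rw [Equiv.apply_ofInjective_symm x.2]
  rfl

/-- The map on unordered configurations that moves each particle `p` of a configuration with the
set of particles `S` to `F S p`. -/
def UConf.move {k : ℕ} (F : Set X → X → X) (hF : ∀ S : Set X, S.Finite → InjOn (F S) S)
    (x : UConf k X) : UConf k X :=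
  Quotient.map (fun y : OrdConf k X => (⟨fun i => F (range y.1) (y.1 i), fun i j h =>
    y.2 (hF _ y.finite_range (mem_range_self i) (mem_range_self j) h)⟩ : OrdConf k X)) (by
    rintro y z ⟨σ, h⟩
    refine ⟨σ, ?_⟩
    have : range z.1 = range y.1 := by rw [h]; exact σ.surjective.range_comp y.1
    funext i
    change F (range z.1) (z.1 i) = F (range y.1) (y.1 (σ i))
    rw [this, h]
    rfl) x

theorem UConf.support_move {k : ℕ} (F : Set X → X → X)
    (hF : ∀ S : Set X, S.Finite → InjOn (F S) S) (x : UConf k X) :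
    (x.move F hF).support = F x.support '' x.support := by
  induction x using Quotient.inductionOn with
  | h y => exact range_comp (F (range y.1)) y.1

/-- The sum of the values of a function over the particles of a configuration. -/
def total (φ : X → ℝ) (S : Set X) : ℝ := ∑ᶠ p ∈ S, φ p

theorem total_range {ι : Type*} [Fintype ι] (φ : X → ℝ) {y : ι → X} (hy : Function.Injective y) :
    total φ (range y) = ∑ i, φ (y i) := by
  rw [total, finsum_mem_range hy, finsum_eq_sum_of_fintype]

variable [TopologicalSpace X]

theorem isOpenQuotientMap_uconf (k : ℕ) :
    IsOpenQuotientMap (Quotient.mk (confSetoid k X)) := by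
  refine ⟨Quotient.mk_surjective, continuous_quotient_mk', fun U hU => ?_⟩
  rw [← isQuotientMap_quotient_mk'.isOpen_preimage]
  have : Quotient.mk (confSetoid k X) ⁻¹' (Quotient.mk (confSetoid k X) '' U) =
      ⋃ σ : Equiv.Perm (Fin k), {y : OrdConf k X |
        (⟨y.1 ∘ σ, y.2.comp σ.injective⟩ : OrdConf k X) ∈ U} := by
    ext y
    simp only [mem_preimage, mem_image, mem_iUnion, mem_ofPred_eq]
    constructor
    · rintro ⟨z, hz, h⟩
      obtain ⟨σ, hσ⟩ := Quotient.exact h.symm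
      refine ⟨σ, ?_⟩
      convert hz
      exact hσ.symm
    · rintro ⟨σ, hσ⟩
      exact ⟨_, hσ, (Quotient.sound ⟨σ, rfl⟩ : (⟦y⟧ : UConf k X) = _).symm⟩
  have hopen : IsOpen (⋃ σ : Equiv.Perm (Fin k), {y : OrdConf k X |
        (⟨y.1 ∘ σ, y.2.comp σ.injective⟩ : OrdConf k X) ∈ U}) := by
    refine isOpen_iUnion fun σ => hU.preimage (Continuous.subtype_mk ?_ _)
    exact continuous_pi fun i => (continuous_apply (σ i)).comp continuous_subtype_val
  rw [← this] at hopen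
  exact hopen

/-- The quotient maps are open, so their products with a parameter space are quotient maps. -/
theorem continuous_conf_prod {Z Y : Type*} [TopologicalSpace Z] [TopologicalSpace Y]
    {G : Conf X × Z → Y}
    (h : ∀ k, Continuous fun p : OrdConf k X × Z => G (⟨k, ⟦p.1⟧⟩, p.2)) : Continuous G := by
  have : Continuous (G ∘ Homeomorph.sigmaProdDistrib.symm) := by
    refine continuous_sigma fun k => ?_
    have hq := ((isOpenQuotientMap_uconf (X := X) k).prodMap
      (IsOpenQuotientMap.id (X := Z))).isQuotientMap
    exact hq.continuous_iff.2 (h k)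
  simpa [Function.comp_assoc] using this.comp Homeomorph.sigmaProdDistrib.continuous

theorem continuous_conf {Y : Type*} [TopologicalSpace Y] {G : Conf X → Y}
    (h : ∀ k, Continuous fun y : OrdConf k X => G ⟨k, ⟦y⟧⟩) : Continuous G :=
  continuous_sigma fun k => isQuotientMap_quotient_mk'.continuous_iff.2 (h k)

/-- A motion of the particles of a configuration that depends continuously on the ordered
configuration and on a parameter induces a continuous map on the unordered configurations. -/
theorem continuous_move {Z : Type*} [TopologicalSpace Z] (F : Z → Set X → X → X)
    (hF : ∀ z, ∀ S : Set X, S.Finite → InjOn (F z S) S)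
    (hc : ∀ k (i : Fin k), Continuous fun p : OrdConf k X × Z => F p.2 (range p.1.1) (p.1.1 i)) :
    Continuous fun p : Conf X × Z => (⟨p.1.1, p.1.2.move (F p.2) (hF p.2)⟩ : Conf X) := by
  refine continuous_conf_prod fun k => ?_
  have : Continuous fun p : OrdConf k X × Z => (⟨fun i => F p.2 (range p.1.1) (p.1.1 i),
      fun i j h => p.1.2 (hF _ _ p.1.finite_range (mem_range_self i) (mem_range_self j) h)⟩ :
        OrdConf k X) :=
    Continuous.subtype_mk (continuous_pi fun i => hc k i) _
  exact continuous_sigmaMk.comp ((isOpenQuotientMap_uconf k).continuous.comp this)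

/-- A continuous motion of particles that starts at rest is a homotopy from the identity to the map
that it reaches at the end. -/
theorem exists_homotopic_id_of_motion (F : unitInterval → Set X → X → X)
    (hF : ∀ t, ∀ S : Set X, S.Finite → InjOn (F t S) S)
    (hc : ∀ k (i : Fin k), Continuous fun p : OrdConf k X × unitInterval =>
      F p.2 (range p.1.1) (p.1.1 i))
    (h0 : ∀ S p, F 0 S p = p) :
    ∃ g : C(Conf X, Conf X), (∀ x, g x = ⟨x.1, x.2.move (F 1) (hF 1)⟩) ∧
      g.Homotopic (ContinuousMap.id _) := by
  have hcont := continuous_move F hF hc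
  refine ⟨⟨_, hcont.comp (Continuous.prodMk_left 1)⟩, fun x => rfl, ?_⟩
  refine ContinuousMap.Homotopic.symm ⟨⟨⟨_, hcont.comp continuous_swap⟩, fun x => ?_, fun x => rfl⟩⟩
  refine Conf.ext_support ?_
  simp [UConf.support_move, h0]

theorem continuous_total {φ : X → ℝ} (hφ : Continuous φ) :
    Continuous fun x : Conf X => total φ x.2.support := by
  refine continuous_conf fun k => ?_
  have : (fun y : OrdConf k X => total φ (UConf.support (⟦y⟧ : UConf k X))) =
      fun y => ∑ i, φ (y.1 i) := by
    ext y; exact total_range φ y.2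
  rw [this]
  exact continuous_finsetSum _ fun i _ =>
    hφ.comp ((continuous_apply i).comp continuous_subtype_val)

end Conf

/-! ### Radial expansion is continuous -/

theorem expand_zero (t : ℝ) : expand t 0 = 0 := by
  simp [expand, Real.zero_rpow (Real.exp_pos _).ne']

theorem expand_two (t : ℝ) : expand t 2 = 2 := by simp [expand]

theorem expand_zero_time (s : ℝ) : expand 0 s = s := by
  simp [expand]; ring

theorem le_expand {t s : ℝ} (ht : 0 ≤ t) (hs : 0 < s) (hs2 : s ≤ 2) : s ≤ expand t s := by
  have h := Real.rpow_le_rpow_of_exponent_ge (x := s / 2) (by positivity) (by linarith)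
    (Real.exp_le_one_iff.2 (neg_nonpos.2 ht))
  rw [Real.rpow_one] at h
  unfold expand
  linarith

theorem expand_mono {t s s' : ℝ} (hs : 0 ≤ s) (h : s ≤ s') : expand t s ≤ expand t s' := by
  unfold expand
  have := Real.rpow_le_rpow (z := Real.exp (-t)) (by positivity : 0 ≤ s / 2)
    (by linarith : s / 2 ≤ s' / 2) (Real.exp_pos _).le
  linarith

theorem continuous_expand_prod : Continuous fun p : ℝ × ℝ => expand p.1 p.2 := by
  unfold expand
  refine continuous_const.mul (Continuous.rpow (by fun_prop) (by fun_prop) fun p => ?_)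
  exact Or.inr (Real.exp_pos _)

theorem edgeExpand_eq (a b : ℝ) (s : ℝ) : edgeExpand a b s =
    expand a (min s 2) + (max 2 (min s 3) - 2) + (2 - expand b (min (5 - s) 2)) := by
  unfold edgeExpand
  split_ifs with h h'
  · rw [min_eq_left h, min_eq_left (by linarith : s ≤ 3), max_eq_left h,
      min_eq_right (by linarith : (2 : ℝ) ≤ 5 - s), expand_two]
    ring
  · rw [min_eq_right (by linarith : 2 ≤ s), min_eq_left h'.le, max_eq_right (by linarith),
      min_eq_right (by linarith : (2 : ℝ) ≤ 5 - s), expand_two, expand_two]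
    ring
  · rw [min_eq_right (by linarith : 2 ≤ s), min_eq_right (by linarith : 3 ≤ s),
      max_eq_right (by norm_num), min_eq_left (by linarith : 5 - s ≤ 2), expand_two]
    ring

theorem continuous_edgeExpand : Continuous fun p : ℝ × ℝ × ℝ => edgeExpand p.1 p.2.1 p.2.2 := by
  simp only [edgeExpand_eq]
  have h1 : Continuous fun p : ℝ × ℝ × ℝ => expand p.1 (min p.2.2 2) :=
    continuous_expand_prod.comp
      (continuous_fst.prodMk ((continuous_snd.comp continuous_snd).min continuous_const))
  have h2 : Continuous fun p : ℝ × ℝ × ℝ => expand p.2.1 (min (5 - p.2.2) 2) :=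
    continuous_expand_prod.comp ((continuous_fst.comp continuous_snd).prodMk
      ((continuous_const.sub (continuous_snd.comp continuous_snd)).min continuous_const))
  exact (h1.add (by fun_prop)).add (continuous_const.sub h2)

/-- The time that radial expansion takes to move a point from the distance `r ∈ (0, 1]` to the
distance `1`. -/
def exitTime (r : ℝ) : ℝ := Real.log (Real.log (2 / r) / Real.log 2)

theorem log_two_div_pos {r : ℝ} (hr : 0 < r) (hr1 : r ≤ 1) : 0 < Real.log (2 / r) := by
  apply Real.log_pos
  rw [lt_div_iff₀ hr]
  linarith

theorem expand_lt_one_iff {t r : ℝ} (hr : 0 < r) (hr1 : r ≤ 1) :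
    expand t r < 1 ↔ t < exitTime r := by
  have hlog := log_two_div_pos hr hr1
  have hlog2 : 0 < Real.log 2 := Real.log_pos (by norm_num)
  have hpow : 0 < (r / 2) ^ Real.exp (-t) := by positivity
  have h2 : Real.log (r / 2) = -Real.log (2 / r) := by rw [← Real.log_inv, inv_div]
  have h3 : Real.log (1 / 2 : ℝ) = -Real.log 2 := by simp
  rw [exitTime, Real.lt_log_iff_exp_lt (by positivity), lt_div_iff₀ hlog2]
  have h1 : expand t r < 1 ↔ (r / 2) ^ Real.exp (-t) < 1 / 2 := by
    unfold expand; constructor <;> intro h <;> linarith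
  rw [h1, ← Real.log_lt_log_iff hpow (by norm_num), Real.log_rpow (by positivity), h2, h3,
    Real.exp_neg]
  have he := Real.exp_pos t
  rw [mul_neg, neg_lt_neg_iff, inv_mul_eq_div, lt_div_iff₀ he, mul_comm]

theorem continuous_exitTime {Z : Type*} [TopologicalSpace Z] {f : Z → ℝ} (hf : Continuous f)
    (h0 : ∀ z, 0 < f z) (h1 : ∀ z, f z ≤ 1) : Continuous fun z => exitTime (f z) := by
  have hlog2 : 0 < Real.log 2 := Real.log_pos (by norm_num)
  unfold exitTime
  refine Continuous.log ((Continuous.log (continuous_const.div hf fun z => (h0 z).ne') fun z => ?_).div_const _)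
    fun z => (div_pos (log_two_div_pos (h0 z) (h1 z)) hlog2).ne'
  exact (div_pos two_pos (h0 z)).ne'

namespace TopGraph

variable {V E X : Type*} [TopologicalSpace X] (Γ : TopGraph V E X)

theorem continuous_push [Finite V] [Finite E] [T2Space X] :
    Continuous fun p : X × (V → ℝ) => Γ.push p.2 p.1 := by
  refine Γ.continuous_prod_of_cell (fun v => ?_) fun e => ?_
  · simp only [push_vert]; exact continuous_const
  · have hmem : ∀ (a b : ℝ) (s : Icc (0 : ℝ) 5), edgeExpand a b s ∈ Icc (0 : ℝ) 5 := by
      rintro a b ⟨s, h0, h5⟩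
      rcases eq_or_lt_of_le h0 with rfl | h0
      · simp [edgeExpand, expand_zero]
      rcases eq_or_lt_of_le h5 with rfl | h5
      · norm_num [edgeExpand, expand_zero]
      exact Ioo_subset_Icc_self (edgeExpand_mem a b ⟨h0, h5⟩)
    have heq : ∀ p : Icc (0 : ℝ) 5 × (V → ℝ), Γ.push p.2 (Γ.arc e p.1) =
        Γ.arc e (edgeExpand (p.2 (Γ.endpt (e, false))) (p.2 (Γ.endpt (e, true))) p.1) := by
      rintro ⟨⟨s, h0, h5⟩, τ⟩
      rcases eq_or_lt_of_le h0 with rfl | h0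
      · simp [edgeExpand, expand_zero, Γ.arc_zero, push_vert]
      rcases eq_or_lt_of_le h5 with rfl | h5
      · norm_num [edgeExpand, expand_zero, Γ.arc_five, push_vert]
      exact Γ.push_arc τ e ⟨h0, h5⟩
    simp only [heq]
    refine (Γ.continuousOn_arc e).comp_continuous ?_ fun p => hmem _ _ _
    exact continuous_edgeExpand.comp (f := fun p : Icc (0 : ℝ) 5 × (V → ℝ) =>
      (p.2 (Γ.endpt (e, false)), p.2 (Γ.endpt (e, true)), (p.1 : ℝ))) (by fun_prop)

open Classical in
/-- The function that is `1 - s` at the points at distance `s ∈ [0, 1]` from the vertex `v`, and `0`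
outside the open star of radius `1`. -/
def bump (v : V) : X → ℝ :=
  Γ.extend (fun w => if w = v then 1 else 0) fun e s =>
    (if Γ.endpt (e, false) = v then max 0 (1 - s) else 0) +
      if Γ.endpt (e, true) = v then max 0 (s - 4) else 0

theorem continuous_bump [Finite V] [Finite E] [T2Space X] (v : V) : Continuous (Γ.bump v) := by
  classical
  refine Γ.continuous_extend (fun e => Continuous.add ?_ ?_) (fun e => ?_) (fun e => ?_)
  · split_ifs <;> fun_prop
  · split_ifs <;> fun_prop
  · norm_num
  · norm_num

theorem bump_vert_self (v : V) : Γ.bump v (Γ.vert v) = 1 := by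
  simp [bump, extend_vert]

theorem bump_nonneg (v : V) (p : X) : 0 ≤ Γ.bump v p := by
  classical
  rcases Γ.exists_eq p with ⟨w, rfl⟩ | ⟨e, s, hs, rfl⟩
  · rw [bump, extend_vert]; split_ifs <;> norm_num
  · rw [bump, extend_arc _ _ _ _ hs]
    split_ifs <;> positivity

theorem bump_arc_left {v : V} {e : E} {s : ℝ} (hs : 0 < s) (h : s ≤ 4)
    (he : Γ.endpt (e, false) = v) : Γ.bump v (Γ.arc e s) = max 0 (1 - s) := by
  rw [bump, extend_arc _ _ _ _ ⟨hs, by linarith⟩, if_pos he]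
  split_ifs <;> simp; linarith

theorem bump_arc_right {v : V} {e : E} {s : ℝ} (hs : 1 ≤ s) (h : s < 5)
    (he : Γ.endpt (e, true) = v) : Γ.bump v (Γ.arc e s) = max 0 (s - 4) := by
  rw [bump, extend_arc _ _ _ _ ⟨by linarith, by linarith⟩, if_pos he]
  split_ifs <;> simp; linarith

theorem bump_eq_zero {v : V} {p : X} (hp : p ∉ Γ.openStar v 1) : Γ.bump v p = 0 := by
  classical
  rcases Γ.exists_eq p with ⟨w, rfl⟩ | ⟨e, s, hs, rfl⟩
  · rw [vert_mem_openStar] at hp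
    simp [bump, extend_vert, hp]
  · rw [arc_mem_openStar _ hs] at hp
    push Not at hp
    rw [bump, extend_arc _ _ _ _ hs]
    split_ifs with h1 h2 h2
    · have := hp.1 h1; have := hp.2 h2
      rw [max_eq_left (by linarith), max_eq_left (by linarith), add_zero]
    · have := hp.1 h1
      rw [max_eq_left (by linarith), add_zero]
    · have := hp.2 h2
      rw [max_eq_left (by linarith), add_zero]
    · simp

theorem halfArc_zero (h : E × Bool) : Γ.halfArc h 0 = Γ.vert (Γ.endpt h) := by
  rcases h with ⟨e, _ | _⟩
  · simp [halfArc, Γ.arc_zero]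
  · simp [halfArc, Γ.arc_five]

theorem bump_halfArc {v : V} {h : E × Bool} (hv : Γ.endpt h = v) {r : ℝ} (hr : r ∈ Icc (0 : ℝ) 1) :
    Γ.bump v (Γ.halfArc h r) = 1 - r := by
  rcases eq_or_lt_of_le hr.1 with rfl | h0
  · rw [halfArc_zero, hv, bump_vert_self, sub_zero]
  rcases h with ⟨e, _ | _⟩
  · rw [show Γ.halfArc (e, false) r = Γ.arc e r from rfl,
      Γ.bump_arc_left h0 (by linarith [hr.2]) hv, max_eq_right (by linarith [hr.2])]
  · rw [show Γ.halfArc (e, true) r = Γ.arc e (5 - r) from rfl,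
      Γ.bump_arc_right (by linarith [hr.2]) (by linarith) hv, max_eq_right (by linarith [hr.2])]
    ring

theorem bump_le_one (v : V) (p : X) : Γ.bump v p ≤ 1 := by
  by_cases hp : p ∈ Γ.openStar v 1
  · rcases hp with rfl | ⟨h, hv, r, hr, rfl⟩
    · rw [bump_vert_self]
    · rw [Γ.bump_halfArc hv ⟨hr.1.le, hr.2.le⟩]; linarith [hr.1]
  · rw [Γ.bump_eq_zero hp]; norm_num

theorem bump_lt_one {v : V} {p : X} (hp : p ≠ Γ.vert v) : Γ.bump v p < 1 := by
  by_cases hp' : p ∈ Γ.openStar v 1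
  · rcases hp' with rfl | ⟨h, hv, r, hr, rfl⟩
    · exact absurd rfl hp
    · rw [Γ.bump_halfArc hv ⟨hr.1.le, hr.2.le⟩]; linarith [hr.1]
  · rw [Γ.bump_eq_zero hp']; norm_num

theorem push_mem_openStar_iff {t : ℝ} (ht : 0 ≤ t) (v : V) (p : X) :
    Γ.push (fun _ => t) p ∈ Γ.openStar v 1 ↔ expand t (1 - Γ.bump v p) < 1 := by
  have h1 : 1 ≤ expand t 1 := le_expand ht one_pos one_le_two
  rcases Γ.exists_eq p with ⟨w, rfl⟩ | ⟨e, s, hs, rfl⟩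
  · rw [push_vert]
    by_cases hw : w = v
    · subst hw
      simp [bump_vert_self, expand_zero, vert_mem_openStar]
    · have : Γ.vert w ∉ Γ.openStar v 1 := fun h => hw (Γ.vert_mem_openStar.1 h)
      rw [Γ.bump_eq_zero this, sub_zero]
      exact ⟨fun h => absurd h this, fun h => absurd h h1.not_gt⟩
  · rw [push_arc_mem_openStar _ _ hs]
    obtain ⟨h0, h5⟩ := hs
    constructor
    · rintro (⟨hv, h2, hlt⟩ | ⟨hv, h2, hlt⟩)
      · have := le_expand ht h0 h2
        rw [Γ.bump_arc_left h0 (by linarith) hv, max_eq_right (by linarith)]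
        simpa using hlt
      · have := le_expand ht (by linarith : 0 < 5 - s) (by linarith)
        rw [Γ.bump_arc_right (by linarith) h5 hv, max_eq_right (by linarith)]
        convert hlt using 2; ring
    · intro hlt
      have hstar : Γ.arc e s ∈ Γ.openStar v 1 := by
        by_contra hn
        rw [Γ.bump_eq_zero hn, sub_zero] at hlt
        exact absurd hlt h1.not_gt
      rw [arc_mem_openStar _ ⟨h0, h5⟩] at hstar
      rcases hstar with ⟨hv, h⟩ | ⟨hv, h⟩
      · rw [Γ.bump_arc_left h0 (by linarith) hv, max_eq_right (by linarith)] at hlt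
        exact Or.inl ⟨hv, by linarith, by simpa using hlt⟩
      · rw [Γ.bump_arc_right (by linarith) h5 hv, max_eq_right (by linarith)] at hlt
        refine Or.inr ⟨hv, by linarith, ?_⟩
        convert hlt using 2; ring

theorem max_one_sub_bump_pos {v : V} {p q : X} (hpq : p ≠ q) :
    0 < max (1 - Γ.bump v p) (1 - Γ.bump v q) := by
  by_cases hp : p = Γ.vert v
  · refine lt_max_of_lt_right ?_
    linarith [Γ.bump_lt_one (v := v) (p := q) (fun h => hpq (hp.trans h.symm))]
  · refine lt_max_of_lt_left ?_
    linarith [Γ.bump_lt_one hp]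

/-- The expansion time at `v` is the largest time at which two particles are both still in the star:
the time at which the second closest particle leaves it. -/
theorem expTime_range {k : ℕ} {y : Fin k → X} (hy : Function.Injective y) (v : V) :
    Γ.expTime (range y) v = ((Finset.univ : Finset (Fin k × Fin k)).sup fun c =>
      if c.1 = c.2 then 0 else
        Real.toNNReal (exitTime (max (1 - Γ.bump v (y c.1)) (1 - Γ.bump v (y c.2)))) : NNReal) := by
  refine (Γ.isLeast_expTime (finite_range y) v).unique ?_
  have key : ∀ t : ℝ, 0 ≤ t → (t ∈ Γ.clearTimes (range y) v ↔
      ∀ i j, i ≠ j → exitTime (max (1 - Γ.bump v (y i)) (1 - Γ.bump v (y j))) ≤ t) := by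
    intro t ht
    have hboth : ∀ i j, i ≠ j → (exitTime (max (1 - Γ.bump v (y i)) (1 - Γ.bump v (y j))) ≤ t ↔
        ¬ (Γ.push (fun _ => t) (y i) ∈ Γ.openStar v 1 ∧
          Γ.push (fun _ => t) (y j) ∈ Γ.openStar v 1)) := by
      intro i j hij
      have hi := Γ.bump_le_one v (y i)
      have hj := Γ.bump_le_one v (y j)
      have hi' := Γ.bump_nonneg v (y i)
      have hj' := Γ.bump_nonneg v (y j)
      rw [push_mem_openStar_iff _ ht, push_mem_openStar_iff _ ht, ← not_lt,
        ← expand_lt_one_iff (Γ.max_one_sub_bump_pos (hy.ne hij)) (max_le (by linarith) (by linarith)),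
        not_iff_not]
      constructor
      · intro h
        exact ⟨(expand_mono (by linarith) (le_max_left _ _)).trans_lt h,
          (expand_mono (by linarith) (le_max_right _ _)).trans_lt h⟩
      · rintro ⟨h1, h2⟩
        rcases max_choice (1 - Γ.bump v (y i)) (1 - Γ.bump v (y j)) with h | h <;> rw [h] <;>
          assumption
    constructor
    · rintro ⟨-, h⟩ i j hij
      rw [hboth i j hij]
      rintro ⟨h1, h2⟩
      exact hij (hy (Γ.push_injective _ (h ⟨mem_image_of_mem _ (mem_range_self i), h1⟩
        ⟨mem_image_of_mem _ (mem_range_self j), h2⟩)))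
    · intro h
      refine ⟨ht, ?_⟩
      rintro _ ⟨⟨_, ⟨i, rfl⟩, rfl⟩, h1⟩ _ ⟨⟨_, ⟨j, rfl⟩, rfl⟩, h2⟩
      by_contra hne
      have hij : i ≠ j := fun h => hne (by rw [h])
      exact (hboth i j hij).1 (h i j hij) ⟨h1, h2⟩
  constructor
  · rw [key _ NNReal.zero_le_coe]
    intro i j hij
    have := Finset.le_sup (f := fun c : Fin k × Fin k => if c.1 = c.2 then 0 else
        Real.toNNReal (exitTime (max (1 - Γ.bump v (y c.1)) (1 - Γ.bump v (y c.2)))))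
        (Finset.mem_univ (i, j))
    simp only [if_neg hij] at this
    exact Real.toNNReal_le_iff_le_coe.1 this
  · intro t ht
    have ht0 : 0 ≤ t := ht.1
    rw [key t ht0] at ht
    rw [← Real.coe_toNNReal t ht0, NNReal.coe_le_coe]
    refine Finset.sup_le fun c _ => ?_
    split_ifs with h
    · exact zero_le
    · exact Real.toNNReal_le_toNNReal (ht _ _ h)

theorem continuous_expTime [Finite V] [Finite E] [T2Space X] (k : ℕ) (v : V) :
    Continuous fun y : OrdConf k X => Γ.expTime (range y.1) v := by
  have : (fun y : OrdConf k X => Γ.expTime (range y.1) v) = _ :=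
    funext fun y => Γ.expTime_range y.2 v
  rw [this]
  refine NNReal.continuous_coe.comp (Continuous.finset_sup_apply fun c _ => ?_)
  by_cases h : c.1 = c.2
  · simp only [if_pos h]; exact continuous_const
  · simp only [if_neg h]
    have hb : ∀ i, Continuous fun y : OrdConf k X => 1 - Γ.bump v (y.1 i) := fun i =>
      continuous_const.sub ((Γ.continuous_bump v).comp
        ((continuous_apply i).comp continuous_subtype_val))
    refine continuous_real_toNNReal.comp (continuous_exitTime ((hb _).max (hb _))
      (fun y => Γ.max_one_sub_bump_pos (y.2.ne h)) fun y => max_le ?_ ?_)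
    · linarith [Γ.bump_nonneg v (y.1 c.1)]
    · linarith [Γ.bump_nonneg v (y.1 c.2)]

theorem push_zero (p : X) : Γ.push (fun _ => 0) p = p := by
  rcases Γ.exists_eq p with ⟨w, rfl⟩ | ⟨e, s, hs, rfl⟩
  · rw [push_vert]
  · rw [push_arc _ _ _ hs]
    congr 1
    unfold edgeExpand
    split_ifs <;> simp [expand_zero_time]

/-- The retraction onto the reduced configurations is a continuous self-map of `B(X)`, and it is
homotopic to the identity: multiply all expansion times by `t ∈ [0, 1]`. -/
theorem exists_deform_homotopic_id [Finite V] [Finite E] [T2Space X] :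
    ∃ g : C(Conf X, Conf X), (∀ x, g x = (Γ.deform x).1) ∧
      g.Homotopic (ContinuousMap.id _) := by
  have hc : ∀ k (i : Fin k), Continuous fun p : OrdConf k X × unitInterval =>
      Γ.push (fun v => p.2 * Γ.expTime (range p.1.1) v) (p.1.1 i) := fun k i => by
    have hy : Continuous fun p : OrdConf k X × unitInterval => p.1.1 i :=
      (continuous_apply i).comp (continuous_subtype_val.comp continuous_fst)
    have hτ : Continuous fun (p : OrdConf k X × unitInterval) (v : V) =>
        (p.2 : ℝ) * Γ.expTime (range p.1.1) v := continuous_pi fun v =>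
      (continuous_subtype_val.comp continuous_snd).mul
        ((Γ.continuous_expTime k v).comp continuous_fst)
    have := Γ.continuous_push.comp (hy.prodMk hτ)
    exact this
  obtain ⟨g, hg, hhom⟩ := exists_homotopic_id_of_motion
    (fun (t : unitInterval) S => Γ.push (fun v => t * Γ.expTime S v))
    (fun t S _ => (Γ.push_injective _).injOn) hc (fun S p => by simp [push_zero])
  refine ⟨g, fun x => ?_, hhom⟩
  rw [hg]
  refine Conf.ext_support ?_
  simp only [UConf.support_move, deform, expandConf, UConf.support_map]
  simp

theorem continuous_deform [Finite V] [Finite E] [T2Space X] : Continuous Γ.deform := by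
  obtain ⟨g, hg, -⟩ := Γ.exists_deform_homotopic_id
  have : Subtype.val ∘ Γ.deform = g := funext fun x => (hg x).symm
  exact continuous_induced_rng.2 (this ▸ g.continuous)

end TopGraph

/-! ### Spreading the particles on an edge -/

/-- The position in `[0, 5]` of a particle with the mass `a` of particles to the left of it and the
mass `b` to the right of it, each including its own.  A particle with `a < 1` is in the star at
the left end, at a distance that tends to `0` with `a`; a particle with `a, b ≥ 1` is in `[1, 4]`. -/
def spreadPos (a b : ℝ) : ℝ := min a 1 + 3 * a / (a + b) + 1 - min b 1

theorem spreadPos_swap {a b : ℝ} (h : 0 < a + b) : spreadPos b a = 5 - spreadPos a b := by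
  unfold spreadPos
  have h' : 3 * b / (b + a) = 3 - 3 * a / (a + b) := by
    rw [add_comm b a]; field_simp; ring
  rw [h']; ring

theorem spreadPos_nonneg {a b : ℝ} (ha : 0 ≤ a) (hb : 0 ≤ b) : 0 ≤ spreadPos a b := by
  unfold spreadPos
  have h1 : 0 ≤ min a 1 := le_min ha zero_le_one
  have h2 : 0 ≤ 3 * a / (a + b) := by positivity
  have h3 := min_le_right b 1
  linarith

theorem spreadPos_pos {a b : ℝ} (ha : 0 < a) (hb : 0 ≤ b) : 0 < spreadPos a b := by
  unfold spreadPos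
  have h1 : 0 < min a 1 := lt_min ha zero_lt_one
  have h2 : 0 ≤ 3 * a / (a + b) := by positivity
  have h3 := min_le_right b 1
  linarith

theorem one_le_spreadPos {a b : ℝ} (ha : 1 ≤ a) (hb : 0 ≤ b) : 1 ≤ spreadPos a b := by
  unfold spreadPos
  have h2 : 0 ≤ 3 * a / (a + b) := by positivity
  have h3 := min_le_right b 1
  rw [min_eq_right ha]
  linarith

theorem spreadPos_zero {b : ℝ} (hb : 1 ≤ b) : spreadPos 0 b = 0 := by
  simp [spreadPos, hb]

theorem spreadPos_le {a b : ℝ} (ha : 0 ≤ a) (hb : 0 ≤ b) (h : 0 < a + b) : spreadPos a b ≤ 5 := by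
  have := spreadPos_nonneg hb ha
  rw [spreadPos_swap h] at this
  linarith

theorem spreadPos_lt {a b : ℝ} (ha : 0 ≤ a) (hb : 0 < b) : spreadPos a b < 5 := by
  have := spreadPos_pos hb ha
  rw [spreadPos_swap (by linarith)] at this
  linarith

theorem spreadPos_le_four {a b : ℝ} (ha : 0 ≤ a) (hb : 1 ≤ b) : spreadPos a b ≤ 4 := by
  have := one_le_spreadPos hb ha
  rw [spreadPos_swap (by linarith)] at this
  linarith

theorem spreadPos_five {a : ℝ} (ha : 1 ≤ a) : spreadPos a 0 = 5 := by
  have := spreadPos_swap (a := 0) (b := a) (by linarith)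
  rw [this, spreadPos_zero ha, sub_zero]

theorem spreadPos_strictMono {a b a' b' : ℝ} (ha : 0 < a) (hb : 0 < b') (haa : a < a')
    (hbb : b' < b) : spreadPos a b < spreadPos a' b' := by
  unfold spreadPos
  have h1 : min a 1 ≤ min a' 1 := min_le_min_right _ haa.le
  have h2 : min b' 1 ≤ min b 1 := min_le_min_right _ hbb.le
  have h3 : 3 * a / (a + b) < 3 * a' / (a' + b') := by
    rw [div_lt_div_iff₀ (by linarith) (by linarith)]
    nlinarith [mul_lt_mul'' haa hbb ha.le hb.le]
  linarith

/-- The mass of the particles in `A ⊆ (0, 5)` up to `s`, where a particle at distance `a < 1` from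
the left end has the mass `a`, and other particles have the mass `1`. -/
def massLeft (A : Finset ℝ) (s : ℝ) : ℝ := ∑ a ∈ A with a ≤ s, min 1 a

/-- The mass of the particles in `A ⊆ (0, 5)` from `s` on, where a particle at distance `a < 1` from
the right end has the mass `a`, and other particles have the mass `1`. -/
def massRight (A : Finset ℝ) (s : ℝ) : ℝ := ∑ a ∈ A with s ≤ a, min 1 (5 - a)

section mass

variable {A : Finset ℝ} (hA : ∀ a ∈ A, a ∈ Ioo (0 : ℝ) 5)

include hA

theorem massLeft_nonneg (s : ℝ) : 0 ≤ massLeft A s :=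
  Finset.sum_nonneg fun a ha => le_min zero_le_one (hA a (Finset.mem_filter.1 ha).1).1.le

theorem massRight_nonneg (s : ℝ) : 0 ≤ massRight A s :=
  Finset.sum_nonneg fun a ha => le_min zero_le_one
    (by linarith [(hA a (Finset.mem_filter.1 ha).1).2])

theorem le_massLeft {a s : ℝ} (ha : a ∈ A) (h : a ≤ s) : min 1 a ≤ massLeft A s :=
  Finset.single_le_sum (f := fun a => min 1 a)
    (fun a ha => le_min zero_le_one (hA a (Finset.mem_filter.1 ha).1).1.le)
    (Finset.mem_filter.2 ⟨ha, h⟩)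

theorem le_massRight {a s : ℝ} (ha : a ∈ A) (h : s ≤ a) : min 1 (5 - a) ≤ massRight A s :=
  Finset.single_le_sum (f := fun a => min 1 (5 - a))
    (fun a ha => le_min zero_le_one (by linarith [(hA a (Finset.mem_filter.1 ha).1).2]))
    (Finset.mem_filter.2 ⟨ha, h⟩)

theorem massLeft_pos {s : ℝ} (hs : s ∈ A) : 0 < massLeft A s :=
  (lt_min zero_lt_one (hA s hs).1).trans_le (le_massLeft hA hs le_rfl)

theorem massRight_pos {s : ℝ} (hs : s ∈ A) : 0 < massRight A s :=
  (lt_min zero_lt_one (by linarith [(hA s hs).2])).trans_le (le_massRight hA hs le_rfl)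

theorem massLeft_lt {s s' : ℝ} (h : s < s') (hs' : s' ∈ A) : massLeft A s < massLeft A s' := by
  refine Finset.sum_lt_sum_of_subset (i := s') (fun a ha => ?_)
    (Finset.mem_filter.2 ⟨hs', le_rfl⟩) (fun h' => absurd (Finset.mem_filter.1 h').2 h.not_ge)
    (lt_min zero_lt_one (hA s' hs').1)
    fun a ha _ => le_min zero_le_one (hA a (Finset.mem_filter.1 ha).1).1.le
  have := Finset.mem_filter.1 ha
  exact Finset.mem_filter.2 ⟨this.1, this.2.trans h.le⟩

theorem massRight_lt {s s' : ℝ} (h : s < s') (hs : s ∈ A) : massRight A s' < massRight A s := by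
  refine Finset.sum_lt_sum_of_subset (i := s) (fun a ha => ?_)
    (Finset.mem_filter.2 ⟨hs, le_rfl⟩) (fun h' => absurd (Finset.mem_filter.1 h').2 h.not_ge)
    (lt_min zero_lt_one (by linarith [(hA s hs).2]))
    fun a ha _ => le_min zero_le_one (by linarith [(hA a (Finset.mem_filter.1 ha).1).2])
  have := Finset.mem_filter.1 ha
  exact Finset.mem_filter.2 ⟨this.1, h.le.trans this.2⟩

end mass

/-- The position at the time `t ∈ [0, 1]` of the particle at `s` of the set of particles
`A ⊆ (0, 5)`: it moves with constant speed from `s` to its spread position. -/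
def edgeSpread (t : ℝ) (A : Finset ℝ) (s : ℝ) : ℝ :=
  (1 - t) * s + t * spreadPos (massLeft A s) (massRight A s)

theorem edgeSpread_mem {t : ℝ} (ht : t ∈ Icc (0 : ℝ) 1) {A : Finset ℝ}
    (hA : ∀ a ∈ A, a ∈ Ioo (0 : ℝ) 5) {s : ℝ} (hs : s ∈ A) : edgeSpread t A s ∈ Ioo (0 : ℝ) 5 := by
  have h1 := massLeft_pos hA hs
  have h2 := massRight_pos hA hs
  exact convex_Ioo 0 5 (hA s hs) ⟨spreadPos_pos h1 h2.le, spreadPos_lt h1.le h2⟩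
    (by linarith [ht.2]) ht.1 (by ring)

theorem edgeSpread_lt {t : ℝ} (ht : t ∈ Icc (0 : ℝ) 1) {A : Finset ℝ}
    (hA : ∀ a ∈ A, a ∈ Ioo (0 : ℝ) 5) {s s' : ℝ} (hs : s ∈ A) (hs' : s' ∈ A) (h : s < s') :
    edgeSpread t A s < edgeSpread t A s' := by
  have h1 := spreadPos_strictMono (massLeft_pos hA hs) (massRight_pos hA hs')
    (massLeft_lt hA h hs') (massRight_lt hA h hs)
  unfold edgeSpread
  rcases eq_or_lt_of_le ht.1 with rfl | h0
  · simpa using h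
  · have := mul_lt_mul_of_pos_left h1 h0
    have := mul_le_mul_of_nonneg_left h.le (by linarith [ht.2] : 0 ≤ 1 - t)
    linarith

theorem one_le_edgeSpread {t : ℝ} (ht : t ∈ Icc (0 : ℝ) 1) {A : Finset ℝ}
    (hA : ∀ a ∈ A, a ∈ Ioo (0 : ℝ) 5) {s : ℝ} (hs : s ∈ A) (h : 1 ≤ s) :
    1 ≤ edgeSpread t A s := by
  have h1 := le_massLeft hA hs le_rfl
  rw [min_eq_left h] at h1
  have := one_le_spreadPos h1 (massRight_nonneg hA s)
  exact (convex_Ici (1 : ℝ)) h this (by linarith [ht.2]) ht.1 (by ring)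

theorem edgeSpread_le_four {t : ℝ} (ht : t ∈ Icc (0 : ℝ) 1) {A : Finset ℝ}
    (hA : ∀ a ∈ A, a ∈ Ioo (0 : ℝ) 5) {s : ℝ} (hs : s ∈ A) (h : s ≤ 4) :
    edgeSpread t A s ≤ 4 := by
  have h1 := le_massRight hA hs le_rfl
  rw [min_eq_left (by linarith)] at h1
  have := spreadPos_le_four (massLeft_nonneg hA s) h1
  exact (convex_Iic (4 : ℝ)) h this (by linarith [ht.2]) ht.1 (by ring)

namespace TopGraph

variable {V E X : Type*} [TopologicalSpace X] (Γ : TopGraph V E X)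

theorem injOn_arc (e : E) : InjOn (Γ.arc e) (Ioo 0 5) := fun _ hs _ hs' h =>
  (Γ.arc_inj hs hs' h).2

open Classical in
/-- The parameters of the particles of a finite set `S` on the open edge `e`. -/
def onEdge (S : Set X) (e : E) : Finset ℝ :=
  if h : {s | s ∈ Ioo (0 : ℝ) 5 ∧ Γ.arc e s ∈ S}.Finite then h.toFinset else ∅

theorem mem_onEdge {S : Set X} (hS : S.Finite) {e : E} {s : ℝ} :
    s ∈ Γ.onEdge S e ↔ s ∈ Ioo (0 : ℝ) 5 ∧ Γ.arc e s ∈ S := by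
  have h : {s | s ∈ Ioo (0 : ℝ) 5 ∧ Γ.arc e s ∈ S}.Finite :=
    Finite.of_finite_image (hS.subset (by rintro _ ⟨s, hs, rfl⟩; exact hs.2))
      ((Γ.injOn_arc e).mono fun s hs => hs.1)
  rw [onEdge, dif_pos h]
  simp

theorem onEdge_subset (S : Set X) (e : E) : ∀ a ∈ Γ.onEdge S e, a ∈ Ioo (0 : ℝ) 5 := by
  intro a ha
  unfold onEdge at ha
  split_ifs at ha with h
  · exact ((Set.Finite.mem_toFinset h).1 ha).1
  · simp at ha

theorem total_eq_sum_onEdge {S : Set X} (hS : S.Finite) (e : E) {φ : X → ℝ}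
    (hφ : ∀ p, φ p ≠ 0 → ∃ s ∈ Ioo (0 : ℝ) 5, p = Γ.arc e s) :
    total φ S = ∑ s ∈ Γ.onEdge S e, φ (Γ.arc e s) := by
  have hinj : InjOn (Γ.arc e) (Γ.onEdge S e : Set ℝ) :=
    (Γ.injOn_arc e).mono fun s hs => Γ.onEdge_subset S e s hs
  rw [total, ← finsum_mem_coe_finset, ← finsum_mem_image hinj]
  refine finsum_mem_inter_support_eq' _ _ _ fun p hp => ?_
  obtain ⟨s, hs, rfl⟩ := hφ p hp
  constructor
  · intro h
    exact ⟨s, (Γ.mem_onEdge hS).2 ⟨hs, h⟩, rfl⟩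
  · rintro ⟨s', hs', h⟩
    rw [← h]
    exact ((Γ.mem_onEdge hS).1 hs').2

/-- The motion that spreads the particles of `S` on each edge, at the time `t ∈ [0, 1]`. -/
def spread (t : ℝ) (S : Set X) : X → X :=
  Γ.extend Γ.vert fun e s => Γ.arc e (edgeSpread t (Γ.onEdge S e) s)

theorem spread_vert (t : ℝ) (S : Set X) (v : V) : Γ.spread t S (Γ.vert v) = Γ.vert v :=
  Γ.extend_vert _ _ v

theorem spread_arc (t : ℝ) (S : Set X) (e : E) {s : ℝ} (hs : s ∈ Ioo (0 : ℝ) 5) :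
    Γ.spread t S (Γ.arc e s) = Γ.arc e (edgeSpread t (Γ.onEdge S e) s) :=
  Γ.extend_arc _ _ e hs

theorem spread_zero (S : Set X) (p : X) : Γ.spread 0 S p = p := by
  rcases Γ.exists_eq p with ⟨w, rfl⟩ | ⟨e, s, hs, rfl⟩
  · rw [spread_vert]
  · rw [spread_arc _ _ _ _ hs]; simp [edgeSpread]

theorem injOn_spread {t : ℝ} (ht : t ∈ Icc (0 : ℝ) 1) {S : Set X} (hS : S.Finite) :
    InjOn (Γ.spread t S) S := by
  intro p hp q hq h
  rcases Γ.exists_eq p with ⟨v, rfl⟩ | ⟨e, s, hs, rfl⟩ <;>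
    rcases Γ.exists_eq q with ⟨w, rfl⟩ | ⟨e', s', hs', rfl⟩
  · simpa only [spread_vert] using h
  · have h2 := edgeSpread_mem ht (Γ.onEdge_subset S e') ((Γ.mem_onEdge hS).2 ⟨hs', hq⟩)
    rw [spread_vert, spread_arc _ _ _ _ hs'] at h
    exact absurd h (Γ.vert_ne_arc _ _ h2)
  · have h2 := edgeSpread_mem ht (Γ.onEdge_subset S e) ((Γ.mem_onEdge hS).2 ⟨hs, hp⟩)
    rw [spread_vert, spread_arc _ _ _ _ hs] at h
    exact absurd h.symm (Γ.vert_ne_arc _ _ h2)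
  · have hs1 := (Γ.mem_onEdge hS).2 ⟨hs, hp⟩
    have hs2 := (Γ.mem_onEdge hS).2 ⟨hs', hq⟩
    have h1 := edgeSpread_mem ht (Γ.onEdge_subset S e) hs1
    have h2 := edgeSpread_mem ht (Γ.onEdge_subset S e') hs2
    rw [spread_arc _ _ _ _ hs, spread_arc _ _ _ _ hs'] at h
    obtain ⟨rfl, heq⟩ := Γ.arc_inj h1 h2 h
    rcases lt_trichotomy s s' with hlt | rfl | hlt
    · exact absurd heq (edgeSpread_lt ht (Γ.onEdge_subset S e) hs1 hs2 hlt).ne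
    · rfl
    · exact absurd heq (edgeSpread_lt ht (Γ.onEdge_subset S e) hs2 hs1 hlt).ne'

open Classical in
/-- The contribution of the particle with the parameter `a` in a closed cell to the mass on the
edge `e` to the left of the parameter `s`. -/
def cellLeft (e : E) (s : ℝ) : V ⊕ E → ℝ → ℝ
  | Sum.inl _, _ => 0
  | Sum.inr e', a => if e' = e then if a ≤ s then min 1 a else 0 else 0

open Classical in
/-- The contribution of the particle with the parameter `a` in a closed cell to the mass on the
edge `e` to the right of the parameter `s`. -/
def cellRight (e : E) (s : ℝ) : V ⊕ E → ℝ → ℝ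
  | Sum.inl _, _ => 0
  | Sum.inr e', a => if e' = e then if s ≤ a then min 1 (5 - a) else 0 else 0

theorem cellLeft_nonneg (e : E) (s : ℝ) (c : V ⊕ E) {a : ℝ} (ha : 0 ≤ a) :
    0 ≤ cellLeft e s c a := by
  rcases c with v | e'
  · exact le_rfl
  · simp only [cellLeft]
    split_ifs <;> first | exact le_rfl | exact le_min zero_le_one ha

theorem cellRight_nonneg (e : E) (s : ℝ) (c : V ⊕ E) {a : ℝ} (ha : a ≤ 5) :
    0 ≤ cellRight e s c a := by
  rcases c with v | e'
  · exact le_rfl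
  · simp only [cellRight]
    split_ifs <;> first | exact le_rfl | exact le_min zero_le_one (by linarith)

section cells

variable {k : ℕ} {a : Fin k → V ⊕ E} {s : Fin k → Icc (0 : ℝ) 5}

theorem massLeft_cell (h : Function.Injective fun j => Γ.cell (a j) (s j)) (e : E) {r : ℝ}
    (hr : r < 5) : massLeft (Γ.onEdge (range fun j => Γ.cell (a j) (s j)) e) r =
      ∑ j, cellLeft e r (a j) (s j) := by
  classical
  have hφ : ∀ p, Γ.extend (fun _ => (0 : ℝ))
      (fun e' a => if e' = e then if a ≤ r then min 1 a else 0 else 0) p ≠ 0 →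
        ∃ s ∈ Ioo (0 : ℝ) 5, p = Γ.arc e s := by
    intro p hp
    rcases Γ.exists_eq p with ⟨v, rfl⟩ | ⟨e', s, hs, rfl⟩
    · rw [extend_vert] at hp; exact absurd rfl hp
    · rw [extend_arc _ _ _ _ hs] at hp
      split_ifs at hp with h1 h2
      · exact ⟨s, hs, by rw [h1]⟩
      all_goals exact absurd rfl hp
  have h1 := Γ.total_eq_sum_onEdge (finite_range fun j => Γ.cell (a j) (s j)) e hφ
  rw [total_range _ h] at h1
  rw [massLeft, Finset.sum_filter]
  convert h1.symm using 1
  · refine Finset.sum_congr rfl fun x hx => ?_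
    rw [extend_arc _ _ _ _ (Γ.onEdge_subset _ _ _ hx), if_pos rfl]
  · refine Finset.sum_congr rfl fun j _ => ?_
    rcases a j with v | e'
    · change _ = Γ.extend _ _ (Γ.vert v)
      rw [extend_vert]
      rfl
    · change _ = Γ.extend _ _ (Γ.arc e' (s j))
      rw [Γ.extend_arc_of_mem_Icc ?_ ?_ (s j).2]
      · rfl
      · simp
      · simp [hr]

theorem massRight_cell (h : Function.Injective fun j => Γ.cell (a j) (s j)) (e : E) {r : ℝ}
    (hr : 0 < r) : massRight (Γ.onEdge (range fun j => Γ.cell (a j) (s j)) e) r =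
      ∑ j, cellRight e r (a j) (s j) := by
  classical
  have hφ : ∀ p, Γ.extend (fun _ => (0 : ℝ))
      (fun e' a => if e' = e then if r ≤ a then min 1 (5 - a) else 0 else 0) p ≠ 0 →
        ∃ s ∈ Ioo (0 : ℝ) 5, p = Γ.arc e s := by
    intro p hp
    rcases Γ.exists_eq p with ⟨v, rfl⟩ | ⟨e', s, hs, rfl⟩
    · rw [extend_vert] at hp; exact absurd rfl hp
    · rw [extend_arc _ _ _ _ hs] at hp
      split_ifs at hp with h1 h2
      · exact ⟨s, hs, by rw [h1]⟩
      all_goals exact absurd rfl hp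
  have h1 := Γ.total_eq_sum_onEdge (finite_range fun j => Γ.cell (a j) (s j)) e hφ
  rw [total_range _ h] at h1
  rw [massRight, Finset.sum_filter]
  convert h1.symm using 1
  · refine Finset.sum_congr rfl fun x hx => ?_
    rw [extend_arc _ _ _ _ (Γ.onEdge_subset _ _ _ hx), if_pos rfl]
  · refine Finset.sum_congr rfl fun j _ => ?_
    rcases a j with v | e'
    · change _ = Γ.extend _ _ (Γ.vert v)
      rw [extend_vert]
      rfl
    · change _ = Γ.extend _ _ (Γ.arc e' (s j))
      rw [Γ.extend_arc_of_mem_Icc ?_ ?_ (s j).2]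
      · rfl
      · simp [hr]
      · simp

theorem le_sum_cellLeft {e : E} {i : Fin k} (hi : a i = Sum.inr e) :
    min 1 (s i : ℝ) ≤ ∑ j, cellLeft e (s i) (a j) (s j) := by
  refine le_trans ?_ (Finset.single_le_sum
    (f := fun j => cellLeft e (s i) (a j) (s j : ℝ))
    (fun j _ => cellLeft_nonneg e _ _ (s j).2.1) (Finset.mem_univ i))
  simp [hi, cellLeft]

theorem le_sum_cellRight {e : E} {i : Fin k} (hi : a i = Sum.inr e) :
    min 1 (5 - s i : ℝ) ≤ ∑ j, cellRight e (s i) (a j) (s j) := by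
  refine le_trans ?_ (Finset.single_le_sum
    (f := fun j => cellRight e (s i) (a j) (s j : ℝ))
    (fun j _ => cellRight_nonneg e _ _ (s j).2.2) (Finset.mem_univ i))
  simp [hi, cellRight]

/-- On closed cells the motion is given by one formula, also when particles on the edge `e` are at
its ends: the spread positions there are `0` and `5`. -/
theorem spread_cell (t : ℝ) (h : Function.Injective fun j => Γ.cell (a j) (s j)) {e : E}
    {i : Fin k} (hi : a i = Sum.inr e) :
    Γ.spread t (range fun j => Γ.cell (a j) (s j)) (Γ.arc e (s i)) =
      Γ.arc e ((1 - t) * s i + t * spreadPos (∑ j, cellLeft e (s i) (a j) (s j))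
        (∑ j, cellRight e (s i) (a j) (s j))) := by
  have hL := le_sum_cellLeft (s := s) hi
  have hR := le_sum_cellRight (s := s) hi
  rcases eq_or_lt_of_le (s i).2.1 with h0 | h0
  · rw [← h0] at hR ⊢
    have hz : ∑ j, cellLeft e 0 (a j) (s j : ℝ) = 0 := by
      refine Finset.sum_eq_zero fun j _ => ?_
      rcases a j with v | e'
      · rfl
      · simp only [cellLeft]
        split_ifs with h1 h2
        · rw [le_antisymm h2 (s j).2.1]; norm_num
        all_goals rfl
    norm_num at hR
    rw [hz, spreadPos_zero hR, Γ.arc_zero, spread_vert, mul_zero, mul_zero, add_zero, Γ.arc_zero]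
  rcases eq_or_lt_of_le (s i).2.2 with h5 | h5
  · rw [h5] at hL ⊢
    have hz : ∑ j, cellRight e 5 (a j) (s j : ℝ) = 0 := by
      refine Finset.sum_eq_zero fun j _ => ?_
      rcases a j with v | e'
      · rfl
      · simp only [cellRight]
        split_ifs with h1 h2
        · rw [le_antisymm (s j).2.2 h2]; norm_num
        all_goals rfl
    norm_num at hL
    rw [hz, spreadPos_five hL, Γ.arc_five, spread_vert, show (1 - t) * 5 + t * 5 = 5 by ring,
      Γ.arc_five]
  rw [spread_arc _ _ _ _ ⟨h0, h5⟩, edgeSpread, Γ.massLeft_cell h e h5, Γ.massRight_cell h e h0]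

end cells

theorem continuous_spread [Finite V] [Finite E] [T2Space X] (k : ℕ) (i : Fin k) :
    Continuous fun p : OrdConf k X × unitInterval => Γ.spread p.2 (range p.1.1) (p.1.1 i) := by
  refine Γ.continuous_ordConf_of_cell fun a => ?_
  obtain ⟨c, hc⟩ : ∃ c, a i = c := ⟨_, rfl⟩
  rcases c with v | e
  · have : ∀ s, Γ.cell (a i) s = Γ.vert v := fun s => by rw [hc]; rfl
    simp only [this, spread_vert]
    exact continuous_const
  have hcell : ∀ s, Γ.cell (a i) s = Γ.arc e s := fun s => by rw [hc]; rfl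
  have hs : ∀ j, Continuous fun p : {s : Fin k → Icc (0 : ℝ) 5 //
      Function.Injective fun j => Γ.cell (a j) (s j)} × unitInterval => (p.1.1 j : ℝ) := fun j =>
    continuous_subtype_val.comp ((continuous_apply j).comp
      (continuous_subtype_val.comp continuous_fst))
  -- distinct particles on `e` have distinct parameters, so their order is locally constant
  have hne : ∀ j, a j = Sum.inr e → j ≠ i → ∀ p : {s : Fin k → Icc (0 : ℝ) 5 //
      Function.Injective fun j => Γ.cell (a j) (s j)} × unitInterval,
      (p.1.1 j : ℝ) ≠ p.1.1 i := by
    intro j hj hji p h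
    refine hji (p.1.2 ?_)
    simp only [hj, hc, Subtype.ext h]
  have hL : ∀ j, Continuous fun p : {s : Fin k → Icc (0 : ℝ) 5 //
      Function.Injective fun j => Γ.cell (a j) (s j)} × unitInterval =>
        cellLeft e (p.1.1 i) (a j) (p.1.1 j : ℝ) := by
    intro j
    by_cases hj : a j = Sum.inr e
    · simp only [hj, cellLeft, if_true]
      by_cases hji : j = i
      · subst hji
        simp only [le_refl, if_true]
        exact continuous_const.min (hs j)
      · exact Continuous.if_le (continuous_const.min (hs j)) continuous_const (hs j) (hs i)
          fun p h => absurd h (hne j hj hji p)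
    · rcases h : a j with v | e'
      · exact continuous_const
      · have : e' ≠ e := fun he => hj (by rw [h, he])
        simp only [cellLeft, if_neg this]
        exact continuous_const
  have hR : ∀ j, Continuous fun p : {s : Fin k → Icc (0 : ℝ) 5 //
      Function.Injective fun j => Γ.cell (a j) (s j)} × unitInterval =>
        cellRight e (p.1.1 i) (a j) (p.1.1 j : ℝ) := by
    intro j
    by_cases hj : a j = Sum.inr e
    · simp only [hj, cellRight, if_true]
      by_cases hji : j = i
      · subst hji
        simp only [le_refl, if_true]
        exact continuous_const.min (continuous_const.sub (hs j))
      · exact Continuous.if_le (continuous_const.min (continuous_const.sub (hs j)))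
          continuous_const (hs i) (hs j) fun p h => absurd h.symm (hne j hj hji p)
    · rcases h : a j with v | e'
      · exact continuous_const
      · have : e' ≠ e := fun he => hj (by rw [h, he])
        simp only [cellRight, if_neg this]
        exact continuous_const
  have hsum : ∀ p : {s : Fin k → Icc (0 : ℝ) 5 //
      Function.Injective fun j => Γ.cell (a j) (s j)} × unitInterval,
      0 < ∑ j, cellLeft e (p.1.1 i) (a j) (p.1.1 j : ℝ) +
        ∑ j, cellRight e (p.1.1 i) (a j) (p.1.1 j : ℝ) := by
    intro p
    have h1 := le_sum_cellLeft (s := p.1.1) hc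
    have h2 := le_sum_cellRight (s := p.1.1) hc
    rcases le_total (p.1.1 i : ℝ) 1 with h | h
    · rw [min_eq_left (by linarith)] at h2
      have := (le_min zero_le_one (p.1.1 i).2.1).trans h1
      linarith
    · rw [min_eq_left h] at h1
      have := (le_min zero_le_one (by linarith [(p.1.1 i).2.2])).trans h2
      linarith
  simp only [hcell]
  have heq : ∀ p : {s : Fin k → Icc (0 : ℝ) 5 //
      Function.Injective fun j => Γ.cell (a j) (s j)} × unitInterval, _ :=
    fun p => Γ.spread_cell p.2 p.1.2 hc
  simp only [heq]
  refine (Γ.continuousOn_arc e).comp_continuous ?_ fun p => ?_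
  · have hLs := continuous_finsetSum Finset.univ fun j _ => hL j
    have hRs := continuous_finsetSum Finset.univ fun j _ => hR j
    have ht : Continuous fun p : {s : Fin k → Icc (0 : ℝ) 5 //
      Function.Injective fun j => Γ.cell (a j) (s j)} × unitInterval => (p.2 : ℝ) :=
      continuous_subtype_val.comp continuous_snd
    unfold spreadPos
    exact ((continuous_const.sub ht).mul (hs i)).add (ht.mul
      ((((hLs.min continuous_const).add ((continuous_const.mul hLs).div (hLs.add hRs)
        fun p => (hsum p).ne')).add continuous_const).sub (hRs.min continuous_const)))
  · have h1 := Finset.sum_nonneg fun j (_ : j ∈ Finset.univ) =>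
      cellLeft_nonneg e (p.1.1 i) (a j) (p.1.1 j).2.1
    have h2 := Finset.sum_nonneg fun j (_ : j ∈ Finset.univ) =>
      cellRight_nonneg e (p.1.1 i) (a j) (p.1.1 j).2.2
    exact convex_Icc 0 5 (p.1.1 i).2 ⟨spreadPos_nonneg h1 h2, spreadPos_le h1 h2 (hsum p)⟩
      (by linarith [p.2.2.2]) p.2.2.1 (by ring)

/-- The map of `B(X)` that spreads a configuration for the time `t`. -/
def spreadConf (t : unitInterval) (x : Conf X) : Conf X :=
  ⟨x.1, x.2.move (Γ.spread t) fun _ hS => Γ.injOn_spread t.2 hS⟩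

theorem support_spreadConf (t : unitInterval) (x : Conf X) :
    (Γ.spreadConf t x).2.support = Γ.spread t x.2.support '' x.2.support :=
  UConf.support_move _ (fun _ hS => Γ.injOn_spread t.2 hS) _

theorem continuous_spreadConf [Finite V] [Finite E] [T2Space X] :
    Continuous fun p : Conf X × unitInterval => Γ.spreadConf p.2 p.1 :=
  continuous_move (fun t : unitInterval => Γ.spread t) _ Γ.continuous_spread

end TopGraph

/-! ### Finite sets of particles on an edge -/

section rank

variable {A A' : Finset ℝ}

theorem card_le_add_card_ge {s : ℝ} (hs : s ∈ A) :
    (A.filter (· ≤ s)).card + (A.filter (s ≤ ·)).card = A.card + 1 := by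
  rw [← Finset.card_union_add_card_inter, ← Finset.filter_or, ← Finset.filter_and]
  congr 1
  · congr 1
    exact Finset.filter_true_of_mem fun a _ => le_total a s
  · rw [Finset.card_eq_one]
    refine ⟨s, ?_⟩
    ext a
    simp only [Finset.mem_filter, Finset.mem_singleton]
    constructor
    · rintro ⟨-, h1, h2⟩; exact le_antisymm h1 h2
    · rintro rfl; exact ⟨hs, le_rfl, le_rfl⟩

theorem exists_card_filter_le_eq (h : A.card = A'.card) {s : ℝ} (hs : s ∈ A) :
    ∃ s' ∈ A', (A'.filter (· ≤ s')).card = (A.filter (· ≤ s)).card := by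
  have hinj : InjOn (fun s => (A'.filter (· ≤ s)).card) (A' : Set ℝ) := by
    have hlt : ∀ x ∈ A', ∀ y ∈ A', x < y →
        (A'.filter (· ≤ x)).card < (A'.filter (· ≤ y)).card := by
      intro x hx y hy hxy
      refine Finset.card_lt_card ⟨?_, fun hsub => ?_⟩
      · intro a ha
        rw [Finset.mem_filter] at ha ⊢
        exact ⟨ha.1, ha.2.trans hxy.le⟩
      · exact absurd (Finset.mem_filter.1 (hsub (Finset.mem_filter.2 ⟨hy, le_rfl⟩))).2 hxy.not_ge
    intro x hx y hy hxy
    rcases lt_trichotomy x y with h | h | h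
    · exact absurd hxy (hlt x hx y hy h).ne
    · exact h
    · exact absurd hxy (hlt y hy x hx h).ne'
  have himg : A'.image (fun s => (A'.filter (· ≤ s)).card) = Finset.Icc 1 A'.card := by
    refine Finset.eq_of_subset_of_card_le ?_ ?_
    · intro n hn
      obtain ⟨x, hx, rfl⟩ := Finset.mem_image.1 hn
      exact Finset.mem_Icc.2 ⟨Finset.card_pos.2 ⟨x, Finset.mem_filter.2 ⟨hx, le_rfl⟩⟩,
        Finset.card_filter_le _ _⟩
    · rw [Finset.card_image_of_injOn hinj]; simp
  have hmem : (A.filter (· ≤ s)).card ∈ Finset.Icc 1 A'.card :=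
    Finset.mem_Icc.2 ⟨Finset.card_pos.2 ⟨s, Finset.mem_filter.2 ⟨hs, le_rfl⟩⟩,
      h ▸ Finset.card_filter_le _ _⟩
  rw [← himg] at hmem
  obtain ⟨s', hs', h'⟩ := Finset.mem_image.1 hmem
  exact ⟨s', hs', h'⟩

/-- The only particle in `A` of a mass other than `1` is the first one, so that the mass up to a
particle of `A` is its rank minus a constant. -/
theorem massLeft_eq (hA : ∀ a ∈ A, ∀ b ∈ A, a < 1 → b < 1 → a = b) {s : ℝ} (hs : s ∈ A) :
    massLeft A s = (A.filter (· ≤ s)).card - ∑ a ∈ A with a < 1, (1 - a) := by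
  have h1 : ∀ a : ℝ, min 1 a = 1 - if a < 1 then 1 - a else 0 := fun a => by
    split_ifs with h
    · rw [min_eq_right h.le]; ring
    · rw [min_eq_left (not_lt.1 h)]; ring
  have h2 : (A.filter (· ≤ s)).filter (· < 1) = A.filter (· < 1) := by
    ext a
    simp only [Finset.mem_filter]
    constructor
    · rintro ⟨⟨h, -⟩, h'⟩; exact ⟨h, h'⟩
    · rintro ⟨h, h'⟩
      refine ⟨⟨h, ?_⟩, h'⟩
      by_cases hs1 : s < 1
      · exact (hA a h s hs h' hs1).le
      · linarith
  rw [massLeft, Finset.sum_congr rfl fun a _ => h1 a, Finset.sum_sub_distrib,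
    ← Finset.sum_filter, h2]
  simp

theorem massRight_eq (hA : ∀ a ∈ A, ∀ b ∈ A, 4 < a → 4 < b → a = b) {s : ℝ} (hs : s ∈ A) :
    massRight A s = (A.filter (s ≤ ·)).card - ∑ a ∈ A with 4 < a, (a - 4) := by
  have h1 : ∀ a : ℝ, min 1 (5 - a) = 1 - if 4 < a then a - 4 else 0 := fun a => by
    split_ifs with h
    · rw [min_eq_right (by linarith)]; ring
    · rw [min_eq_left (by linarith [not_lt.1 h])]; ring
  have h2 : (A.filter (s ≤ ·)).filter (4 < ·) = A.filter (4 < ·) := by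
    ext a
    simp only [Finset.mem_filter]
    constructor
    · rintro ⟨⟨h, -⟩, h'⟩; exact ⟨h, h'⟩
    · rintro ⟨h, h'⟩
      refine ⟨⟨h, ?_⟩, h'⟩
      by_cases hs1 : 4 < s
      · exact (hA a h s hs h' hs1).ge
      · linarith
  rw [massRight, Finset.sum_congr rfl fun a _ => h1 a, Finset.sum_sub_distrib,
    ← Finset.sum_filter, h2]
  simp

/-- Two sets of particles on an edge that agree in the stars at the two ends, with at most one
particle each, and that have the same number of elements. -/
structure EdgeEq (A A' : Finset ℝ) : Prop where
  left : ∀ a ∈ A, ∀ b ∈ A, a < 1 → b < 1 → a = b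
  right : ∀ a ∈ A, ∀ b ∈ A, 4 < a → 4 < b → a = b
  mem_left : ∀ a, a < 1 → (a ∈ A ↔ a ∈ A')
  mem_right : ∀ a, 4 < a → (a ∈ A ↔ a ∈ A')
  card_eq : A.card = A'.card

namespace EdgeEq

theorem left' (h : EdgeEq A A') : ∀ a ∈ A', ∀ b ∈ A', a < 1 → b < 1 → a = b :=
  fun a ha b hb h1 h2 => h.left a ((h.mem_left a h1).2 ha) b ((h.mem_left b h2).2 hb) h1 h2

theorem right' (h : EdgeEq A A') : ∀ a ∈ A', ∀ b ∈ A', 4 < a → 4 < b → a = b :=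
  fun a ha b hb h1 h2 => h.right a ((h.mem_right a h1).2 ha) b ((h.mem_right b h2).2 hb) h1 h2

/-- The spread position of a particle depends only on its rank. -/
theorem spreadPos_eq (h : EdgeEq A A') {s s' : ℝ} (hs : s ∈ A) (hs' : s' ∈ A')
    (hr : (A'.filter (· ≤ s')).card = (A.filter (· ≤ s)).card) :
    spreadPos (massLeft A s) (massRight A s) = spreadPos (massLeft A' s') (massRight A' s') := by
  have h1 := card_le_add_card_ge hs
  have h2 := card_le_add_card_ge hs'
  have h3 : (A'.filter (s' ≤ ·)).card = (A.filter (s ≤ ·)).card := by have := h.card_eq; omega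
  have h4 : A'.filter (· < 1) = A.filter (· < 1) := by
    ext a; simp only [Finset.mem_filter, and_congr_left_iff]
    exact fun ha => (h.mem_left a ha).symm
  have h5 : A'.filter (4 < ·) = A.filter (4 < ·) := by
    ext a; simp only [Finset.mem_filter, and_congr_left_iff]
    exact fun ha => (h.mem_right a ha).symm
  rw [massLeft_eq h.left hs, massRight_eq h.right hs, massLeft_eq h.left' hs',
    massRight_eq h.right' hs', hr, h3, h4, h5]

theorem exists_edgeSpread_one_eq (h : EdgeEq A A') {s : ℝ} (hs : s ∈ A) :
    ∃ s' ∈ A', edgeSpread 1 A s = edgeSpread 1 A' s' := by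
  obtain ⟨s', hs', hr⟩ := exists_card_filter_le_eq h.card_eq hs
  refine ⟨s', hs', ?_⟩
  simp [edgeSpread, h.spreadPos_eq hs hs' hr]

theorem edgeSpread_eq (h : EdgeEq A A') (t : ℝ) {s : ℝ} (hs : s ∈ A) (hs1 : s < 1 ∨ 4 < s) :
    edgeSpread t A s = edgeSpread t A' s := by
  have hs' : s ∈ A' := hs1.elim (fun h1 => (h.mem_left s h1).1 hs) fun h1 => (h.mem_right s h1).1 hs
  have hr : (A'.filter (· ≤ s)).card = (A.filter (· ≤ s)).card := by
    rcases hs1 with h1 | h1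
    · congr 1
      ext a
      simp only [Finset.mem_filter, and_congr_left_iff]
      exact fun ha => (h.mem_left a (ha.trans_lt h1)).symm
    · have h2 := card_le_add_card_ge hs
      have h3 := card_le_add_card_ge hs'
      have h4 : A'.filter (s ≤ ·) = A.filter (s ≤ ·) := by
        ext a
        simp only [Finset.mem_filter, and_congr_left_iff]
        exact fun ha => (h.mem_right a (h1.trans_le ha)).symm
      rw [h4] at h3
      have := h.card_eq
      omega
  rw [edgeSpread, edgeSpread, h.spreadPos_eq hs hs' hr]

end EdgeEq

end rank

namespace TopGraph

variable {V E X : Type*} [TopologicalSpace X] (Γ : TopGraph V E X)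

/-! ### Reduced sets of particles -/

/-- A set of particles is reduced if each open star of radius `1` holds at most one of them. -/
def Reduced (S : Set X) : Prop := ∀ v, (S ∩ Γ.openStar v 1).Subsingleton

theorem halfArc_mem_openStar {v : V} {h : E × Bool} (hv : Γ.endpt h = v) {r : ℝ}
    (hr : r ∈ Ioo (0 : ℝ) 1) : Γ.halfArc h r ∈ Γ.openStar v 1 :=
  Or.inr ⟨h, hv, r, hr, rfl⟩

theorem vert_mem_openStar_self (v : V) : Γ.vert v ∈ Γ.openStar v 1 := Or.inl rfl

/-- The distance of the point with the parameter `a` from one of the two ends of an edge.  It is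
its own inverse. -/
def side (b : Bool) (a : ℝ) : ℝ := if b then 5 - a else a

theorem side_side (b : Bool) (a : ℝ) : side b (side b a) = a := by
  cases b <;> simp [side]

theorem side_mem {b : Bool} {a : ℝ} (ha : a ∈ Ioo (0 : ℝ) 5) : side b a ∈ Ioo (0 : ℝ) 5 := by
  obtain ⟨h0, h5⟩ := ha
  cases b
  · exact ⟨h0, h5⟩
  · exact ⟨by simp [side, h5], by simp [side, h0]⟩

theorem halfArc_eq (h : E × Bool) (r : ℝ) : Γ.halfArc h r = Γ.arc h.1 (side h.2 r) := rfl

theorem halfArc_side (e : E) (b : Bool) (a : ℝ) : Γ.halfArc (e, b) (side b a) = Γ.arc e a := by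
  rw [halfArc_eq, side_side]

theorem halfArc_inj_of_lt_two {h h' : E × Bool} {r r' : ℝ} (hr : r ∈ Ioo (0 : ℝ) 2)
    (hr' : r' ∈ Ioo (0 : ℝ) 2) (heq : Γ.halfArc h r = Γ.halfArc h' r') : h = h' ∧ r = r' := by
  obtain ⟨e, b⟩ := h
  obtain ⟨e', b'⟩ := h'
  obtain ⟨h1, h2⟩ := Γ.arc_inj (side_mem ⟨hr.1, by linarith [hr.2]⟩)
    (side_mem ⟨hr'.1, by linarith [hr'.2]⟩) heq
  obtain rfl : e = e' := h1
  obtain ⟨hr0, hr1⟩ := hr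
  obtain ⟨hr0', hr1'⟩ := hr'
  cases b <;> cases b' <;> simp only [side] at h2 <;> norm_num at h2 ⊢ <;> linarith

theorem halfArc_inj {h h' : E × Bool} {r r' : ℝ} (hr : r ∈ Ioo (0 : ℝ) 1)
    (hr' : r' ∈ Ioo (0 : ℝ) 1) (heq : Γ.halfArc h r = Γ.halfArc h' r') : h = h' ∧ r = r' :=
  Γ.halfArc_inj_of_lt_two (Ioo_subset_Ioo_right one_le_two hr)
    (Ioo_subset_Ioo_right one_le_two hr') heq

theorem arc_side_mem_openStar {e : E} {b : Bool} {a : ℝ} (ha : a ∈ Ioo (0 : ℝ) 5)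
    (h : side b a < 1) : Γ.arc e a ∈ Γ.openStar (Γ.endpt (e, b)) 1 := by
  rw [← Γ.halfArc_side e b a]
  exact Γ.halfArc_mem_openStar rfl ⟨(side_mem ha).1, h⟩

theorem arc_notMem_openStar {v : V} {e : E} {s : ℝ} (hs : s ∈ Icc (1 : ℝ) 4) :
    Γ.arc e s ∉ Γ.openStar v 1 := by
  rw [arc_mem_openStar _ ⟨by linarith [hs.1], by linarith [hs.2]⟩]
  rintro (⟨-, h⟩ | ⟨-, h⟩)
  · linarith [hs.1]
  · linarith [hs.2]

theorem star_cases (S : Set X) (v : V) : Γ.vert v ∈ S ∨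
    (∃ h, Γ.endpt h = v ∧ ∃ r ∈ Ioo (0 : ℝ) 1, Γ.halfArc h r ∈ S) ∨
      S ∩ Γ.openStar v 1 = ∅ := by
  rcases (S ∩ Γ.openStar v 1).eq_empty_or_nonempty with h | ⟨p, hp, hp'⟩
  · exact Or.inr (Or.inr h)
  · rcases hp' with rfl | ⟨h, hv, r, hr, rfl⟩
    · exact Or.inl hp
    · exact Or.inr (Or.inl ⟨h, hv, r, hr, hp⟩)

section total

variable {Γ} {S : Set X} (hS : Γ.Reduced S) {v : V} {φ : X → ℝ}

theorem total_eq_zero_of_star (h : S ∩ Γ.openStar v 1 = ∅)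
    (hφ : ∀ p, p ∉ Γ.openStar v 1 → φ p = 0) : total φ S = 0 := by
  rw [total, ← finsum_mem_empty (f := φ)]
  refine finsum_mem_inter_support_eq' _ _ _ fun p hp => ?_
  simp only [mem_empty_iff_false, iff_false]
  intro hpS
  exact eq_empty_iff_forall_notMem.1 h p ⟨hpS, not_imp_comm.1 (hφ p) hp⟩

include hS

theorem Reduced.total_eq {p : X} (hp : p ∈ S) (hp' : p ∈ Γ.openStar v 1)
    (hφ : ∀ p, p ∉ Γ.openStar v 1 → φ p = 0) : total φ S = φ p := by
  rw [total, ← finsum_mem_singleton (f := φ) (a := p)]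
  refine finsum_mem_inter_support_eq' _ _ _ fun q hq => ⟨fun hqS => ?_, ?_⟩
  · exact hS v ⟨hqS, not_imp_comm.1 (hφ q) hq⟩ ⟨hp, hp'⟩
  · rintro rfl; exact hp

end total

/-- The distance from the vertex `v` of the particle of `S` in the open star of radius `1` at
`v`, and `1` if there is none; here `S` is a reduced set of particles. -/
def starCoord (S : Set X) (v : V) : Icc (0 : ℝ) 1 :=
  projIcc 0 1 zero_le_one (1 - total (Γ.bump v) S)

section starCoord

variable {Γ} {S : Set X} {v : V}

theorem starCoord_of_empty (h : S ∩ Γ.openStar v 1 = ∅) : Γ.starCoord S v = 1 := by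
  rw [starCoord, total_eq_zero_of_star h fun p hp => Γ.bump_eq_zero hp, sub_zero]
  exact projIcc_right zero_le_one

theorem Reduced.starCoord_of_vert (hS : Γ.Reduced S) (h : Γ.vert v ∈ S) :
    Γ.starCoord S v = 0 := by
  rw [starCoord, hS.total_eq h (Γ.vert_mem_openStar_self v) fun p hp => Γ.bump_eq_zero hp,
    bump_vert_self, sub_self]
  exact projIcc_left zero_le_one

theorem Reduced.starCoord_of_half (hS : Γ.Reduced S) {h : E × Bool} (hv : Γ.endpt h = v) {r : ℝ}
    (hr : r ∈ Ioo (0 : ℝ) 1) (h : Γ.halfArc h r ∈ S) : (Γ.starCoord S v : ℝ) = r := by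
  have hr' : r ∈ Icc (0 : ℝ) 1 := ⟨hr.1.le, hr.2.le⟩
  rw [starCoord, hS.total_eq h (Γ.halfArc_mem_openStar hv hr) fun p hp => Γ.bump_eq_zero hp,
    Γ.bump_halfArc hv hr', sub_sub_cancel, projIcc_of_mem _ hr']

theorem localState_of_vert (h : Γ.vert v ∈ S) : Γ.localState S v = LocalState.vertex := by
  simp [localState, h]

theorem localState_of_empty (h : S ∩ Γ.openStar v 1 = ∅) :
    Γ.localState S v = LocalState.empty := by
  have h1 : Γ.vert v ∉ S := fun h' =>
    eq_empty_iff_forall_notMem.1 h _ ⟨h', Γ.vert_mem_openStar_self v⟩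
  have h2 : ¬ ∃ h, Γ.endpt h = v ∧ Γ.HasParticle S h := by
    rintro ⟨h', hv, s, hs, hsS⟩
    exact eq_empty_iff_forall_notMem.1 h _ ⟨hsS, Γ.halfArc_mem_openStar hv hs⟩
  simp [localState, h1, h2]

theorem Reduced.localState_of_half (hS : Γ.Reduced S) {h : E × Bool} (hv : Γ.endpt h = v) {r : ℝ}
    (hr : r ∈ Ioo (0 : ℝ) 1) (hrS : Γ.halfArc h r ∈ S) :
    Γ.localState S v = LocalState.half h hv := by
  have h1 : Γ.vert v ∉ S := fun h' => by
    have := hS v ⟨h', Γ.vert_mem_openStar_self v⟩ ⟨hrS, Γ.halfArc_mem_openStar hv hr⟩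
    exact Γ.vert_ne_arc v h.1 (side_mem ⟨hr.1, by linarith [hr.2]⟩) this
  have h2 : ∃ h, Γ.endpt h = v ∧ Γ.HasParticle S h := ⟨h, hv, r, hr, hrS⟩
  obtain ⟨hv', s, hs, hsS⟩ := h2.choose_spec
  have := (Γ.halfArc_inj hs hr (hS v ⟨hsS, Γ.halfArc_mem_openStar hv' hs⟩
    ⟨hrS, Γ.halfArc_mem_openStar hv hr⟩)).1
  simp only [localState, if_neg h1, dif_pos h2]
  congr

theorem Reduced.starCoord_mem_of_isHalf (hS : Γ.Reduced S) {h : E × Bool} {hv : Γ.endpt h = v}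
    (H : Γ.localState S v = LocalState.half h hv) :
    (Γ.starCoord S v : ℝ) ∈ Ioo (0 : ℝ) 1 ∧ Γ.halfArc h (Γ.starCoord S v) ∈ S := by
  obtain ⟨s, hs, h', hv', H', hsS⟩ := Γ.localState_spec S v ⟨h, hv, H⟩
  obtain rfl : h' = h := by
    rw [H] at H'
    injection H'.symm
  rw [hS.starCoord_of_half hv' hs hsS]
  exact ⟨hs, hsS⟩

/-- The point of the cube of the labelling `l` whose coordinates are a restriction of the family
`d`. -/
def cubePoint (l : Γ.Labelling) (d : V → Icc (0 : ℝ) 1) : Γ.Cubes := ⟨l, fun v => d v.1⟩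

theorem Reduced.cubeCoord_eq (hS : Γ.Reduced S) :
    (⟨Γ.labelling S, Γ.cubeCoord S⟩ : Γ.Cubes) = cubePoint (Γ.labelling S) (Γ.starCoord S) := by
  unfold cubePoint
  congr 1
  refine funext fun v => Subtype.ext ?_
  obtain ⟨hs, h, hv, -, hsS⟩ := (Γ.localState_spec S v.1 v.2).choose_spec
  exact (hS.starCoord_of_half hv hs hsS).symm

end starCoord

theorem record_eq (x : Γ.RedConf) : Γ.record x = Quot.mk Γ.Glue
    (cubePoint (Γ.labelling x.1.2.support) (Γ.starCoord x.1.2.support)) :=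
  congrArg (Quot.mk Γ.Glue) (Reduced.cubeCoord_eq (S := x.1.2.support) x.2)

/-! ### Counting the particles on an edge -/

theorem labelling_edge {S : Set X} (hS : S.Finite) (e : E) :
    (Γ.labelling S).edge e = ((Γ.onEdge S e).filter fun a => 1 ≤ a ∧ a ≤ 4).card := by
  rw [← Set.ncard_coe_finset]
  change Set.ncard _ = _
  congr 1
  ext a
  simp only [Finset.coe_filter, mem_onEdge _ hS, mem_ofPred_eq]
  constructor
  · rintro ⟨⟨h1, h2⟩, h3⟩
    exact ⟨⟨⟨by linarith, by linarith⟩, h3⟩, h1, h2⟩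
  · rintro ⟨⟨-, h3⟩, h1, h2⟩
    exact ⟨⟨h1, h2⟩, h3⟩

open Classical in
/-- The particles in the open stars at the ends of an edge contribute to a sum over the
particles on the edge through the local states. -/
theorem Reduced.sum_side {Γ : TopGraph V E X} {S : Set X} (hS : Γ.Reduced S) (hfin : S.Finite)
    (e : E) (b : Bool) (g : ℝ → ℝ) :
    ∑ a ∈ Γ.onEdge S e with side b a < 1, g (side b a) =
      if Γ.localState S (Γ.endpt (e, b)) = LocalState.half (e, b) rfl then
        g (Γ.starCoord S (Γ.endpt (e, b))) else 0 := by
  split_ifs with h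
  · obtain ⟨h1, h2⟩ := hS.starCoord_mem_of_isHalf h
    rw [Finset.sum_eq_single_of_mem (side b (Γ.starCoord S (Γ.endpt (e, b))))]
    · rw [side_side]
    · rw [Finset.mem_filter, mem_onEdge _ hfin, side_side]
      exact ⟨⟨side_mem ⟨h1.1, by linarith [h1.2]⟩, h2⟩, h1.2⟩
    · intro a ha hne
      rw [Finset.mem_filter, mem_onEdge _ hfin] at ha
      have := Γ.arc_side_mem_openStar ha.1.1 ha.2 (e := e)
      have h3 := hS _ ⟨ha.1.2, this⟩ ⟨h2, Γ.halfArc_mem_openStar rfl h1⟩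
      rw [← Γ.halfArc_side e b a] at h3
      have := (Γ.halfArc_inj ⟨(side_mem ha.1.1).1, ha.2⟩ h1 h3).2
      rw [← this, side_side] at hne
      exact absurd rfl hne
  · rw [Finset.filter_false_of_mem, Finset.sum_empty]
    intro a ha hlt
    rw [mem_onEdge _ hfin] at ha
    refine h (hS.localState_of_half rfl ⟨(side_mem ha.1).1, hlt⟩ ?_)
    rw [halfArc_side]
    exact ha.2

theorem sum_onEdge_eq {S : Set X} (e : E) (g : ℝ → ℝ) :
    ∑ a ∈ Γ.onEdge S e, g a = ∑ a ∈ Γ.onEdge S e with 1 ≤ a ∧ a ≤ 4, g a +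
      ∑ a ∈ Γ.onEdge S e with side false a < 1, g a +
        ∑ a ∈ Γ.onEdge S e with side true a < 1, g a := by
  simp only [Finset.sum_filter, ← Finset.sum_add_distrib]
  refine Finset.sum_congr rfl fun a _ => ?_
  simp only [side]
  by_cases h1 : a < 1
  · simp [h1, h1.not_ge, show ¬ 5 - a < 1 by linarith]
  · by_cases h2 : 4 < a
    · simp [h1, h2.not_ge, show 5 - a < 1 by linarith]
    · simp [h1, not_lt.1 h1, not_lt.1 h2, show ¬ 5 - a < 1 by linarith [not_lt.1 h2]]

open Classical in
/-- The contribution of the half-edge `h` to the mass on its edge of a labelling `l` with the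
coordinates `d`. -/
def Labelling.part {Γ : TopGraph V E X} (l : Γ.Labelling) (d : V → ℝ) (h : E × Bool) : ℝ :=
  if l.state (Γ.endpt h) = LocalState.half h rfl then d (Γ.endpt h) else 0

theorem Labelling.part_congr {Γ : TopGraph V E X} {l l' : Γ.Labelling} {d d' : V → ℝ}
    {h : E × Bool} (hl : l.state (Γ.endpt h) = l'.state (Γ.endpt h))
    (hd : d (Γ.endpt h) = d' (Γ.endpt h)) : l.part d h = l'.part d' h := by
  rw [Labelling.part, Labelling.part, hl, hd]

theorem Reduced.card_onEdge {Γ : TopGraph V E X} {S : Set X} (hS : Γ.Reduced S) (hfin : S.Finite)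
    (e : E) : ((Γ.onEdge S e).card : ℝ) = (Γ.labelling S).edge e +
      (Γ.labelling S).part (fun _ => 1) (e, false) +
        (Γ.labelling S).part (fun _ => 1) (e, true) := by
  have h1 := Γ.sum_onEdge_eq (S := S) e fun _ => 1
  rw [hS.sum_side hfin e false fun _ => 1, hS.sum_side hfin e true fun _ => 1] at h1
  simp only [Finset.sum_const, nsmul_eq_mul, mul_one] at h1
  rw [h1, labelling_edge _ hfin]
  rfl

open Classical in
/-- The function that is `1` at the points of the open edge `e` at distance at least `1` from the
ends, and the distance from the closest end at the other points of `e`. -/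
def edgeMass (e : E) : X → ℝ :=
  Γ.extend (fun _ => 0) fun e' s => if e' = e then min 1 (min s (5 - s)) else 0

theorem continuous_edgeMass [Finite V] [Finite E] [T2Space X] (e : E) :
    Continuous (Γ.edgeMass e) := by
  classical
  refine Γ.continuous_extend (fun e' => ?_) (fun e' => ?_) (fun e' => ?_)
  · split_ifs <;> fun_prop
  · simp
  · simp

theorem edgeMass_vert (e : E) (v : V) : Γ.edgeMass e (Γ.vert v) = 0 := Γ.extend_vert _ _ v

theorem edgeMass_arc (e : E) {s : ℝ} (hs : s ∈ Icc (0 : ℝ) 5) :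
    Γ.edgeMass e (Γ.arc e s) = min 1 (min s (5 - s)) := by
  rw [edgeMass, extend_arc_of_mem_Icc _ (by simp) (by simp) hs, if_pos rfl]

theorem edgeMass_support (e : E) (p : X) (hp : Γ.edgeMass e p ≠ 0) :
    ∃ s ∈ Ioo (0 : ℝ) 5, p = Γ.arc e s := by
  rcases Γ.exists_eq p with ⟨w, rfl⟩ | ⟨e', s, hs, rfl⟩
  · exact absurd (Γ.edgeMass_vert e w) hp
  · rw [edgeMass, extend_arc _ _ _ _ hs] at hp
    split_ifs at hp with h
    · exact ⟨s, hs, by rw [h]⟩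
    · exact absurd rfl hp

theorem edgeMass_le_one (e : E) (p : X) : Γ.edgeMass e p ≤ 1 := by
  by_cases hp : Γ.edgeMass e p = 0
  · rw [hp]; exact zero_le_one
  · obtain ⟨s, hs, rfl⟩ := Γ.edgeMass_support e p hp
    rw [Γ.edgeMass_arc e (Ioo_subset_Icc_self hs)]
    exact min_le_left _ _

theorem Reduced.total_edgeMass {Γ : TopGraph V E X} {S : Set X} (hS : Γ.Reduced S)
    (hfin : S.Finite) (e : E) : total (Γ.edgeMass e) S = (Γ.labelling S).edge e +
      (Γ.labelling S).part (fun v => Γ.starCoord S v) (e, false) +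
        (Γ.labelling S).part (fun v => Γ.starCoord S v) (e, true) := by
  rw [Γ.total_eq_sum_onEdge hfin e (Γ.edgeMass_support e), Γ.sum_onEdge_eq (S := S) e]
  congr 1
  · congr 1
    · rw [labelling_edge _ hfin, Finset.sum_congr rfl (g := fun _ => (1 : ℝ)) fun a ha => ?_]
      · simp
      · obtain ⟨ha, h1, h2⟩ := Finset.mem_filter.1 ha
        rw [Γ.edgeMass_arc e (Ioo_subset_Icc_self (Γ.onEdge_subset S e a ha))]
        exact min_eq_left (le_min h1 (by linarith))
    · refine Eq.trans (Finset.sum_congr rfl fun a ha => ?_) (hS.sum_side hfin e false fun a => a)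
      obtain ⟨ha, h1⟩ := Finset.mem_filter.1 ha
      rw [Γ.edgeMass_arc e (Ioo_subset_Icc_self (Γ.onEdge_subset S e a ha))]
      simp only [side, Bool.false_eq_true, if_false] at h1 ⊢
      rw [min_eq_left (by linarith : a ≤ 5 - a), min_eq_right h1.le]
  · refine Eq.trans (Finset.sum_congr rfl fun a ha => ?_) (hS.sum_side hfin e true fun a => a)
    obtain ⟨ha, h1⟩ := Finset.mem_filter.1 ha
    rw [Γ.edgeMass_arc e (Ioo_subset_Icc_self (Γ.onEdge_subset S e a ha))]
    simp only [side, if_true] at h1 ⊢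
    rw [min_eq_right (by linarith : 5 - a ≤ a), min_eq_right h1.le]

/-! ### Local equivalence of reduced configurations -/

/-- Two sets of particles are locally equivalent if they agree in the open star of radius `1` at
each vertex and have the same number of particles on each open edge. -/
structure LocEq (S S' : Set X) : Prop where
  star_eq : ∀ v, S ∩ Γ.openStar v 1 = S' ∩ Γ.openStar v 1
  card_eq : ∀ e, (Γ.onEdge S e).card = (Γ.onEdge S' e).card

section LocEq

variable {Γ} {S S' : Set X}

theorem LocEq.symm (h : Γ.LocEq S S') : Γ.LocEq S' S :=
  ⟨fun v => (h.star_eq v).symm, fun e => (h.card_eq e).symm⟩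

theorem LocEq.mem_iff (h : Γ.LocEq S S') {v : V} {p : X} (hp : p ∈ Γ.openStar v 1) :
    p ∈ S ↔ p ∈ S' := by
  have := Set.ext_iff.1 (h.star_eq v) p
  simpa [hp] using this

theorem LocEq.reduced (h : Γ.LocEq S S') (hS : Γ.Reduced S) : Γ.Reduced S' := fun v => by
  rw [← h.star_eq v]; exact hS v

theorem Reduced.onEdge_side_inj (hS : Γ.Reduced S) (hfin : S.Finite) {e : E} (b : Bool) :
    ∀ a ∈ Γ.onEdge S e, ∀ a' ∈ Γ.onEdge S e, side b a < 1 → side b a' < 1 → a = a' := by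
  intro a ha a' ha' h h'
  rw [mem_onEdge _ hfin] at ha ha'
  exact (Γ.arc_inj ha.1 ha'.1 (hS _ ⟨ha.2, Γ.arc_side_mem_openStar ha.1 h⟩
    ⟨ha'.2, Γ.arc_side_mem_openStar ha'.1 h'⟩)).2

theorem LocEq.onEdge_side (h : Γ.LocEq S S') (hfin : S.Finite) (hfin' : S'.Finite) {e : E}
    (b : Bool) {a : ℝ} (ha : side b a < 1) : a ∈ Γ.onEdge S e ↔ a ∈ Γ.onEdge S' e := by
  rw [mem_onEdge _ hfin, mem_onEdge _ hfin']
  exact and_congr_right fun h' => h.mem_iff (Γ.arc_side_mem_openStar h' ha)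

theorem LocEq.edgeEq (h : Γ.LocEq S S') (hS : Γ.Reduced S) (hfin : S.Finite)
    (hfin' : S'.Finite) (e : E) : EdgeEq (Γ.onEdge S e) (Γ.onEdge S' e) where
  left a ha b hb h1 h2 := hS.onEdge_side_inj hfin false a ha b hb h1 h2
  right a ha b hb h1 h2 := hS.onEdge_side_inj hfin true a ha b hb
    (by simp only [side, if_true]; linarith) (by simp only [side, if_true]; linarith)
  mem_left _ ha := h.onEdge_side hfin hfin' false ha
  mem_right _ ha := h.onEdge_side hfin hfin' true (by simp only [side, if_true]; linarith)
  card_eq := h.card_eq e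

theorem LocEq.spread_one_subset (h : Γ.LocEq S S') (hS : Γ.Reduced S) (hfin : S.Finite)
    (hfin' : S'.Finite) : Γ.spread 1 S '' S ⊆ Γ.spread 1 S' '' S' := by
  rintro _ ⟨p, hp, rfl⟩
  rcases Γ.exists_eq p with ⟨v, rfl⟩ | ⟨e, s, hs, rfl⟩
  · refine ⟨Γ.vert v, (h.mem_iff (Γ.vert_mem_openStar_self v)).1 hp, ?_⟩
    rw [spread_vert, spread_vert]
  · -- the particles of the same rank on the edge have the same spread position
    obtain ⟨s', hs', heq⟩ := (h.edgeEq hS hfin hfin' e).exists_edgeSpread_one_eq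
      ((Γ.mem_onEdge hfin).2 ⟨hs, hp⟩)
    have hs'' := (Γ.mem_onEdge hfin').1 hs'
    refine ⟨Γ.arc e s', hs''.2, ?_⟩
    rw [spread_arc _ _ _ _ hs''.1, spread_arc _ _ _ _ hs, heq]

theorem LocEq.spread_one_eq (h : Γ.LocEq S S') (hS : Γ.Reduced S) (hfin : S.Finite)
    (hfin' : S'.Finite) : Γ.spread 1 S '' S = Γ.spread 1 S' '' S' :=
  (h.spread_one_subset hS hfin hfin').antisymm
    (h.symm.spread_one_subset (h.reduced hS) hfin' hfin)

theorem spread_mem_openStar {t : ℝ} (ht : t ∈ Icc (0 : ℝ) 1) (hfin : S.Finite) {v : V} {p : X}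
    (hp : p ∈ S) (h : Γ.spread t S p ∈ Γ.openStar v 1) : p ∈ Γ.openStar v 1 := by
  rcases Γ.exists_eq p with ⟨w, rfl⟩ | ⟨e, s, hs, rfl⟩
  · rwa [spread_vert] at h
  · have hA := (Γ.mem_onEdge hfin).2 ⟨hs, hp⟩
    have hsub := Γ.onEdge_subset S e
    rw [spread_arc _ _ _ _ hs, arc_mem_openStar _ (edgeSpread_mem ht hsub hA)] at h
    rw [arc_mem_openStar _ hs]
    refine h.imp (And.imp_right fun h' => ?_) (And.imp_right fun h' => ?_)
    · by_contra hn
      exact absurd (one_le_edgeSpread ht hsub hA (not_lt.1 hn)) h'.not_ge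
    · by_contra hn
      exact absurd (edgeSpread_le_four ht hsub hA (not_lt.1 hn)) h'.not_ge

theorem Reduced.spread (hS : Γ.Reduced S) {t : ℝ} (ht : t ∈ Icc (0 : ℝ) 1) (hfin : S.Finite) :
    Γ.Reduced (Γ.spread t S '' S) := by
  rintro v _ ⟨⟨p, hp, rfl⟩, hp'⟩ _ ⟨⟨q, hq, rfl⟩, hq'⟩
  rw [hS v ⟨hp, spread_mem_openStar ht hfin hp hp'⟩ ⟨hq, spread_mem_openStar ht hfin hq hq'⟩]

theorem onEdge_spread {t : ℝ} (ht : t ∈ Icc (0 : ℝ) 1) (hfin : S.Finite) (e : E) :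
    Γ.onEdge (Γ.spread t S '' S) e =
      (Γ.onEdge S e).image (edgeSpread t (Γ.onEdge S e)) := by
  have hsub := Γ.onEdge_subset S
  ext a
  rw [mem_onEdge _ (hfin.image _), Finset.mem_image]
  constructor
  · rintro ⟨ha, p, hp, hpa⟩
    rcases Γ.exists_eq p with ⟨w, rfl⟩ | ⟨e', s, hs, rfl⟩
    · rw [spread_vert] at hpa
      exact absurd hpa (Γ.vert_ne_arc w e ha)
    · have hA := (Γ.mem_onEdge hfin).2 ⟨hs, hp⟩
      rw [spread_arc _ _ _ _ hs] at hpa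
      obtain ⟨rfl, h⟩ := Γ.arc_inj (edgeSpread_mem ht (hsub e') hA) ha hpa
      exact ⟨s, hA, h⟩
  · rintro ⟨s, hs, rfl⟩
    have hs' := (Γ.mem_onEdge hfin).1 hs
    exact ⟨edgeSpread_mem ht (hsub e) hs, Γ.arc e s, hs'.2, Γ.spread_arc _ _ _ hs'.1⟩

theorem card_onEdge_spread {t : ℝ} (ht : t ∈ Icc (0 : ℝ) 1) (hfin : S.Finite) (e : E) :
    (Γ.onEdge (Γ.spread t S '' S) e).card = (Γ.onEdge S e).card := by
  rw [onEdge_spread ht hfin]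
  refine Finset.card_image_of_injOn fun a ha b hb hab => ?_
  have hsub := Γ.onEdge_subset S e
  rcases lt_trichotomy a b with h | h | h
  · exact absurd hab (edgeSpread_lt ht hsub ha hb h).ne
  · exact h
  · exact absurd hab (edgeSpread_lt ht hsub hb ha h).ne'

theorem LocEq.spread_star_subset (h : Γ.LocEq S S') (hS : Γ.Reduced S) (hfin : S.Finite)
    (hfin' : S'.Finite) {t : ℝ} (ht : t ∈ Icc (0 : ℝ) 1) (v : V) :
    Γ.spread t S '' S ∩ Γ.openStar v 1 ⊆ Γ.spread t S' '' S' ∩ Γ.openStar v 1 := by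
  rintro _ ⟨⟨p, hp, rfl⟩, hp'⟩
  refine ⟨?_, hp'⟩
  have hpv := spread_mem_openStar ht hfin hp hp'
  refine ⟨p, (h.mem_iff hpv).1 hp, ?_⟩
  rcases Γ.exists_eq p with ⟨w, rfl⟩ | ⟨e, s, hs, rfl⟩
  · rw [spread_vert, spread_vert]
  · rw [spread_arc _ _ _ _ hs, spread_arc _ _ _ _ hs]
    rw [arc_mem_openStar _ hs] at hpv
    rw [(h.edgeEq hS hfin hfin' e).edgeSpread_eq t ((Γ.mem_onEdge hfin).2 ⟨hs, hp⟩)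
      (hpv.imp And.right And.right)]

theorem LocEq.spread (h : Γ.LocEq S S') (hS : Γ.Reduced S) (hfin : S.Finite)
    (hfin' : S'.Finite) {t : ℝ} (ht : t ∈ Icc (0 : ℝ) 1) :
    Γ.LocEq (Γ.spread t S '' S) (Γ.spread t S' '' S') where
  star_eq v := (h.spread_star_subset hS hfin hfin' ht v).antisymm
    (h.symm.spread_star_subset (h.reduced hS) hfin' hfin ht v)
  card_eq e := by rw [card_onEdge_spread ht hfin, card_onEdge_spread ht hfin', h.card_eq]

theorem LocEq.localState_eq (h : Γ.LocEq S S') (hS : Γ.Reduced S) (v : V) :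
    Γ.localState S v = Γ.localState S' v ∧ Γ.starCoord S v = Γ.starCoord S' v := by
  have hS' := h.reduced hS
  rcases Γ.star_cases S v with h1 | ⟨k, hv, r, hr, h1⟩ | h1
  · have h2 := (h.mem_iff (Γ.vert_mem_openStar_self v)).1 h1
    rw [localState_of_vert h1, localState_of_vert h2, hS.starCoord_of_vert h1,
      hS'.starCoord_of_vert h2]
    exact ⟨rfl, rfl⟩
  · have h2 := (h.mem_iff (Γ.halfArc_mem_openStar hv hr)).1 h1
    rw [hS.localState_of_half hv hr h1, hS'.localState_of_half hv hr h2]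
    exact ⟨rfl, Subtype.ext (by
      rw [hS.starCoord_of_half hv hr h1, hS'.starCoord_of_half hv hr h2])⟩
  · have h2 : S' ∩ Γ.openStar v 1 = ∅ := by rw [← h.star_eq, h1]
    rw [localState_of_empty h1, localState_of_empty h2, starCoord_of_empty h1,
      starCoord_of_empty h2]
    exact ⟨rfl, rfl⟩

theorem LocEq.labelling_eq (h : Γ.LocEq S S') (hS : Γ.Reduced S) (hfin : S.Finite)
    (hfin' : S'.Finite) : Γ.labelling S = Γ.labelling S' := by
  have hstate : (Γ.labelling S).state = (Γ.labelling S').state :=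
    funext fun v => (h.localState_eq hS v).1
  have hedge : (Γ.labelling S).edge = (Γ.labelling S').edge := by
    funext e
    have h1 := hS.card_onEdge hfin e
    have h2 := (h.reduced hS).card_onEdge hfin' e
    rw [← h.card_eq e, h1] at h2
    rw [Labelling.part_congr (congrFun hstate _) rfl,
      Labelling.part_congr (congrFun hstate (Γ.endpt (e, true))) rfl] at h2
    have : ((Γ.labelling S).edge e : ℝ) = (Γ.labelling S').edge e := by linarith
    exact_mod_cast this
  calc Γ.labelling S = ⟨(Γ.labelling S).edge, (Γ.labelling S).state⟩ := rfl
    _ = _ := by rw [hstate, hedge]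

end LocEq

theorem record_eq_of_locEq {x x' : Γ.RedConf}
    (h : Γ.LocEq x.1.2.support x'.1.2.support) : Γ.record x = Γ.record x' := by
  rw [record_eq, record_eq, h.labelling_eq x.2 x.1.2.finite_support x'.1.2.finite_support,
    funext fun v => (h.localState_eq x.2 v).2]

end TopGraph

namespace TopGraph

variable {V E X : Type*} [TopologicalSpace X] (Γ : TopGraph V E X)

/-! ### Labellings that are compatible with a configuration -/

open Classical in
/-- The function that is `r * (1 - r)` at the points at distance `r ∈ [0, 1]` from the end `h` on
the half-edge `h`, and `0` elsewhere. -/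
def tent (h : E × Bool) : X → ℝ :=
  Γ.extend (fun _ => 0) fun e s =>
    if e = h.1 then max 0 (side h.2 s * (1 - side h.2 s)) else 0

theorem continuous_tent [Finite V] [Finite E] [T2Space X] (h : E × Bool) :
    Continuous (Γ.tent h) := by
  classical
  obtain ⟨e, b⟩ := h
  refine Γ.continuous_extend (fun e' => ?_) (fun e' => ?_) (fun e' => ?_)
  · cases b <;> simp only [side] <;> split_ifs <;> fun_prop
  · cases b <;> simp [side]; norm_num
  · cases b <;> simp [side]; norm_num

theorem tent_support (h : E × Bool) (p : X) (hp : Γ.tent h p ≠ 0) :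
    ∃ r ∈ Ioo (0 : ℝ) 1, p = Γ.halfArc h r := by
  rcases Γ.exists_eq p with ⟨w, rfl⟩ | ⟨e, s, hs, rfl⟩
  · exact absurd (Γ.extend_vert _ _ w) hp
  · rw [tent, extend_arc _ _ _ _ hs] at hp
    split_ifs at hp with he
    · subst he
      have h0 := (side_mem (b := h.2) hs).1
      refine ⟨side h.2 s, ⟨h0, ?_⟩, (Γ.halfArc_side h.1 h.2 s).symm⟩
      by_contra hn
      exact hp (max_eq_left (mul_nonpos_of_nonneg_of_nonpos h0.le (by linarith)))
    · exact absurd rfl hp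

theorem tent_eq_zero {h : E × Bool} {p : X} (hp : p ∉ Γ.openStar (Γ.endpt h) 1) :
    Γ.tent h p = 0 := by
  by_contra hn
  obtain ⟨r, hr, rfl⟩ := Γ.tent_support h p hn
  exact hp (Γ.halfArc_mem_openStar rfl hr)

theorem tent_halfArc (h : E × Bool) {r : ℝ} (hr : r ∈ Ioo (0 : ℝ) 1) :
    Γ.tent h (Γ.halfArc h r) = r * (1 - r) := by
  rw [halfArc_eq, tent, extend_arc _ _ _ _ (side_mem ⟨hr.1, by linarith [hr.2]⟩), if_pos rfl,
    side_side, max_eq_right (mul_nonneg hr.1.le (by linarith [hr.2]))]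

theorem tent_vert (h : E × Bool) (v : V) : Γ.tent h (Γ.vert v) = 0 := Γ.extend_vert _ _ v

variable {Γ}

/-- The labelling `l` is compatible with the set of particles `S` if the point of the cube of `l`
with the coordinates `starCoord S` represents the image of `S` in `UK(Γ)`.  All conditions are
equations between continuous functions of `S`: the point may lie on the boundary of the cube.  The
condition `half` says that a particle at a distance in `(0, 1)` from `v` lies on `h`. -/
structure Compat (l : Γ.Labelling) (S : Set X) : Prop where
  vertex : ∀ v, l.state v = LocalState.vertex → (Γ.starCoord S v : ℝ) = 0
  empty : ∀ v, l.state v = LocalState.empty → (Γ.starCoord S v : ℝ) = 1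
  half : ∀ v h hv, l.state v = LocalState.half h hv →
    total (Γ.tent h) S = Γ.starCoord S v * (1 - Γ.starCoord S v)
  edge : ∀ e, (l.edge e : ℝ) + l.part (fun v => Γ.starCoord S v) (e, false) +
    l.part (fun v => Γ.starCoord S v) (e, true) = total (Γ.edgeMass e) S

variable {S : Set X} {l l' : Γ.Labelling}

theorem Reduced.total_tent (hS : Γ.Reduced S) {h : E × Bool} {r : ℝ} (hr : r ∈ Ioo (0 : ℝ) 1)
    (hrS : Γ.halfArc h r ∈ S) : total (Γ.tent h) S = r * (1 - r) := by
  rw [hS.total_eq hrS (Γ.halfArc_mem_openStar rfl hr) fun p hp => Γ.tent_eq_zero hp,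
    Γ.tent_halfArc h hr]

theorem Reduced.compat_labelling (hS : Γ.Reduced S) (hfin : S.Finite) :
    Compat (Γ.labelling S) S where
  vertex v hv := by
    change Γ.localState S v = _ at hv
    rcases Γ.star_cases S v with h | ⟨h, hv', r, hr, h1⟩ | h
    · rw [hS.starCoord_of_vert h]; rfl
    · rw [hS.localState_of_half hv' hr h1] at hv; cases hv
    · rw [localState_of_empty h] at hv; cases hv
  empty v hv := by
    change Γ.localState S v = _ at hv
    rcases Γ.star_cases S v with h | ⟨h, hv', r, hr, h1⟩ | h
    · rw [localState_of_vert h] at hv; cases hv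
    · rw [hS.localState_of_half hv' hr h1] at hv; cases hv
    · rw [starCoord_of_empty h]; rfl
  half v h hv H := by
    obtain ⟨h1, h2⟩ := hS.starCoord_mem_of_isHalf H
    exact hS.total_tent h1 h2
  edge e := (hS.total_edgeMass hfin e).symm

theorem LocalState.half_inj {v : V} {h h' : E × Bool} {hv : Γ.endpt h = v} {hv' : Γ.endpt h' = v}
    (heq : (LocalState.half h hv : Γ.LocalState v) = LocalState.half h' hv') : h = h' := by
  injection heq

theorem Labelling.part_eq_zero {d : V → ℝ} {h : E × Bool}
    (hl : ¬ (l.state (Γ.endpt h)).IsHalf) : l.part d h = 0 :=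
  if_neg fun h' => hl ⟨h, rfl, h'⟩

open Classical in
/-- The effect on the edge contributions of forgetting the half-edge `h` at the vertex `v`. -/
theorem Labelling.part_of_forget {d d' : V → ℝ} {v : V} {h : E × Bool} {hv : Γ.endpt h = v}
    (hl : l.state v = LocalState.half h hv) (hl' : ¬ (l'.state v).IsHalf)
    (hne : ∀ w, w ≠ v → l'.state w = l.state w)
    (hd : ∀ w, w ≠ v → (l.state w).IsHalf → d' w = d w) (k : E × Bool) :
    l'.part d' k = l.part d k - if k = h then d v else 0 := by
  subst hv
  by_cases hk : Γ.endpt k = Γ.endpt h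
  · have h1 : l'.part d' k = 0 := Labelling.part_eq_zero (by rw [hk]; exact hl')
    rw [h1]
    split_ifs with hkh
    · subst hkh
      rw [Labelling.part, if_pos hl, sub_self]
    · rw [Labelling.part, if_neg, sub_zero]
      intro h2
      apply hkh
      have h3 : ∀ w (hw : Γ.endpt k = w), l.state w = LocalState.half k hw := by
        rintro _ rfl; exact h2
      exact LocalState.half_inj ((h3 _ hk).symm.trans hl)
  · rw [if_neg (fun h' => hk (by rw [h'])), sub_zero]
    by_cases hH : (l.state (Γ.endpt k)).IsHalf
    · exact Labelling.part_congr (hne _ hk) (hd _ hk hH)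
    · rw [Labelling.part_eq_zero hH, Labelling.part_eq_zero (by rwa [hne _ hk])]

open Classical in
/-- The labelling obtained from `l` by replacing the state at the vertex of `h` by `σ`, and adding
`n` to the label of the edge of `h`. -/
def Labelling.forget (l : Γ.Labelling) (h : E × Bool) (σ : Γ.LocalState (Γ.endpt h)) (n : ℕ) :
    Γ.Labelling where
  edge e := l.edge e + if e = h.1 then n else 0
  state := Function.update l.state (Γ.endpt h) σ

theorem Labelling.forget_state_self (l : Γ.Labelling) (h : E × Bool)
    (σ : Γ.LocalState (Γ.endpt h)) (n : ℕ) : (l.forget h σ n).state (Γ.endpt h) = σ := by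
  simp [Labelling.forget]

theorem Labelling.forget_state_of_ne (l : Γ.Labelling) (h : E × Bool)
    (σ : Γ.LocalState (Γ.endpt h)) (n : ℕ) {w : V} (hw : w ≠ Γ.endpt h) :
    (l.forget h σ n).state w = l.state w := by
  simp [Labelling.forget, hw]

theorem Labelling.forget_edge_self (l : Γ.Labelling) (h : E × Bool)
    (σ : Γ.LocalState (Γ.endpt h)) (n : ℕ) : (l.forget h σ n).edge h.1 = l.edge h.1 + n := by
  simp [Labelling.forget]

theorem Labelling.forget_edge_of_ne (l : Γ.Labelling) (h : E × Bool)
    (σ : Γ.LocalState (Γ.endpt h)) (n : ℕ) {e : E} (he : e ≠ h.1) :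
    (l.forget h σ n).edge e = l.edge e := by
  simp [Labelling.forget, he]

theorem Compat.forget (hl : Compat l S) {h : E × Bool}
    (hh : l.state (Γ.endpt h) = LocalState.half h rfl) {σ : Γ.LocalState (Γ.endpt h)} {n : ℕ}
    (hσ : ¬ σ.IsHalf) (hn : (Γ.starCoord S (Γ.endpt h) : ℝ) = n)
    (h0 : σ = LocalState.vertex → n = 0) (h1 : σ = LocalState.empty → n = 1) :
    Compat (l.forget h σ n) S := by
  classical
  have hself := l.forget_state_self h σ n
  have hne : ∀ w, w ≠ Γ.endpt h → (l.forget h σ n).state w = l.state w :=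
    fun w hw => l.forget_state_of_ne h σ n hw
  refine ⟨fun v hv => ?_, fun v hv => ?_, fun v k hk hv => ?_, fun e => ?_⟩
  · by_cases hvh : v = Γ.endpt h
    · subst hvh
      rw [hn, h0 (hself.symm.trans hv), Nat.cast_zero]
    · exact hl.vertex v ((hne v hvh).symm.trans hv)
  · by_cases hvh : v = Γ.endpt h
    · subst hvh
      rw [hn, h1 (hself.symm.trans hv), Nat.cast_one]
    · exact hl.empty v ((hne v hvh).symm.trans hv)
  · by_cases hvh : v = Γ.endpt h
    · subst hvh
      exact absurd ⟨k, hk, hself.symm.trans hv⟩ hσ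
    · exact hl.half v k hk ((hne v hvh).symm.trans hv)
  · have hpart := Labelling.part_of_forget (l' := l.forget h σ n)
      (d := fun v => (Γ.starCoord S v : ℝ)) (d' := fun v => (Γ.starCoord S v : ℝ)) hh
      (by rwa [hself]) hne (fun _ _ _ => rfl)
    rw [hpart, hpart, ← hl.edge e, hn]
    obtain ⟨e', b⟩ := h
    by_cases he : e = e'
    · subst he
      rw [l.forget_edge_self (e, b), Nat.cast_add]
      cases b
      · simp
      · simp
        ring
    · rw [l.forget_edge_of_ne (e', b) σ n he]
      simp [he]

/-- A labelling is generic for the coordinates `d` if these belong to an interior point of its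
cube. -/
def Labelling.Generic (l : Γ.Labelling) (d : V → Icc (0 : ℝ) 1) : Prop :=
  ∀ v, (l.state v).IsHalf → (d v : ℝ) ∈ Ioo (0 : ℝ) 1

/-- Passing to faces replaces a compatible labelling by a generic one with the same point of
`UK(Γ)`. -/
theorem Compat.exists_generic [Finite V] (hl : Compat l S) :
    ∃ l' : Γ.Labelling, Compat l' S ∧ l'.Generic (Γ.starCoord S) ∧
      (Quot.mk Γ.Glue (cubePoint l' (Γ.starCoord S)) : Γ.UK) =
        Quot.mk Γ.Glue (cubePoint l (Γ.starCoord S)) := by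
  induction hn : {v | (l.state v).IsHalf}.ncard using Nat.strong_induction_on generalizing l with
  | _ n ih =>
  by_cases hg : l.Generic (Γ.starCoord S)
  · exact ⟨l, hl, hg, rfl⟩
  simp only [Labelling.Generic, not_forall] at hg
  obtain ⟨_, ⟨h, rfl, hh⟩, hd⟩ := hg
  have hfin : {v | (l.state v).IsHalf}.Finite := Set.toFinite _
  have hlt : ∀ (σ : Γ.LocalState (Γ.endpt h)) (m : ℕ), ¬ σ.IsHalf →
      {v | ((l.forget h σ m).state v).IsHalf}.ncard < n := by
    intro σ m hσ
    rw [← hn]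
    refine Set.ncard_lt_ncard ⟨fun v hv => ?_, fun hsub => ?_⟩ hfin
    · by_cases hvh : v = Γ.endpt h
      · subst hvh; exact ⟨h, rfl, hh⟩
      · rwa [mem_ofPred_eq, l.forget_state_of_ne h σ m hvh] at hv
    · have := hsub (show Γ.endpt h ∈ {v | (l.state v).IsHalf} from ⟨h, rfl, hh⟩)
      rw [mem_ofPred_eq, l.forget_state_self] at this
      exact hσ this
  -- the coordinate of `h` is an end of `[0, 1]`, so the point lies on a face of the cube of `l`
  have hbd := (Γ.starCoord S (Γ.endpt h)).2
  have hcase : (Γ.starCoord S (Γ.endpt h) : ℝ) = 0 ∨ (Γ.starCoord S (Γ.endpt h) : ℝ) = 1 := by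
    by_contra! hcon
    exact hd ⟨lt_of_le_of_ne hbd.1 hcon.1.symm, lt_of_le_of_ne hbd.2 hcon.2⟩
  rcases hcase with h0 | h1
  · have hσ : ¬ (LocalState.vertex : Γ.LocalState (Γ.endpt h)).IsHalf := by
      rintro ⟨_, _, h⟩; cases h
    obtain ⟨l', hc, hg, heq⟩ := ih _ (hlt LocalState.vertex 0 hσ) (hl.forget hh (n := 0) hσ
      (by simpa using h0) (fun _ => rfl) (fun h => by cases h)) rfl
    refine ⟨l', hc, hg, heq.trans (Quot.sound ⟨_, h, rfl, hh, Or.inl ⟨?_, fun e => ?_, ?_⟩,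
      fun w hw => ?_, fun _ _ _ => rfl⟩)⟩
    · exact l.forget_state_self _ _ _
    · simp [cubePoint, Labelling.forget]
    · exact Subtype.ext h0
    · exact l.forget_state_of_ne _ _ _ hw
  · have hσ : ¬ (LocalState.empty : Γ.LocalState (Γ.endpt h)).IsHalf := by
      rintro ⟨_, _, h⟩; cases h
    obtain ⟨l', hc, hg, heq⟩ := ih _ (hlt LocalState.empty 1 hσ) (hl.forget hh (n := 1) hσ
      (by simpa using h1) (fun h => by cases h) (fun _ => rfl)) rfl
    refine ⟨l', hc, hg, heq.trans (Quot.sound ⟨_, h, rfl, hh, Or.inr ⟨?_, ?_, fun e he => ?_, ?_⟩,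
      fun w hw => ?_, fun _ _ _ => rfl⟩)⟩
    · exact l.forget_state_self _ _ _
    · simp [cubePoint, Labelling.forget]
    · simp [cubePoint, Labelling.forget, he]
    · exact Subtype.ext h1
    · exact l.forget_state_of_ne _ _ _ hw

theorem Compat.exists_particle (hl : Compat l S) (hg : l.Generic (Γ.starCoord S)) {v : V}
    {h : E × Bool} {hv : Γ.endpt h = v} (hh : l.state v = LocalState.half h hv) :
    ∃ r ∈ Ioo (0 : ℝ) 1, Γ.halfArc h r ∈ S := by
  have h1 := hg v ⟨h, hv, hh⟩
  have h2 : ∑ᶠ p ∈ S, Γ.tent h p ≠ 0 := by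
    have := hl.half v h hv hh
    rw [total] at this
    rw [this]
    exact (mul_pos h1.1 (by linarith [h1.2])).ne'
  obtain ⟨p, hp, hp'⟩ := exists_ne_zero_of_finsum_mem_ne_zero h2
  obtain ⟨r, hr, rfl⟩ := Γ.tent_support h p hp'
  exact ⟨r, hr, hp⟩

theorem Compat.eq_of_generic (hS : Γ.Reduced S) (hl : Compat l S) (hl' : Compat l' S)
    (hg : l.Generic (Γ.starCoord S)) (hg' : l'.Generic (Γ.starCoord S)) : l = l' := by
  have hstate : ∀ v, l.state v = l'.state v := by
    intro v
    have hv := hl.vertex v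
    have he := hl.empty v
    have hv' := hl'.vertex v
    have he' := hl'.empty v
    have hgv := hg v
    have hgv' := hg' v
    rcases h1 : l.state v with _ | _ | ⟨h, hh⟩ <;> rcases h2 : l'.state v with _ | _ | ⟨h', hh'⟩
    · rfl
    · linarith [he h1, hv' h2]
    · exact absurd (he h1) (hgv' ⟨h', hh', h2⟩).2.ne
    · linarith [he' h2, hv h1]
    · rfl
    · exact absurd (hv h1) (hgv' ⟨h', hh', h2⟩).1.ne'
    · exact absurd (he' h2) (hgv ⟨h, hh, h1⟩).2.ne
    · exact absurd (hv' h2) (hgv ⟨h, hh, h1⟩).1.ne'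
    · obtain ⟨r, hr, hrS⟩ := hl.exists_particle hg h1
      obtain ⟨r', hr', hrS'⟩ := hl'.exists_particle hg' h2
      have := (Γ.halfArc_inj hr hr' (hS v ⟨hrS, Γ.halfArc_mem_openStar hh hr⟩
        ⟨hrS', Γ.halfArc_mem_openStar hh' hr'⟩)).1
      subst this
      rfl
  have hedge : ∀ e, l.edge e = l'.edge e := by
    intro e
    have h1 := hl.edge e
    have h2 := hl'.edge e
    rw [Labelling.part_congr (hstate _) rfl,
      Labelling.part_congr (h := (e, true)) (hstate _) rfl, ← h2] at h1
    have : (l.edge e : ℝ) = l'.edge e := by linarith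
    exact_mod_cast this
  obtain ⟨a, b⟩ := l
  obtain ⟨a', b'⟩ := l'
  obtain rfl : a = a' := funext hedge
  obtain rfl : b = b' := funext hstate
  rfl

theorem Compat.record_eq [Finite V] {x : Γ.RedConf} (hl : Compat l x.1.2.support) :
    Γ.record x = Quot.mk Γ.Glue (cubePoint l (Γ.starCoord x.1.2.support)) := by
  have hS : Γ.Reduced x.1.2.support := x.2
  obtain ⟨l₁, hc₁, hg₁, heq₁⟩ := hl.exists_generic
  obtain ⟨l₂, hc₂, hg₂, heq₂⟩ := (hS.compat_labelling x.1.2.finite_support).exists_generic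
  rw [TopGraph.record_eq, ← heq₁, ← heq₂, hc₁.eq_of_generic hS hc₂ hg₁ hg₂]

/-! ### Continuity of the comparison map -/

variable (Γ)

instance [Finite E] (v : V) : Finite (Γ.LocalState v) :=
  Finite.of_surjective (fun c : Bool ⊕ {h : E × Bool // Γ.endpt h = v} =>
    match c with
    | Sum.inl true => LocalState.vertex
    | Sum.inl false => LocalState.empty
    | Sum.inr h => LocalState.half h.1 h.2) (by
    rintro (_ | _ | ⟨h, hv⟩)
    · exact ⟨Sum.inl false, rfl⟩
    · exact ⟨Sum.inl true, rfl⟩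
    · exact ⟨Sum.inr ⟨h, hv⟩, rfl⟩)

theorem finite_labelling_le [Finite V] [Finite E] (k : ℕ) :
    {l : Γ.Labelling | ∀ e, l.edge e ≤ k}.Finite := by
  have : Finite ↑{l : Γ.Labelling | ∀ e, l.edge e ≤ k} := by
    refine Finite.of_injective (fun l : ↑{l : Γ.Labelling | ∀ e, l.edge e ≤ k} =>
      ((fun e => ⟨l.1.edge e, Nat.lt_succ_of_le (l.2 e)⟩, l.1.state) :
        (E → Fin (k + 1)) × ∀ v, Γ.LocalState v)) ?_
    rintro ⟨⟨a, b⟩, h⟩ ⟨⟨a', b'⟩, h'⟩ heq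
    simp only [Prod.mk.injEq] at heq
    obtain rfl : a = a' := funext fun e => congrArg Fin.val (congrFun heq.1 e)
    obtain rfl := heq.2
    rfl
  exact Set.toFinite _

theorem total_edgeMass_le {k : ℕ} (x : UConf k X) (e : E) :
    total (Γ.edgeMass e) x.support ≤ k := by
  induction x using Quotient.inductionOn with
  | h y =>
    refine (total_range (Γ.edgeMass e) y.2).trans_le ?_
    refine (Finset.sum_le_sum fun i _ => Γ.edgeMass_le_one e (y.1 i)).trans ?_
    simp

theorem continuous_starCoord [Finite V] [Finite E] [T2Space X] (v : V) :
    Continuous fun x : Γ.RedConf => Γ.starCoord x.1.2.support v :=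
  continuous_projIcc.comp (continuous_const.sub
    ((continuous_total (Γ.continuous_bump v)).comp continuous_subtype_val))

theorem isClosed_compat [Finite V] [Finite E] [T2Space X] (l : Γ.Labelling) :
    IsClosed {x : Γ.RedConf | Compat l x.1.2.support} := by
  have hd : ∀ v, Continuous fun x : Γ.RedConf => (Γ.starCoord x.1.2.support v : ℝ) := fun v =>
    continuous_subtype_val.comp (Γ.continuous_starCoord v)
  have htot : ∀ {φ : X → ℝ}, Continuous φ →
      Continuous fun x : Γ.RedConf => total φ x.1.2.support := fun hφ =>
    (continuous_total hφ).comp continuous_subtype_val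
  have hpart : ∀ h, Continuous fun x : Γ.RedConf =>
      l.part (fun v => (Γ.starCoord x.1.2.support v : ℝ)) h := fun h => by
    unfold Labelling.part
    split_ifs
    · exact hd _
    · exact continuous_const
  have : {x : Γ.RedConf | Compat l x.1.2.support} =
      ({x | ∀ v, l.state v = LocalState.vertex → (Γ.starCoord x.1.2.support v : ℝ) = 0} ∩
        {x | ∀ v, l.state v = LocalState.empty → (Γ.starCoord x.1.2.support v : ℝ) = 1}) ∩
      ({x | ∀ v h hv, l.state v = LocalState.half h hv → total (Γ.tent h) x.1.2.support =
          Γ.starCoord x.1.2.support v * (1 - Γ.starCoord x.1.2.support v)} ∩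
        {x | ∀ e, (l.edge e : ℝ) + l.part (fun v => Γ.starCoord x.1.2.support v) (e, false) +
          l.part (fun v => Γ.starCoord x.1.2.support v) (e, true) =
            total (Γ.edgeMass e) x.1.2.support}) := by
    ext x
    exact ⟨fun h => ⟨⟨h.vertex, h.empty⟩, h.half, h.edge⟩,
      fun h => ⟨h.1.1, h.1.2, h.2.1, h.2.2⟩⟩
  rw [this]
  simp only [ofPred_forall]
  refine ((isClosed_iInter fun v => isClosed_iInter fun _ =>
    isClosed_eq (hd v) continuous_const).inter (isClosed_iInter fun v => isClosed_iInter fun _ =>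
      isClosed_eq (hd v) continuous_const)).inter
    ((isClosed_iInter fun v => isClosed_iInter fun h => isClosed_iInter fun _ =>
      isClosed_iInter fun _ => isClosed_eq (htot (Γ.continuous_tent h))
        ((hd v).mul (continuous_const.sub (hd v)))).inter
      (isClosed_iInter fun e => isClosed_eq ((continuous_const.add (hpart _)).add (hpart _))
        (htot (Γ.continuous_edgeMass e))))

theorem isQuotientMap_mk_uk : IsQuotientMap (Quot.mk Γ.Glue : Γ.Cubes → Γ.UK) :=
  isQuotientMap_quot_mk

/-- The configurations that are compatible with a given labelling form a closed set, on which the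
map to `UK(Γ)` lifts to the cube of the labelling; these closed sets are a locally finite cover. -/
theorem continuous_record [Finite V] [Finite E] [T2Space X] : Continuous Γ.record := by
  refine LocallyFinite.continuous (f := fun l : Γ.Labelling =>
    {x : Γ.RedConf | Compat l x.1.2.support}) (fun x => ?_) ?_ Γ.isClosed_compat fun l => ?_
  · refine ⟨{x' | x'.1.1 = x.1.1}, ?_, (Γ.finite_labelling_le x.1.1).subset ?_⟩
    · have h1 : Continuous fun x' : Γ.RedConf => x'.1.1 :=
        (continuous_sigma fun k => continuous_const :
          Continuous fun y : Conf X => y.1).comp continuous_subtype_val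
      exact ((isOpen_discrete {x.1.1}).preimage h1).mem_nhds rfl
    · rintro l ⟨x', hl, hx'⟩ e
      have h1 := hl.edge e
      have h2 := Γ.total_edgeMass_le x'.1.2 e
      have hpart : ∀ h, 0 ≤ l.part (fun v => (Γ.starCoord x'.1.2.support v : ℝ)) h := fun h => by
        unfold Labelling.part
        split_ifs
        · exact (Γ.starCoord _ _).2.1
        · exact le_rfl
      have h3 : (l.edge e : ℝ) ≤ x'.1.1 := by linarith [hpart (e, false), hpart (e, true)]
      rw [← show x'.1.1 = x.1.1 from hx']
      exact_mod_cast h3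
  · refine eq_univ_of_forall fun x => mem_iUnion.2 ⟨Γ.labelling x.1.2.support, ?_⟩
    exact Reduced.compat_labelling (S := x.1.2.support) x.2 x.1.2.finite_support
  · have : Continuous fun x : Γ.RedConf =>
        (Quot.mk Γ.Glue (cubePoint l (Γ.starCoord x.1.2.support)) : Γ.UK) :=
      Γ.isQuotientMap_mk_uk.continuous.comp (continuous_sigmaMk.comp
        (continuous_pi fun v => Γ.continuous_starCoord v.1))
    exact this.continuousOn.congr fun x hx => Compat.record_eq hx

end TopGraph

namespace TopGraph

variable {V E X : Type*} [TopologicalSpace X] (Γ : TopGraph V E X)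

/-! ### Realization of the points of the cubes -/

variable {Γ}

/-- The particle at the vertex `v` that belongs to the labelling `l` and the coordinates `d`, if
`l.state v` is not empty. -/
def starPoint (l : Γ.Labelling) (d : V → Icc (0 : ℝ) 1) (v : V) : X :=
  match l.state v with
  | LocalState.half h _ => Γ.halfArc h (d v)
  | _ => Γ.vert v

/-- The names of the particles of a configuration with the labelling `l`. -/
abbrev ParticleIndex (l : Γ.Labelling) : Type _ :=
  {v // l.state v ≠ LocalState.empty} ⊕ Σ e, Fin (l.edge e)

/-- The particles of the standard realization of a point of the cube of `l`: the particles near the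
vertices are prescribed, and those in the interior of an edge are equally spaced in `(1, 4)`. -/
def particle (l : Γ.Labelling) (d : V → Icc (0 : ℝ) 1) : ParticleIndex l → X
  | Sum.inl v => starPoint l d v
  | Sum.inr ⟨e, i⟩ => Γ.arc e (1 + 3 * ((i + 1 : ℝ) / (l.edge e + 1)))

variable {l l' : Γ.Labelling} {d d' : V → Icc (0 : ℝ) 1}

theorem starPoint_of_half {v : V} {h : E × Bool} {hv : Γ.endpt h = v}
    (H : l.state v = LocalState.half h hv) : starPoint l d v = Γ.halfArc h (d v) := by
  simp [starPoint, H]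

theorem starPoint_of_not_isHalf {v : V} (H : ¬ (l.state v).IsHalf) :
    starPoint l d v = Γ.vert v := by
  unfold starPoint
  split
  · rename_i h hv heq
    exact absurd ⟨h, hv, heq⟩ H
  · rfl

theorem starPoint_congr {v : V} (hl : l.state v = l'.state v)
    (hd : (l.state v).IsHalf → d v = d' v) : starPoint l d v = starPoint l' d' v := by
  by_cases H : (l.state v).IsHalf
  · obtain ⟨h, hv, hh⟩ := id H
    rw [starPoint_of_half hh, starPoint_of_half (hl.symm.trans hh), hd H]
  · rw [starPoint_of_not_isHalf H, starPoint_of_not_isHalf (by rwa [← hl])]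

theorem starPoint_cases (l : Γ.Labelling) (d : V → Icc (0 : ℝ) 1) (v : V) :
    starPoint l d v = Γ.vert v ∨
      ∃ h, Γ.endpt h = v ∧ ∃ r ∈ Ioc (0 : ℝ) 1, starPoint l d v = Γ.halfArc h r := by
  by_cases H : (l.state v).IsHalf
  · obtain ⟨h, hv, hh⟩ := H
    rw [starPoint_of_half hh]
    rcases eq_or_lt_of_le (d v).2.1 with h0 | h0
    · left; rw [← h0, halfArc_zero, hv]
    · exact Or.inr ⟨h, hv, _, ⟨h0, (d v).2.2⟩, rfl⟩
  · exact Or.inl (starPoint_of_not_isHalf H)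

theorem starPoint_inj {v w : V} (h : starPoint l d v = starPoint l d w) : v = w := by
  rcases starPoint_cases l d v with h1 | ⟨k, hk, r, hr, h1⟩ <;>
    rcases starPoint_cases l d w with h2 | ⟨k', hk', r', hr', h2⟩ <;> rw [h1, h2] at h
  · exact Γ.vert_inj h
  · exact absurd h (Γ.vert_ne_arc v _ (side_mem ⟨hr'.1, by linarith [hr'.2]⟩))
  · exact absurd h.symm (Γ.vert_ne_arc w _ (side_mem ⟨hr.1, by linarith [hr.2]⟩))
  · have := (Γ.halfArc_inj_of_lt_two ⟨hr.1, by linarith [hr.2]⟩ ⟨hr'.1, by linarith [hr'.2]⟩ h).1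
    rw [← hk, ← hk', this]

theorem eq_of_starPoint_mem_openStar {v w : V} (h : starPoint l d w ∈ Γ.openStar v 1) :
    w = v := by
  rcases starPoint_cases l d w with h1 | ⟨k, hk, r, hr, h1⟩ <;> rw [h1] at h
  · exact Γ.vert_mem_openStar.1 h
  · rcases h with h | ⟨k', hk', r', hr', h⟩
    · exact absurd h.symm (Γ.vert_ne_arc v _ (side_mem ⟨hr.1, by linarith [hr.2]⟩))
    · have := (Γ.halfArc_inj_of_lt_two ⟨hr.1, by linarith [hr.2]⟩
        ⟨hr'.1, by linarith [hr'.2]⟩ h).1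
      rw [← hk, ← hk', this]

theorem interior_mem {n : ℕ} (i : Fin n) :
    1 + 3 * ((i + 1 : ℝ) / (n + 1)) ∈ Ioo (1 : ℝ) 4 := by
  have h1 : (i : ℝ) + 1 < n + 1 := by exact_mod_cast Nat.succ_lt_succ i.2
  have h2 : (0 : ℝ) < (i + 1 : ℝ) / (n + 1) := by positivity
  have h3 : (i + 1 : ℝ) / (n + 1) < 1 := by rw [div_lt_one (by positivity)]; exact h1
  constructor <;> linarith

theorem starPoint_ne_arc {v : V} {e : E} {s : ℝ} (hs : s ∈ Ioo (1 : ℝ) 4) :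
    starPoint l d v ≠ Γ.arc e s := by
  have hs' : s ∈ Ioo (0 : ℝ) 5 := ⟨by linarith [hs.1], by linarith [hs.2]⟩
  intro h
  rcases starPoint_cases l d v with h1 | ⟨⟨e', b⟩, hk, r, hr, h1⟩ <;> rw [h1] at h
  · exact Γ.vert_ne_arc v e hs' h
  · have := (Γ.arc_inj (side_mem ⟨hr.1, by linarith [hr.2]⟩) hs' h).2
    obtain ⟨hs1, hs2⟩ := hs
    obtain ⟨hr1, hr2⟩ := hr
    cases b <;> simp only [side] at this <;> norm_num at this <;> linarith

theorem particle_injective (l : Γ.Labelling) (d : V → Icc (0 : ℝ) 1) :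
    Function.Injective (particle l d) := by
  rintro (v | ⟨e, i⟩) (w | ⟨e', j⟩) h
  · exact congrArg Sum.inl (Subtype.ext (starPoint_inj h))
  · exact absurd h (starPoint_ne_arc (interior_mem j))
  · exact absurd h.symm (starPoint_ne_arc (interior_mem i))
  · have hi := interior_mem i
    have hj := interior_mem j
    obtain ⟨rfl, h2⟩ := Γ.arc_inj ⟨by linarith [hi.1], by linarith [hi.2]⟩
      ⟨by linarith [hj.1], by linarith [hj.2]⟩ h
    have h3 : (l.edge e + 1 : ℝ) ≠ 0 := by positivity
    field_simp at h2
    have h4 : (i : ℝ) = j := by linarith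
    rw [Fin.ext (by exact_mod_cast h4 : (i : ℕ) = j)]

theorem mem_range_particle_star {v : V} {p : X} (hp : p ∈ Γ.openStar v 1) :
    p ∈ range (particle l d) ↔ l.state v ≠ LocalState.empty ∧ p = starPoint l d v := by
  constructor
  · rintro ⟨w | ⟨e, i⟩, rfl⟩
    · obtain rfl := eq_of_starPoint_mem_openStar hp
      exact ⟨w.2, rfl⟩
    · exact absurd hp (Γ.arc_notMem_openStar (Ioo_subset_Icc_self (interior_mem i)))
  · rintro ⟨h, rfl⟩
    exact ⟨Sum.inl ⟨v, h⟩, rfl⟩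

theorem reduced_particle (l : Γ.Labelling) (d : V → Icc (0 : ℝ) 1) :
    Γ.Reduced (range (particle l d)) := by
  rintro v p ⟨hp, hp'⟩ q ⟨hq, hq'⟩
  rw [((mem_range_particle_star hp').1 hp).2, ((mem_range_particle_star hq').1 hq).2]

theorem starPoint_mem_range {v : V} (h : l.state v ≠ LocalState.empty) :
    starPoint l d v ∈ range (particle l d) := ⟨Sum.inl ⟨v, h⟩, rfl⟩

theorem not_isHalf_of_eq_vertex {v : V} (h : l.state v = LocalState.vertex) :
    ¬ (l.state v).IsHalf := by
  rintro ⟨k, hk, h'⟩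
  rw [h] at h'
  cases h'

theorem not_isHalf_of_eq_empty {v : V} (h : l.state v = LocalState.empty) :
    ¬ (l.state v).IsHalf := by
  rintro ⟨k, hk, h'⟩
  rw [h] at h'
  cases h'

theorem ne_empty_of_isHalf {v : V} (h : (l.state v).IsHalf) : l.state v ≠ LocalState.empty :=
  fun h' => not_isHalf_of_eq_empty h' h

theorem range_particle_star_eq_empty {v : V}
    (h : l.state v = LocalState.empty ∨ ((l.state v).IsHalf ∧ (d v : ℝ) = 1)) :
    range (particle l d) ∩ Γ.openStar v 1 = ∅ := by
  rw [eq_empty_iff_forall_notMem]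
  rintro p ⟨hp, hp'⟩
  obtain ⟨h1, rfl⟩ := (mem_range_particle_star hp').1 hp
  rcases h with h | ⟨⟨k, hk, h⟩, h2⟩
  · exact h1 h
  · rw [starPoint_of_half h, h2] at hp'
    refine Γ.arc_notMem_openStar ?_ hp'
    cases k.2 <;> norm_num

/-- The coordinates `d` extend the coordinates of a point of the cube of `l` to all vertices by `0`
at occupied vertices and `1` at empty ones. -/
structure Adapted (l : Γ.Labelling) (d : V → Icc (0 : ℝ) 1) : Prop where
  vertex : ∀ v, l.state v = LocalState.vertex → (d v : ℝ) = 0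
  empty : ∀ v, l.state v = LocalState.empty → (d v : ℝ) = 1

theorem Adapted.starCoord_eq (h : Adapted l d) : Γ.starCoord (range (particle l d)) = d := by
  have hred := reduced_particle l d
  funext v
  refine Subtype.ext ?_
  rcases hs : l.state v with _ | _ | ⟨k, hk⟩
  · rw [starCoord_of_empty (range_particle_star_eq_empty (Or.inl hs)), h.empty v hs]; rfl
  · have hv : Γ.vert v ∈ range (particle l d) := by
      rw [← starPoint_of_not_isHalf (d := d) (not_isHalf_of_eq_vertex hs)]
      exact starPoint_mem_range (by rw [hs]; simp)
    rw [hred.starCoord_of_vert hv, h.vertex v hs]; rfl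
  · have hmem : Γ.halfArc k (d v) ∈ range (particle l d) := by
      rw [← starPoint_of_half hs]
      exact starPoint_mem_range (by rw [hs]; simp)
    rcases eq_or_lt_of_le (d v).2.1 with h0 | h0
    · rw [← h0, halfArc_zero, hk] at hmem
      rw [hred.starCoord_of_vert hmem, ← h0]; rfl
    rcases eq_or_lt_of_le (d v).2.2 with h1 | h1
    · rw [starCoord_of_empty (range_particle_star_eq_empty (Or.inr ⟨⟨k, hk, hs⟩, h1⟩)), h1]; rfl
    · exact hred.starCoord_of_half hk ⟨h0, h1⟩ hmem

open Classical in
/-- The sum over the particles of the standard realization of a function that is supported on one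
open edge. -/
theorem total_particle [Finite V] [Finite E] (e : E) {φ : X → ℝ}
    (hφ : ∀ p, φ p ≠ 0 → ∃ s ∈ Ioo (0 : ℝ) 5, p = Γ.arc e s) :
    total φ (range (particle l d)) =
      ∑ i : Fin (l.edge e), φ (Γ.arc e (1 + 3 * ((i + 1 : ℝ) / (l.edge e + 1)))) +
        l.part (fun v => φ (starPoint l d v)) (e, false) +
          l.part (fun v => φ (starPoint l d v)) (e, true) := by
  cases nonempty_fintype V
  cases nonempty_fintype E
  have hvert : ∀ v, φ (Γ.vert v) = 0 := fun v => by
    by_contra hn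
    obtain ⟨s, hs, h⟩ := hφ _ hn
    exact Γ.vert_ne_arc v e hs h
  have harc : ∀ e', e' ≠ e → ∀ s ∈ Ioo (0 : ℝ) 5, φ (Γ.arc e' s) = 0 := fun e' he s hs => by
    by_contra hn
    obtain ⟨s', hs', h⟩ := hφ _ hn
    exact he (Γ.arc_inj hs hs' h).1
  rw [total_range φ (particle_injective l d), Fintype.sum_sum_type, add_comm, add_assoc]
  congr 1
  · rw [Fintype.sum_sigma, Finset.sum_eq_single_of_mem e (Finset.mem_univ e)]
    · rfl
    · intro e' _ he'
      refine Finset.sum_eq_zero fun i _ => harc e' he' _ ?_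
      have hi := interior_mem i
      exact ⟨by linarith [hi.1], by linarith [hi.2]⟩
  · -- at each vertex at most one of the two half-edges of `e` contributes
    have hstar : ∀ v, φ (starPoint l d v) =
        ∑ b : Bool, if ∃ hv : Γ.endpt (e, b) = v, l.state v = LocalState.half (e, b) hv then
          φ (starPoint l d v) else 0 := by
      intro v
      rw [← Finset.sum_filter]
      by_cases hz : φ (starPoint l d v) = 0
      · rw [hz]; simp
      obtain ⟨s, hs, hsv⟩ := hφ _ hz
      have hH : (l.state v).IsHalf := by
        by_contra hn
        rw [starPoint_of_not_isHalf hn, hvert] at hz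
        exact hz rfl
      obtain ⟨⟨e', b⟩, hv, hh⟩ := hH
      have he : e' = e := by
        rcases starPoint_cases l d v with h1 | ⟨k, hk, r, hr, h1⟩
        · rw [h1, hvert] at hz; exact absurd rfl hz
        · rcases eq_or_lt_of_le (d v).2.1 with h0 | h0
          · rw [starPoint_of_half hh, ← h0, halfArc_zero, hvert] at hz; exact absurd rfl hz
          · rw [starPoint_of_half hh] at hsv
            exact (Γ.arc_inj (side_mem ⟨h0, by linarith [(d v).2.2]⟩) hs hsv).1
      subst he
      have : (Finset.univ : Finset Bool).filter (fun b => ∃ hv : Γ.endpt (e', b) = v,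
          l.state v = LocalState.half (e', b) hv) = {b} := by
        ext b'
        simp only [Finset.mem_filter, Finset.mem_univ, true_and, Finset.mem_singleton]
        constructor
        · rintro ⟨hv', hh'⟩
          have := LocalState.half_inj (hh.symm.trans hh')
          exact (congrArg Prod.snd this).symm
        · rintro rfl; exact ⟨hv, hh⟩
      rw [this, Finset.sum_singleton]
    have hpart : ∀ b, ∑ v, (if ∃ hv : Γ.endpt (e, b) = v, l.state v = LocalState.half (e, b) hv
        then φ (starPoint l d v) else 0) = l.part (fun v => φ (starPoint l d v)) (e, b) := by
      intro b
      rw [Finset.sum_eq_single_of_mem (Γ.endpt (e, b)) (Finset.mem_univ _)]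
      · simp [Labelling.part]
      · intro v _ hv
        exact if_neg fun h => hv h.1.symm
    have hsub : ∑ v : {v // l.state v ≠ LocalState.empty}, φ (particle l d (Sum.inl v)) =
        ∑ v, φ (starPoint l d v) := by
      rw [← Finset.sum_filter_of_ne (p := fun v => l.state v ≠ LocalState.empty)]
      · exact (Finset.sum_subtype _ (by simp) fun v => φ (starPoint l d v)).symm
      · intro v _ hv h
        rw [starPoint_of_not_isHalf (not_isHalf_of_eq_empty h), hvert] at hv
        exact hv rfl
    rw [hsub, Finset.sum_congr rfl fun v _ => hstar v, Finset.sum_comm, Fintype.sum_bool, hpart,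
      hpart, add_comm]

theorem Labelling.part_congr' {f f' : V → ℝ} {h : E × Bool}
    (hf : ∀ v hv, l.state v = LocalState.half h hv → f v = f' v) : l.part f h = l.part f' h := by
  unfold Labelling.part
  split_ifs with H
  · exact hf _ rfl H
  · rfl

theorem Adapted.compat [Finite V] [Finite E] (h : Adapted l d) :
    Compat l (range (particle l d)) := by
  have hred := reduced_particle l d
  refine ⟨fun v hv => ?_, fun v hv => ?_, fun v k hk hv => ?_, fun e => ?_⟩
  · rw [h.starCoord_eq]; exact h.vertex v hv
  · rw [h.starCoord_eq]; exact h.empty v hv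
  · rw [h.starCoord_eq]
    have hmem : Γ.halfArc k (d v) ∈ range (particle l d) := by
      rw [← starPoint_of_half hv]
      exact starPoint_mem_range (by rw [hv]; simp)
    have htent : ∀ p, p ∉ Γ.openStar v 1 → Γ.tent k p = 0 := by
      intro p hp
      exact Γ.tent_eq_zero (by rwa [hk])
    rcases eq_or_lt_of_le (d v).2.1 with h0 | h0
    · rw [← h0, halfArc_zero, hk] at hmem
      rw [hred.total_eq hmem (Γ.vert_mem_openStar_self v) htent, tent_vert, ← h0]
      ring
    rcases eq_or_lt_of_le (d v).2.2 with h1 | h1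
    · rw [total_eq_zero_of_star (range_particle_star_eq_empty (Or.inr ⟨⟨k, hk, hv⟩, h1⟩)) htent,
        h1]
      ring
    · exact hred.total_tent ⟨h0, h1⟩ hmem
  · rw [h.starCoord_eq, total_particle e (Γ.edgeMass_support e)]
    have hpart : ∀ b, l.part (fun v => Γ.edgeMass e (starPoint l d v)) (e, b) =
        l.part (fun v => (d v : ℝ)) (e, b) := by
      intro b
      refine Labelling.part_congr' fun v hv hh => ?_
      obtain ⟨h0, h1⟩ := (d v).2
      rw [starPoint_of_half hh, halfArc_eq]
      cases b
      · simp only [side, Bool.false_eq_true, if_false]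
        rw [Γ.edgeMass_arc e ⟨h0, by linarith⟩, min_eq_left (by linarith : (d v : ℝ) ≤ 5 - d v),
          min_eq_right h1]
      · simp only [side, if_true]
        rw [Γ.edgeMass_arc e ⟨by linarith, by linarith⟩, sub_sub_cancel,
          min_eq_right (by linarith : (d v : ℝ) ≤ 5 - d v), min_eq_right h1]
    have hint : ∀ i : Fin (l.edge e),
        Γ.edgeMass e (Γ.arc e (1 + 3 * ((i + 1 : ℝ) / (l.edge e + 1)))) = 1 := by
      intro i
      have hi := interior_mem i
      rw [Γ.edgeMass_arc e ⟨by linarith [hi.1], by linarith [hi.2]⟩]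
      exact min_eq_left (le_min hi.1.le (by linarith [hi.2]))
    rw [hpart, hpart, Finset.sum_congr rfl fun i _ => hint i]
    simp

open Classical in
/-- A particle at distance `0` from a vertex is at the vertex, not on the open edge. -/
theorem card_onEdge_particle [Finite V] [Finite E] (e : E) :
    ((Γ.onEdge (range (particle l d)) e).card : ℝ) = l.edge e +
      l.part (fun v => if (d v : ℝ) = 0 then 0 else 1) (e, false) +
        l.part (fun v => if (d v : ℝ) = 0 then 0 else 1) (e, true) := by
  let φ : X → ℝ := Γ.extend (fun _ => 0) fun e' _ => if e' = e then 1 else 0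
  have hvert : ∀ v, φ (Γ.vert v) = 0 := fun v => Γ.extend_vert _ _ v
  have harc : ∀ s ∈ Ioo (0 : ℝ) 5, φ (Γ.arc e s) = 1 := fun s hs =>
    (Γ.extend_arc _ _ e hs).trans (if_pos rfl)
  have hφ : ∀ p, φ p ≠ 0 → ∃ s ∈ Ioo (0 : ℝ) 5, p = Γ.arc e s := by
    intro p hp
    rcases Γ.exists_eq p with ⟨w, rfl⟩ | ⟨e', s, hs, rfl⟩
    · exact absurd (hvert w) hp
    · simp only [φ, extend_arc _ _ _ _ hs] at hp
      split_ifs at hp with h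
      · exact ⟨s, hs, by rw [h]⟩
      · exact absurd rfl hp
  have h1 : total φ (range (particle l d)) = (Γ.onEdge (range (particle l d)) e).card := by
    rw [Γ.total_eq_sum_onEdge (S := range (particle l d)) (finite_range _) e hφ,
      Finset.sum_congr rfl fun s hs => harc s (Γ.onEdge_subset _ e s hs)]
    simp
  have hpart : ∀ b, l.part (fun v => φ (starPoint l d v)) (e, b) =
      l.part (fun v => if (d v : ℝ) = 0 then 0 else 1) (e, b) := by
    intro b
    refine Labelling.part_congr' fun v hv hh => ?_
    rw [starPoint_of_half hh]
    split_ifs with h0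
    · rw [h0, halfArc_zero, hvert]
    · have h0' := lt_of_le_of_ne (d v).2.1 (Ne.symm h0)
      exact harc _ (side_mem ⟨h0', by linarith [(d v).2.2]⟩)
  rw [← h1, total_particle e hφ, hpart, hpart, Finset.sum_congr rfl fun i _ => harc _ ?_]
  · simp
  · have hi := interior_mem i
    exact ⟨by linarith [hi.1], by linarith [hi.2]⟩

open Classical in
/-- The coordinates of a point of a cube, extended to all vertices by `0` at occupied vertices and
`1` at empty ones. -/
def extCoord (p : Γ.Cubes) (v : V) : Icc (0 : ℝ) 1 :=
  if H : (p.1.state v).IsHalf then p.2 ⟨v, H⟩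
  else if p.1.state v = LocalState.vertex then 0 else 1

theorem extCoord_of_isHalf {p : Γ.Cubes} {v : V} (H : (p.1.state v).IsHalf) :
    extCoord p v = p.2 ⟨v, H⟩ := dif_pos H

theorem adapted_extCoord (p : Γ.Cubes) : Adapted p.1 (extCoord p) where
  vertex v hv := by
    rw [extCoord, dif_neg (not_isHalf_of_eq_vertex hv), if_pos hv]; rfl
  empty v hv := by
    rw [extCoord, dif_neg (not_isHalf_of_eq_empty hv), if_neg (by rw [hv]; simp)]; rfl

theorem cubePoint_extCoord (p : Γ.Cubes) : cubePoint p.1 (extCoord p) = p := by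
  obtain ⟨l, c⟩ := p
  unfold cubePoint
  congr 1
  exact funext fun v => extCoord_of_isHalf v.2

theorem Adapted.extCoord_cubePoint (h : Adapted l d) : extCoord (cubePoint l d) = d := by
  funext v
  rcases hs : l.state v with _ | _ | ⟨k, hk⟩
  · exact Subtype.ext (((adapted_extCoord (cubePoint l d)).empty v hs).trans (h.empty v hs).symm)
  · exact Subtype.ext (((adapted_extCoord (cubePoint l d)).vertex v hs).trans
      (h.vertex v hs).symm)
  · exact extCoord_of_isHalf (p := cubePoint l d) ⟨k, hk, hs⟩

/-- The standard realization of a point of a cube as a configuration. -/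
def realize [Finite V] [Finite E] (p : Γ.Cubes) : Conf X :=
  ⟨Nat.card (ParticleIndex p.1), ⟦⟨particle p.1 (extCoord p) ∘ (Finite.equivFin _).symm,
    (particle_injective _ _).comp (Finite.equivFin _).symm.injective⟩⟧⟩

theorem support_realize [Finite V] [Finite E] (p : Γ.Cubes) :
    (realize p).2.support = range (particle p.1 (extCoord p)) :=
  (Finite.equivFin (ParticleIndex p.1)).symm.surjective.range_comp (particle p.1 (extCoord p))

theorem continuous_side (b : Bool) : Continuous (side b) := by
  cases b
  · exact continuous_id
  · exact continuous_const.sub continuous_id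

theorem continuous_realize [Finite V] [Finite E] :
    Continuous (realize : Γ.Cubes → Conf X) := by
  classical
  refine continuous_sigma fun l => ?_
  have hext : ∀ v, Continuous fun c : l.Cube => extCoord (⟨l, c⟩ : Γ.Cubes) v := by
    intro v
    by_cases H : (l.state v).IsHalf
    · have : (fun c : l.Cube => extCoord (⟨l, c⟩ : Γ.Cubes) v) = fun c => c ⟨v, H⟩ :=
        funext fun c => dif_pos H
      rw [this]
      exact continuous_apply _
    · have : (fun c : l.Cube => extCoord (⟨l, c⟩ : Γ.Cubes) v) =
          fun _ => if l.state v = LocalState.vertex then 0 else 1 := funext fun c => dif_neg H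
      rw [this]
      exact continuous_const
  have hpt : ∀ i : ParticleIndex l, Continuous fun c : l.Cube =>
      particle l (extCoord (⟨l, c⟩ : Γ.Cubes)) i := by
    rintro (⟨v, hv⟩ | ⟨e, i⟩)
    · change Continuous fun c : l.Cube => starPoint l (extCoord (⟨l, c⟩ : Γ.Cubes)) v
      by_cases H : (l.state v).IsHalf
      · obtain ⟨h, hv, hh⟩ := H
        simp only [starPoint_of_half hh, halfArc_eq]
        refine (Γ.continuousOn_arc h.1).comp_continuous ?_ fun c => ?_
        · exact (continuous_side h.2).comp (continuous_subtype_val.comp (hext v))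
        · have := (extCoord (⟨l, c⟩ : Γ.Cubes) v).2
          cases h.2
          · exact ⟨this.1, by simp only [side]; norm_num; linarith [this.2]⟩
          · exact ⟨by simp only [side]; norm_num; linarith [this.2],
              by simp only [side]; norm_num; linarith [this.1]⟩
      · simp only [starPoint_of_not_isHalf H]
        exact continuous_const
    · exact continuous_const
  have hord : Continuous fun c : l.Cube => (⟨particle l (extCoord (⟨l, c⟩ : Γ.Cubes)) ∘
      (Finite.equivFin _).symm, (particle_injective _ _).comp (Finite.equivFin _).symm.injective⟩ :
        OrdConf (Nat.card (ParticleIndex l)) X) :=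
    Continuous.subtype_mk (continuous_pi fun i => hpt _) _
  exact (continuous_sigmaMk (σ := fun k => UConf k X)).comp
    ((isOpenQuotientMap_uconf _).continuous.comp hord)

theorem isReduced_realize [Finite V] [Finite E] (p : Γ.Cubes) : Γ.IsReduced (realize p).2 := by
  have := reduced_particle p.1 (extCoord p)
  rwa [← support_realize] at this

theorem record_realize [Finite V] [Finite E] (p : Γ.Cubes) :
    Γ.record ⟨realize p, isReduced_realize p⟩ = Quot.mk Γ.Glue p := by
  have hc := (adapted_extCoord p).compat
  have hd := (adapted_extCoord p).starCoord_eq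
  rw [← support_realize] at hc hd
  rw [Compat.record_eq (x := ⟨realize p, isReduced_realize p⟩) hc]
  dsimp only
  rw [hd, cubePoint_extCoord]

/-- Points of cubes that are glued to each other have locally equivalent realizations. -/
theorem locEq_of_glue [Finite V] [Finite E] {p q : Γ.Cubes} (h : Γ.Glue p q) :
    Γ.LocEq (realize p).2.support (realize q).2.support := by
  classical
  rw [support_realize, support_realize]
  obtain ⟨v, k, hk, hq, hpq, hstate, hcoord⟩ := h
  have hqd : extCoord q v = q.2 ⟨v, k, hk, hq⟩ := extCoord_of_isHalf ⟨k, hk, hq⟩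
  have hp : ¬ (p.1.state v).IsHalf := by
    rcases hpq with ⟨h, -⟩ | ⟨h, -⟩
    · exact not_isHalf_of_eq_vertex h
    · exact not_isHalf_of_eq_empty h
  have hd : ∀ w, w ≠ v → (q.1.state w).IsHalf → extCoord p w = extCoord q w := by
    intro w hw H
    have H' : (p.1.state w).IsHalf := by rwa [hstate w hw]
    rw [extCoord_of_isHalf H, extCoord_of_isHalf H', hcoord w H' H]
  refine ⟨fun w => ?_, fun e => ?_⟩
  · ext x
    simp only [mem_inter_iff, and_congr_left_iff]
    intro hx
    rw [mem_range_particle_star hx, mem_range_particle_star hx]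
    by_cases hw : w = v
    · subst hw
      rw [starPoint_of_not_isHalf hp, starPoint_of_half hq, hqd]
      rcases hpq with ⟨h1, -, h2⟩ | ⟨h1, -, -, h2⟩
      · have hne : q.1.state w ≠ LocalState.empty := ne_empty_of_isHalf ⟨k, hk, hq⟩
        rw [h1, h2, Icc.coe_zero, halfArc_zero, hk]
        simp [hne]
      · rw [h1, h2, Icc.coe_one]
        simp only [ne_eq, not_true_eq_false, false_and, false_iff, not_and]
        rintro - rfl
        refine Γ.arc_notMem_openStar ?_ hx
        cases k.2 <;> norm_num
    · rw [hstate w hw, starPoint_congr (hstate w hw) fun H => hd w hw (by rwa [← hstate w hw])]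
  · have hpart := Labelling.part_of_forget (l' := p.1)
      (d := fun v => if (extCoord q v : ℝ) = 0 then 0 else 1)
      (d' := fun v => if (extCoord p v : ℝ) = 0 then 0 else 1) hq hp hstate
      (fun w hw H => by simp only [hd w hw H])
    have h1 := card_onEdge_particle (l := p.1) (d := extCoord p) e
    have h2 := card_onEdge_particle (l := q.1) (d := extCoord q) e
    rw [hpart, hpart] at h1
    suffices ((Γ.onEdge (range (particle p.1 (extCoord p))) e).card : ℝ) =
      (Γ.onEdge (range (particle q.1 (extCoord q))) e).card by exact_mod_cast this
    rw [h1, h2, hqd]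
    obtain ⟨e', b⟩ := k
    rcases hpq with ⟨-, h3, h4⟩ | ⟨-, h3, h4, h5⟩
    · simp [h3, h4]
    · by_cases he : e = e'
      · subst he
        rw [h3, h5]
        cases b
        · simp
        · simp
          ring
      · rw [h4 e he, h5]
        simp [he]

theorem Reduced.adapted_starCoord {S : Set X} (hS : Γ.Reduced S) (hfin : S.Finite) :
    Adapted (Γ.labelling S) (Γ.starCoord S) :=
  ⟨(hS.compat_labelling hfin).vertex, (hS.compat_labelling hfin).empty⟩

/-- A reduced configuration is locally equivalent to the realization of its image. -/
theorem Reduced.locEq_realize [Finite V] [Finite E] {S : Set X} (hS : Γ.Reduced S)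
    (hfin : S.Finite) :
    Γ.LocEq (realize (cubePoint (Γ.labelling S) (Γ.starCoord S))).2.support S := by
  classical
  rw [support_realize, (hS.adapted_starCoord hfin).extCoord_cubePoint]
  change Γ.LocEq (range (particle (Γ.labelling S) (Γ.starCoord S))) S
  refine ⟨fun v => ?_, fun e => ?_⟩
  · rcases Γ.star_cases S v with h | ⟨k, hv, r, hr, h⟩ | h
    · have hs : (Γ.labelling S).state v = LocalState.vertex := localState_of_vert h
      ext x
      simp only [mem_inter_iff, and_congr_left_iff]
      intro hx
      rw [mem_range_particle_star hx, starPoint_of_not_isHalf (not_isHalf_of_eq_vertex hs), hs]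
      constructor
      · rintro ⟨-, rfl⟩; exact h
      · intro hxS
        exact ⟨by simp, hS v ⟨hxS, hx⟩ ⟨h, Γ.vert_mem_openStar_self v⟩⟩
    · have hs : (Γ.labelling S).state v = LocalState.half k hv := hS.localState_of_half hv hr h
      ext x
      simp only [mem_inter_iff, and_congr_left_iff]
      intro hx
      rw [mem_range_particle_star hx, starPoint_of_half hs, hs, hS.starCoord_of_half hv hr h]
      constructor
      · rintro ⟨-, rfl⟩; exact h
      · intro hxS
        exact ⟨by simp, hS v ⟨hxS, hx⟩ ⟨h, Γ.halfArc_mem_openStar hv hr⟩⟩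
    · rw [h, range_particle_star_eq_empty (Or.inl (localState_of_empty h))]
  · have h1 := hS.card_onEdge hfin e
    have h2 := card_onEdge_particle (l := Γ.labelling S) (d := Γ.starCoord S) e
    have hpart : ∀ b, (Γ.labelling S).part
        (fun v => if (Γ.starCoord S v : ℝ) = 0 then 0 else 1) (e, b) =
          (Γ.labelling S).part (fun _ => 1) (e, b) := fun b =>
      Labelling.part_congr' fun v hv hh =>
        if_neg (hS.starCoord_mem_of_isHalf hh).1.1.ne'
    rw [hpart, hpart, ← h1] at h2
    exact_mod_cast h2

/-! ### The homotopy equivalence -/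

theorem isReduced_spreadConf {x : Conf X} (hx : Γ.IsReduced x.2) (t : unitInterval) :
    Γ.IsReduced (Γ.spreadConf t x).2 := by
  have := Reduced.spread (S := x.2.support) hx t.2 x.2.finite_support
  rwa [← support_spreadConf] at this

theorem spreadConf_one_eq {x x' : Conf X} (hx : Γ.IsReduced x.2)
    (h : Γ.LocEq x.2.support x'.2.support) : Γ.spreadConf 1 x = Γ.spreadConf 1 x' := by
  refine Conf.ext_support ?_
  rw [support_spreadConf, support_spreadConf]
  exact h.spread_one_eq hx x.2.finite_support x'.2.finite_support

theorem record_spreadConf_eq {x x' : Conf X} (hx : Γ.IsReduced x.2) (hx' : Γ.IsReduced x'.2)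
    (h : Γ.LocEq x.2.support x'.2.support) (t : unitInterval) :
    Γ.record ⟨Γ.spreadConf t x, isReduced_spreadConf hx t⟩ =
      Γ.record ⟨Γ.spreadConf t x', isReduced_spreadConf hx' t⟩ := by
  refine Γ.record_eq_of_locEq ?_
  simp only [support_spreadConf]
  exact h.spread hx x.2.finite_support x'.2.finite_support t.2

theorem deform_of_isReduced {x : Conf X} (hx : Γ.IsReduced x.2) : Γ.deform x = ⟨x, hx⟩ := by
  have hzero : Γ.expTime x.2.support = fun _ => 0 := by
    funext v
    have h := Γ.isLeast_expTime x.2.finite_support v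
    refine le_antisymm (h.2 ⟨le_rfl, ?_⟩) h.1.1
    have : Γ.push (fun _ => 0) = id := funext Γ.push_zero
    rw [this, image_id]
    exact hx v
  refine Subtype.ext (Conf.ext_support ?_)
  simp only [deform, expandConf, UConf.support_map, hzero]
  have : Γ.push (fun _ => 0) = id := funext Γ.push_zero
  rw [this, image_id]

variable (Γ)

/-- The homotopy inverse of the comparison map: realize a point of a cube in the standard way, and
then spread the particles on each edge, which makes the result compatible with the gluing. -/
def rhoInv [Finite V] [Finite E] (u : Γ.UK) : Conf X :=
  Quot.lift (fun p => Γ.spreadConf 1 (realize p))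
    (fun _ _ h => spreadConf_one_eq (isReduced_realize _) (locEq_of_glue h)) u

theorem continuous_rhoInv [Finite V] [Finite E] [T2Space X] : Continuous Γ.rhoInv :=
  Γ.isQuotientMap_mk_uk.continuous_iff.2
    ((Γ.continuous_spreadConf.comp (Continuous.prodMk_left 1)).comp continuous_realize)

theorem rhoInv_rho [Finite V] [Finite E] (x : Conf X) :
    Γ.rhoInv (Γ.rho x) = Γ.spreadConf 1 (Γ.deform x).1 := by
  have hS : Γ.Reduced (Γ.deform x).1.2.support := (Γ.deform x).2
  rw [rho, record_eq]
  exact spreadConf_one_eq (isReduced_realize _)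
    (hS.locEq_realize (Γ.deform x).1.2.finite_support)

theorem continuous_rho [Finite V] [Finite E] [T2Space X] : Continuous Γ.rho :=
  Γ.continuous_record.comp Γ.continuous_deform

theorem rhoInv_comp_rho_homotopic [Finite V] [Finite E] [T2Space X] :
    (ContinuousMap.comp ⟨Γ.rhoInv, Γ.continuous_rhoInv⟩ ⟨Γ.rho, Γ.continuous_rho⟩).Homotopic
      (ContinuousMap.id (Conf X)) := by
  obtain ⟨g, hg, hg'⟩ := Γ.exists_deform_homotopic_id
  obtain ⟨s, hs, hs'⟩ := exists_homotopic_id_of_motion (fun t : unitInterval => Γ.spread t)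
    (fun t S hS => Γ.injOn_spread t.2 hS) Γ.continuous_spread (fun S p => Γ.spread_zero S p)
  have heq : ContinuousMap.comp ⟨Γ.rhoInv, Γ.continuous_rhoInv⟩ ⟨Γ.rho, Γ.continuous_rho⟩ =
      s.comp g := by
    ext1 x
    rw [ContinuousMap.comp_apply, ContinuousMap.comp_apply, hs, hg]
    exact Γ.rhoInv_rho x
  rw [heq]
  exact hs'.comp hg'

/-- The homotopy on `UK(Γ)` from the identity to `rho ∘ rhoInv`: spread the standard realization of
a point for the time `t`, and take the image in `UK(Γ)`. -/
def ukHomotopy [Finite V] [Finite E] (c : Γ.UK × unitInterval) : Γ.UK :=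
  Quot.lift (fun p => Γ.record ⟨Γ.spreadConf c.2 (realize p),
      isReduced_spreadConf (isReduced_realize p) c.2⟩)
    (fun _ _ h => record_spreadConf_eq (isReduced_realize _) (isReduced_realize _)
      (locEq_of_glue h) c.2) c.1

theorem continuous_ukHomotopy [Finite V] [Finite E] [T2Space X] : Continuous Γ.ukHomotopy := by
  refine Γ.isQuotientMap_mk_uk.continuous_lift_prod_left ?_
  exact Γ.continuous_record.comp (Continuous.subtype_mk
    (Γ.continuous_spreadConf.comp (continuous_realize.prodMap continuous_id)) _)

theorem rho_comp_rhoInv_homotopic [Finite V] [Finite E] [T2Space X] :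
    (ContinuousMap.comp ⟨Γ.rho, Γ.continuous_rho⟩ ⟨Γ.rhoInv, Γ.continuous_rhoInv⟩).Homotopic
      (ContinuousMap.id Γ.UK) := by
  refine ContinuousMap.Homotopic.symm
    ⟨⟨⟨_, Γ.continuous_ukHomotopy.comp continuous_swap⟩, fun u => ?_, fun u => ?_⟩⟩
  · induction u using Quot.inductionOn with
    | h p =>
      refine Eq.trans ?_ (record_realize p)
      have : Γ.spreadConf 0 (realize p) = realize p := by
        refine Conf.ext_support ?_
        rw [support_spreadConf]
        have : Γ.spread ((0 : unitInterval) : ℝ) (realize p).2.support = id :=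
          funext fun q => Γ.spread_zero _ q
        rw [this, image_id]
      exact congrArg Γ.record (Subtype.ext this)
  · induction u using Quot.inductionOn with
    | h p =>
      exact (congrArg Γ.record
        (deform_of_isReduced (isReduced_spreadConf (isReduced_realize p) 1))).symm

end TopGraph
end

theorem mainTheorem8 {V E X : Type*} [Finite V] [Finite E] [TopologicalSpace X] [T2Space X]
    (Γ : TopGraph V E X) :
    ∃ φ : ContinuousMap.HomotopyEquiv (Conf X) Γ.UK, ∀ x : Conf X, φ x = Γ.rho x :=
  ⟨⟨⟨Γ.rho, Γ.continuous_rho⟩, ⟨Γ.rhoInv, Γ.continuous_rhoInv⟩, Γ.rhoInv_comp_rho_homotopic,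
    Γ.rho_comp_rhoInv_homotopic⟩, fun _ => rfl⟩
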